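/- **Theorem.** Let $M$ be a noncompact smooth manifold of dimension $n\ge 3$ (Hausdorff, second countable, without boundary, not necessarily connected). Let $\mathrm{Metr}(M)$ denote the set of smooth Riemannian metrics on $M$. Put $p=\frac{2n}{n-2}$ and $a_n=\frac{4(n-1)}{n-2}$. For $g\in\mathrm{Metr}(M)$ and a nonempty open set $U\subseteq M$ let $$Y_U(g)=\inf\left\{\frac{1}{\|v\|_{L^p(g)}^2}\int_U\big(a_n|dv|_g^2+\mathrm{scal}_g\,v^2\big)\,d\mu_g \;:\; v\in C^\infty_c(U,\mathbb{R}_{\ge0})\setminus\{0\}\right\}\in\mathbb{R}\cup\{-\infty\}$$ be the Yamabe constant of the restriction of $g$ to $U$, where $\mathrm{scal}_g$ is the scalar curvature and $\mu_g$ the Riemannian measure of $g$. A compact exhaustion of $M$ is a sequence $(K_i)_{i\in\mathbb{N}}$ of compact subsets of $M$ with union $M$ such that each $K_i$ is contained in the interior of $K_{i+1}$. The fine (strong, Whitney) $C^2$-topology on $\mathrm{Metr}(M)$ is the one in which the sets $\{h\in\mathrm{Metr}(M) : j^2_xh\in W \text{ for all } x\in M\}$, where $W$ runs through the open neighbourhoods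 of $\{j^2_xg : x\in M\}$ in the bundle of $2$-jets of Riemannian metrics on $M$, form a neighbourhood basis at $g$. Then: 1. For every $g\in\mathrm{Metr}(M)$ the limit $Y^\infty_M(g)=\lim_{i\to\infty}Y_{M\setminus K_i}(g)$ exists in $[-\infty,\infty]$ for every compact exhaustion $(K_i)$ of $M$, and does not depend on the exhaustion. 2. The function $Y^\infty_M$ (the Yamabe constant at infinity) is locally constant on $\mathrm{Metr}(M)$ with respect to the fine $C^2$-topology: every metric has a fine $C^2$-neighbourhood on which $Y^\infty_M$ takes a single value (including the case in which this value is $-\infty$). In particular, $Y^\infty_M$ is continuous with respect to the fine $C^2$-topology. -/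

import Mathlib

open Set Filter Topology MeasureTheory
open scoped Manifold ContDiff ENNReal

noncomputable section

namespace YamabeInfinity

/-- The model space `ℝⁿ` with its Euclidean norm. -/
abbrev Model (n : ℕ) : Type := EuclideanSpace ℝ (Fin n)

/-! ### Calculus in coordinates -/

/-- The `k`-th partial derivative of a function on `ℝⁿ`. -/
def pd {n : ℕ} (k : Fin n) (f : Model n → ℝ) (y : Model n) : ℝ :=
  fderiv ℝ f y (EuclideanSpace.single k (1 : ℝ))

/-- The Christoffel symbol `Γᵏᵢⱼ = ½ ∑ₗ gᵏˡ (∂ᵢ gⱼₗ + ∂ⱼ gᵢₗ - ∂ₗ gᵢⱼ)` of a matrix-valued function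
`G = (gᵢⱼ)` on `ℝⁿ`. -/
def christoffel {n : ℕ} (G : Model n → Matrix (Fin n) (Fin n) ℝ) (k i j : Fin n)
    (y : Model n) : ℝ :=
  (1 / 2 : ℝ) * ∑ l, (G y)⁻¹ k l *
    (pd i (fun z => G z j l) y + pd j (fun z => G z i l) y - pd l (fun z => G z i j) y)

/-- The Ricci tensor
`Rᵢⱼ = ∑ₖ (∂ₖ Γᵏᵢⱼ - ∂ⱼ Γᵏᵢₖ) + ∑ₖₗ (Γᵏₖₗ Γˡᵢⱼ - Γᵏⱼₗ Γˡᵢₖ)` in coordinates. -/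
def ricci {n : ℕ} (G : Model n → Matrix (Fin n) (Fin n) ℝ) (i j : Fin n) (y : Model n) : ℝ :=
  ∑ k, (pd k (christoffel G k i j) y - pd j (christoffel G k i k) y) +
    ∑ k, ∑ l, (christoffel G k k l y * christoffel G l i j y -
      christoffel G k j l y * christoffel G l i k y)

/-- The scalar curvature `∑ᵢⱼ gⁱʲ Rᵢⱼ` in coordinates. -/
def scalarCoord {n : ℕ} (G : Model n → Matrix (Fin n) (Fin n) ℝ) (y : Model n) : ℝ :=
  ∑ i, ∑ j, (G y)⁻¹ i j * ricci G i j y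

/-! ### Riemannian metrics -/

/-- The set of (smooth) Riemannian metrics on the smooth manifold `M`. -/
abbrev Metr (n : ℕ) (M : Type*) [TopologicalSpace M] [ChartedSpace (Model n) M]
    [IsManifold (𝓡 n) ∞ M] : Type _ :=
  Bundle.ContMDiffRiemannianMetric (𝓡 n) ∞ (Model n) (fun x : M => TangentSpace (𝓡 n) x)

section Manifold

variable {n : ℕ} {M : Type*} [TopologicalSpace M] [ChartedSpace (Model n) M]
  [IsManifold (𝓡 n) ∞ M]

/-- The matrix `gᵢⱼ = g(∂ᵢ, ∂ⱼ)` of the metric `g` in the chart `c`, as a function on (the target in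
`ℝⁿ` of) the chart. -/
def metricCoord (g : Metr n M) (c : OpenPartialHomeomorph M (Model n)) (y : Model n) :
    Matrix (Fin n) (Fin n) ℝ :=
  fun i j => g.inner (c.symm y)
    (mfderiv (𝓡 n) (𝓡 n) c.symm y (EuclideanSpace.single i (1 : ℝ) : Model n))
    (mfderiv (𝓡 n) (𝓡 n) c.symm y (EuclideanSpace.single j (1 : ℝ) : Model n))

/-- The scalar curvature of `g` at `x`. It does not depend on the chart around `x` in which it is
computed; we use the preferred one. -/
def scal (g : Metr n M) (x : M) : ℝ :=
  scalarCoord (metricCoord g (chartAt (Model n) x)) (chartAt (Model n) x x)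

/-- The measure with density `√det(gᵢⱼ)` with respect to Lebesgue measure in the chart `c`, as a
measure on `M` (which is concentrated on the domain of `c`). -/
def chartVolume [MeasurableSpace M] (g : Metr n M) (c : OpenPartialHomeomorph M (Model n)) :
    Measure M :=
  ((volume.restrict c.target).withDensity
    (fun y => ENNReal.ofReal (Real.sqrt (metricCoord g c y).det))).map c.symm

/-- The Riemannian measure `μ_g`: the smallest measure on `M` which dominates the measures
`√det(gᵢⱼ) dy` of all charts of the atlas. Since the latter agree on overlaps of charts, `μ_g` is
the measure that is given in each chart by the density `√det(gᵢⱼ)`. -/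
def riemMeasure [MeasurableSpace M] (g : Metr n M) : Measure M :=
  ⨆ c ∈ atlas (Model n) M, chartVolume g c

/-- The squared norm `|dv|²_g` of the differential of `v` at `x`, with respect to the (dual) norm
on covectors induced by `g`: the supremum of `(dv(u))²` over `u ∈ TₓM` with `g(u, u) ≤ 1`. -/
def normSqDiff (g : Metr n M) (v : M → ℝ) (x : M) : ℝ :=
  sSup {r : ℝ | ∃ u : TangentSpace (𝓡 n) x, g.inner x u u ≤ 1 ∧
    r = (show ℝ from mfderiv (𝓡 n) 𝓘(ℝ, ℝ) v x u) ^ 2}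

/-! ### The Yamabe constant -/

/-- The exponent `p = 2n / (n - 2)`. -/
def yamabeExponent (n : ℕ) : ℝ := 2 * (n : ℝ) / ((n : ℝ) - 2)

/-- The constant `a = 4 (n - 1) / (n - 2)`. -/
def yamabeCoeff (n : ℕ) : ℝ := 4 * ((n : ℝ) - 1) / ((n : ℝ) - 2)

/-- The norm `‖v‖_{L^q(g)}`. -/
def lqNorm [MeasurableSpace M] (g : Metr n M) (q : ℝ) (v : M → ℝ) : ℝ :=
  (∫ x, |v x| ^ q ∂(riemMeasure g)) ^ (1 / q)

/-- The Yamabe functional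
`‖v‖_{L^p(g)}⁻² ∫_M (a |dv|²_g + scal_g v²) dμ_g`. -/
def yamabeFunctional [MeasurableSpace M] (g : Metr n M) (v : M → ℝ) : ℝ :=
  (1 / lqNorm g (yamabeExponent n) v ^ 2) *
    ∫ x, (yamabeCoeff n * normSqDiff g v x + scal g x * v x ^ 2) ∂(riemMeasure g)

/-- For `U ⊆ M` open, the set `C^∞_c(U, ℝ_{≥0}) ∖ {0}`; a function in it is identified with its
extension by zero, a smooth function on `M` whose support is compact and contained in `U`. -/
def testFunctions (n : ℕ) {M : Type*} [TopologicalSpace M] [ChartedSpace (Model n) M]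
    (U : Set M) : Set (M → ℝ) :=
  {v | ContMDiff (𝓡 n) 𝓘(ℝ, ℝ) ∞ v ∧ HasCompactSupport v ∧ tsupport v ⊆ U ∧
    (∀ x, 0 ≤ v x) ∧ v ≠ 0}

/-- The Yamabe constant `Y_U(g) ∈ ℝ ∪ {-∞}` of (the restriction to `U` of) `g`, for `U ⊆ M` open
and nonempty: the infimum of the Yamabe functional over `C^∞_c(U, ℝ_{≥0}) ∖ {0}`. -/
def yamabeConstant [MeasurableSpace M] (g : Metr n M) (U : Set M) : EReal :=
  ⨅ v ∈ testFunctions n U, ((yamabeFunctional g v : ℝ) : EReal)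

variable (n M) in
/-- Some compact exhaustion of `M`. -/
def someExhaustion [T2Space M] [SecondCountableTopology M] : CompactExhaustion M :=
  haveI : LocallyCompactSpace M := ChartedSpace.locallyCompactSpace (Model n) M
  CompactExhaustion.choice M

/-- The Yamabe constant at infinity, the limit of `Y_{M ∖ Kᵢ}(g)` as `i → ∞`, for a chosen compact
exhaustion `(Kᵢ)` of `M`. -/
def yamabeInfinity [T2Space M] [SecondCountableTopology M] [MeasurableSpace M] (g : Metr n M) :
    EReal :=
  limUnder atTop (fun i : ℕ => yamabeConstant g (someExhaustion n M i)ᶜ)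

/-! ### The fine C²-topology -/

/-- The coordinates of the 2-jet of `h` at `x` in the chart `c`: the position `c x` and, there, the
components `hᵢⱼ`, their first and their second partial derivatives. -/
def jetCoord (c : OpenPartialHomeomorph M (Model n)) (h : Metr n M) (x : M) :
    Model n × (Fin n → Fin n → ℝ) × (Fin n → Fin n → Fin n → ℝ) ×
      (Fin n → Fin n → Fin n → Fin n → ℝ) :=
  (c x,
   fun i j => metricCoord h c (c x) i j,
   fun k i j => pd k (fun y => metricCoord h c y i j) (c x),
   fun l k i j => pd l (pd k (fun y => metricCoord h c y i j)) (c x))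

variable (n M) in
/-- Two pairs `(x, h)`, `(x', h')` of a point and a metric define the same 2-jet iff `x = x'` and
the components of `h`, `h'` agree at `x` up to second order in the charts around `x`. -/
def jetSetoid : Setoid (M × Metr n M) where
  r a b := a.1 = b.1 ∧ ∀ c ∈ atlas (Model n) M, a.1 ∈ c.source →
    jetCoord c a.2 a.1 = jetCoord c b.2 b.1
  iseqv :=
    { refl := fun _ => ⟨rfl, fun _ _ _ => rfl⟩
      symm := fun h => ⟨h.1.symm, fun c hc hx => (h.2 c hc (h.1 ▸ hx)).symm⟩
      trans := fun h k =>
        ⟨h.1.trans k.1, fun c hc hx => (h.2 c hc hx).trans (k.2 c hc (h.1 ▸ hx))⟩ }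

variable (n M) in
/-- The total space of the bundle of 2-jets of Riemannian metrics on `M`. (Every 2-jet at a point of
a Riemannian metric that is defined near that point is the jet of a metric on all of `M`.) -/
def TwoJet : Type _ := Quotient (jetSetoid n M)

/-- The 2-jet prolongation `x ↦ j²ₓh` of the metric `h`, a section of the 2-jet bundle. -/
def j2 (h : Metr n M) (x : M) : TwoJet n M := Quotient.mk (jetSetoid n M) (x, h)

/-- The topology of the 2-jet bundle: it is generated by the sets that are described by an open
condition in the jet coordinates over the domain of a chart. -/
instance twoJetTopology : TopologicalSpace (TwoJet n M) :=
  TopologicalSpace.generateFrom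
    {S | ∃ c ∈ atlas (Model n) M, ∃ W, IsOpen W ∧
      S = {η | ∃ (x : M) (h : Metr n M), x ∈ c.source ∧ jetCoord c h x ∈ W ∧ η = j2 h x}}

/-- The fine (also called strong, or Whitney) C²-topology on the set of Riemannian metrics: the sets
`{h | graph (j²h) ⊆ U}`, where `U` runs through the open neighbourhoods of `graph (j²g)` in the
2-jet bundle, form a neighbourhood basis at `g`. -/
instance fineC2Topology : TopologicalSpace (Metr n M) where
  IsOpen S := ∀ g ∈ S, ∃ U : Set (TwoJet n M), IsOpen U ∧ range (j2 g) ⊆ U ∧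
    {h : Metr n M | range (j2 h) ⊆ U} ⊆ S
  isOpen_univ := fun _ _ => ⟨univ, isOpen_univ, subset_univ _, subset_univ _⟩
  isOpen_inter := by
    rintro S T hS hT g ⟨hgS, hgT⟩
    obtain ⟨U, hU, hgU, hUS⟩ := hS g hgS
    obtain ⟨V, hV, hgV, hVT⟩ := hT g hgT
    exact ⟨U ∩ V, hU.inter hV, subset_inter hgU hgV, fun h hh =>
      ⟨hUS (hh.trans inter_subset_left), hVT (hh.trans inter_subset_right)⟩⟩
  isOpen_sUnion := by
    rintro 𝒮 h𝒮 g ⟨S, hS, hgS⟩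
    obtain ⟨U, hU, hgU, hUS⟩ := h𝒮 S hS g hgS
    exact ⟨U, hU, hgU, fun h hh => ⟨S, hS, hUS hh⟩⟩

end Manifold

end YamabeInfinity

end

/-!
The Yamabe constants `Y_{M ∖ K}(g)` grow with the compact set `K`, so the limit along any compact
exhaustion is their supremum `supYamabe g` over all compact sets `K` (`tendsto_supYamabe`). What has
to be shown is that this supremum is locally constant.

Given `g`, fix a smooth function `τ : M → (0, 1]` which tends to zero at infinity so rapidly that
the weight `|dτ|² + τ² (1 + |scal_g|)` is in `L^{n/2}` (`exists_integrable_weight`). Call `h` close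
to `g` when `h`, its volume density and its scalar curvature differ from those of `g` by at most
`τ³`, relatively or absolutely (`Close`). All of these are continuous functions of the 2-jet of the
metric; the positive function `τ³` may decay as fast as it likes, so metrics close to `g` contain a
fine C²-neighbourhood of `g` (`exists_isOpen_forall_close`). Closeness is symmetric and the weights
of close metrics are comparable (`Close.integrable_weight`), hence it is enough to see that
`supYamabe g ≤ supYamabe h` for close metrics (`Close.supYamabe_le`).

So assume that the energy satisfies `E_g(v) ≥ r' ‖v‖²` (with the `L^p`-norm) for test functions
supported outside a compact set, and let `r < r'`. The energy of `h` differs from that of `g` by at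
most a multiple of `∫ τ³ (a |dv|² + (1 + |scal_g|) v²)`, which involves the gradient of `v` and is
not controlled by the Yamabe constant if this is negative or if the scalar curvature is unbounded
below. To control it, localize with the quadratic partition of unity `sin² τ + cos² τ = 1`:
`E_g(v) = E_g(v sin τ) + E_g(v cos τ) - a ∫ |dτ|² v²` (`energyDensity_sin_add_cos`). The term with
`cos τ` is bounded below by `-|r'| ‖v‖²`; the last one is bounded by a multiple of `‖v‖²` by Hölder's
inequality, as `|dτ|²` is in `L^{n/2}`; and `E_g(v sin τ)` dominates
`¼ ∫ τ² (a |dv|² + (1 + |scal_g|) v²)` up to the weight and Hölder's inequality again. Therefore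
`∫ τ² (a |dv|² + (1 + |scal_g|) v²) ≤ 4 E_g(v) + B ‖v‖²` (`exists_integral_absDensity_le`). Far out
`τ³ ≤ ε τ²` with `ε` as small as required, and the error is absorbed (`Close.exists_isCompact`). No
assumption on the value of the supremum enters, so `-∞` needs no separate treatment.

The scalar curvature and the Riemannian measure are defined through charts. That they do not depend
on the charts (`scal_eq`, `riemMeasure_eq_chartVolume`) rests on the transformation rules of the
curvature and of the density under a change of coordinates (`scalarCoord_transform`,
`chartDensity_transition`). For the former, the Ricci tensor is written as a trace of the
coordinate-free curvature `curv` of a connection on an open subset of a normed space.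
-/

noncomputable section

namespace YamabeInfinity

/-! ### Curvature of a connection form, and its behaviour under a change of coordinates -/

section Abstract

variable {E : Type*} [NormedAddCommGroup E] [NormedSpace ℝ E]

/-- The Koszul expression `(∂_u G)(v, w) + (∂_v G)(u, w) - (∂_w G)(u, v)`. -/
def koszul (G : E → E →L[ℝ] E →L[ℝ] ℝ) (y u v w : E) : ℝ :=
  fderiv ℝ G y u v w + fderiv ℝ G y v u w - fderiv ℝ G y w u v

/-- The curvature `R(w, u)v` of the connection `D + Γ`, where `D` is the flat connection of `E`. -/
def curv (Γ : E → E →L[ℝ] E →L[ℝ] E) (y w u v : E) : E :=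
  fderiv ℝ Γ y w u v - fderiv ℝ Γ y u w v + Γ y w (Γ y u v) - Γ y u (Γ y w v)

/-- The derivative of the pull-back `φ^*G` of a field of bilinear maps. Here `A` is the differential
of `φ` and `A1` is its second derivative at `y`. -/
lemma fderiv_bilin_pullback {F : Type*} [NormedAddCommGroup F] [NormedSpace ℝ F]
    {G G' : E → E →L[ℝ] E →L[ℝ] F} {φ : E → E}
    {A : E → E →L[ℝ] E} {A1 : E →L[ℝ] E →L[ℝ] E} {y : E} (hφ : HasFDerivAt φ (A y) y)
    (hA : HasFDerivAt A A1 y) (hG : DifferentiableAt ℝ G (φ y)) (hG' : DifferentiableAt ℝ G' y)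
    (h : ∀ᶠ z in 𝓝 y, ∀ u v, G' z u v = G (φ z) (A z u) (A z v)) (w u v : E) :
    fderiv ℝ G' y w u v = fderiv ℝ G (φ y) (A y w) (A y u) (A y v) +
      G (φ y) (A1 w u) (A y v) + G (φ y) (A y u) (A1 w v) := by
  have h1 : HasFDerivAt (fun z => G (φ z)) ((fderiv ℝ G (φ y)).comp (A y)) y :=
    HasFDerivAt.comp (g := G) (f := φ) y hG.hasFDerivAt hφ
  have hAu : ∀ u, HasFDerivAt (fun z => A z u) _ y := fun u =>
    hA.clm_apply (hasFDerivAt_const u y)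
  have h2 := (h1.clm_apply (hAu u)).clm_apply (hAu v)
  have h3 := (hG'.hasFDerivAt.clm_apply (hasFDerivAt_const u y)).clm_apply (hasFDerivAt_const v y)
  have h4 : (fun z => G' z u v) =ᶠ[𝓝 y] fun z => G (φ z) (A z u) (A z v) := by
    filter_upwards [h] with z hz using hz u v
  have h5 := (h2.congr_of_eventuallyEq h4).unique h3
  have h6 := congrArg (fun L => L w) h5
  simp at h6
  rw [← h6]; abel

/-- The transformation law of the Christoffel symbols: it follows from the Koszul formula, since a
bilinear form and its pull-back have related Koszul expressions. -/
lemma christoffel_transform {G G' : E → E →L[ℝ] E →L[ℝ] ℝ} {φ : E → E}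
    {A : E → E →L[ℝ] E} {A1 : E →L[ℝ] E →L[ℝ] E} {y : E} (hφ : HasFDerivAt φ (A y) y)
    (hA : HasFDerivAt A A1 y) (hG : DifferentiableAt ℝ G (φ y)) (hG' : DifferentiableAt ℝ G' y)
    (h : ∀ᶠ z in 𝓝 y, ∀ u v, G' z u v = G (φ z) (A z u) (A z v))
    (hsymm : ∀ u v, A1 u v = A1 v u) (hGs : ∀ u v, G (φ y) u v = G (φ y) v u)
    (hsurj : Function.Surjective (A y))
    (hnd : ∀ u, (∀ w, G (φ y) u w = 0) → u = 0)
    {Γ Γ' : E →L[ℝ] E →L[ℝ] E}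
    (hΓ : ∀ u v w, 2 * G (φ y) (Γ u v) w = koszul G (φ y) u v w)
    (hΓ' : ∀ u v w, 2 * G' y (Γ' u v) w = koszul G' y u v w) (u v : E) :
    A y (Γ' u v) = A1 u v + Γ (A y u) (A y v) := by
  rw [← sub_eq_zero]
  refine hnd _ fun w' => ?_
  obtain ⟨w, rfl⟩ := hsurj w'
  have e := hΓ' u v w
  have e2 := hΓ (A y u) (A y v) (A y w)
  rw [h.self_of_nhds] at e
  simp only [koszul, fderiv_bilin_pullback hφ hA hG hG' h] at e e2
  rw [hsymm v u, hsymm w u, hsymm w v] at e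
  have s1 := hGs (A1 u w) (A y v)
  have s2 := hGs (A1 v w) (A y u)
  simp only [map_sub, map_add, sub_apply, add_apply] at *
  linarith

/-- The curvature of a connection is a tensor. -/
lemma curv_transform {Γ Γ' : E → E →L[ℝ] E →L[ℝ] E} {φ : E → E}
    {A : E → E →L[ℝ] E} {A1 : E → E →L[ℝ] E →L[ℝ] E} {A2 : E →L[ℝ] E →L[ℝ] E →L[ℝ] E} {y : E}
    (hφ : HasFDerivAt φ (A y) y)
    (hA : HasFDerivAt A (A1 y) y) (hA1 : HasFDerivAt A1 A2 y)
    (hΓ : DifferentiableAt ℝ Γ (φ y)) (hΓ' : DifferentiableAt ℝ Γ' y)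
    (h : ∀ᶠ z in 𝓝 y, ∀ u v, A z (Γ' z u v) = A1 z u v + Γ (φ z) (A z u) (A z v))
    (hsymm : ∀ u v, A1 y u v = A1 y v u) (hsymm2 : ∀ u v w, A2 u v w = A2 v u w) (w u v : E) :
    A y (curv Γ' y w u v) = curv Γ (φ y) (A y w) (A y u) (A y v) := by
  have key : ∀ w u v, A1 y w (Γ' y u v) + A y (fderiv ℝ Γ' y w u v) = A2 w u v +
      (fderiv ℝ Γ (φ y) (A y w) (A y u) (A y v) +
      Γ (φ y) (A1 y w u) (A y v) + Γ (φ y) (A y u) (A1 y w v)) := by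
    intro w u v
    have h1 : HasFDerivAt (fun z => Γ (φ z)) ((fderiv ℝ Γ (φ y)).comp (A y)) y :=
      HasFDerivAt.comp (g := Γ) (f := φ) y hΓ.hasFDerivAt hφ
    have hAu : ∀ u, HasFDerivAt (fun z => A z u) _ y := fun u =>
      hA.clm_apply (hasFDerivAt_const u y)
    have h2 := ((hA1.clm_apply (hasFDerivAt_const u y)).clm_apply (hasFDerivAt_const v y)).add
      ((h1.clm_apply (hAu u)).clm_apply (hAu v))
    have h3 := hA.clm_apply
      ((hΓ'.hasFDerivAt.clm_apply (hasFDerivAt_const u y)).clm_apply (hasFDerivAt_const v y))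
    have h4 : (fun z => A z (Γ' z u v)) =ᶠ[𝓝 y]
        fun z => A1 z u v + Γ (φ z) (A z u) (A z v) := by
      filter_upwards [h] with z hz using hz u v
    have h5 := (h3.congr_of_eventuallyEq h4.symm).unique h2
    have h6 := congrArg (fun L => L w) h5
    simp at h6
    rw [add_comm, h6]; abel
  have e1 := key w u v
  have e2 := key u w v
  have hy := h.self_of_nhds
  have e3 : A y (Γ' y w (Γ' y u v)) = A1 y w (Γ' y u v) +
    Γ (φ y) (A y w) (A1 y u v + Γ (φ y) (A y u) (A y v)) := by rw [hy, hy]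
  have e4 : A y (Γ' y u (Γ' y w v)) = A1 y u (Γ' y w v) +
    Γ (φ y) (A y u) (A1 y w v + Γ (φ y) (A y w) (A y v)) := by rw [hy, hy]
  rw [hsymm u w, hsymm2 u w] at e2
  have e1' := eq_sub_of_add_eq' e1
  have e2' := eq_sub_of_add_eq' e2
  simp only [curv, map_sub, map_add, e3, e4, e1', e2']
  abel

end Abstract

/-! ### Smoothness of the coordinate expressions -/

section Coord

variable {n : ℕ}

/-- The standard basis vector `eᵢ` of `ℝⁿ`. -/
abbrev stdVec (i : Fin n) : Model n := EuclideanSpace.single i (1 : ℝ)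

/-- A matrix-valued function on `ℝⁿ` which is, over the open set `T`, the coordinate expression of a
smooth metric. Positivity is relaxed to nondegeneracy; symmetry is demanded on all of `ℝⁿ`, as it
holds for `metricCoord` even where the chart has no meaning. -/
structure IsMetricOn (G : Model n → Matrix (Fin n) (Fin n) ℝ) (T : Set (Model n)) : Prop where
  isOpen : IsOpen T
  smooth : ∀ i j, ContDiffOn ℝ ∞ (fun y => G y i j) T
  symm : ∀ y i j, G y i j = G y j i
  det_ne : ∀ y ∈ T, (G y).det ≠ 0

lemma contDiffOn_pd {f : Model n → ℝ} {T : Set (Model n)} (hT : IsOpen T)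
    (hf : ContDiffOn ℝ ∞ f T) (k : Fin n) : ContDiffOn ℝ ∞ (pd k f) T :=
  (hf.fderiv_of_isOpen hT (by simp)).clm_apply contDiffOn_const

lemma contDiffOn_det {ι : Type*} [Fintype ι] [DecidableEq ι] {E : Type*} [NormedAddCommGroup E]
    [NormedSpace ℝ E] {G : E → Matrix ι ι ℝ} {T : Set E}
    (h : ∀ i j, ContDiffOn ℝ ∞ (fun y => G y i j) T) : ContDiffOn ℝ ∞ (fun y => (G y).det) T := by
  simp only [Matrix.det_apply']
  exact ContDiffOn.sum fun σ _ => contDiffOn_const.mul (contDiffOn_prod fun i _ => h _ _)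

lemma inv_apply_eq_adjugate {ι : Type*} [Fintype ι] [DecidableEq ι] (A : Matrix ι ι ℝ) (i j : ι) :
    A⁻¹ i j = (A.det)⁻¹ * (A.updateRow j (Pi.single i 1)).det := by
  rw [Matrix.inv_def, Matrix.smul_apply, Matrix.adjugate_apply, smul_eq_mul,
    Ring.inverse_eq_inv']

lemma contDiffOn_matrix_inv {ι : Type*} [Fintype ι] [DecidableEq ι] {E : Type*}
    [NormedAddCommGroup E] [NormedSpace ℝ E] {G : E → Matrix ι ι ℝ} {T : Set E}
    (h : ∀ i j, ContDiffOn ℝ ∞ (fun y => G y i j) T) (hd : ∀ y ∈ T, (G y).det ≠ 0) (i j : ι) :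
    ContDiffOn ℝ ∞ (fun y => (G y)⁻¹ i j) T := by
  simp only [inv_apply_eq_adjugate]
  refine ((contDiffOn_det h).inv hd).mul (contDiffOn_det fun k l => ?_)
  by_cases hk : k = j
  · subst hk; simpa using contDiffOn_const
  · simpa [Matrix.updateRow_ne hk] using h k l

namespace IsMetricOn

variable {G : Model n → Matrix (Fin n) (Fin n) ℝ} {T : Set (Model n)} (hG : IsMetricOn G T)
include hG

lemma contDiffOn_inv (i j : Fin n) : ContDiffOn ℝ ∞ (fun y => (G y)⁻¹ i j) T :=
  contDiffOn_matrix_inv hG.smooth hG.det_ne i j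

lemma contDiffOn_christoffel (k i j : Fin n) : ContDiffOn ℝ ∞ (christoffel G k i j) T := by
  unfold christoffel
  refine contDiffOn_const.mul (ContDiffOn.sum fun l _ => (hG.contDiffOn_inv k l).mul ?_)
  exact ((contDiffOn_pd hG.isOpen (hG.smooth _ _) _).add
    (contDiffOn_pd hG.isOpen (hG.smooth _ _) _)).sub (contDiffOn_pd hG.isOpen (hG.smooth _ _) _)

lemma differentiableAt {f : Model n → ℝ} (hf : ContDiffOn ℝ ∞ f T) {y : Model n} (hy : y ∈ T) :
    DifferentiableAt ℝ f y :=
  ((hf.contDiffAt (hG.isOpen.mem_nhds hy)).differentiableAt (by simp))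

lemma christoffel_symm (k i j : Fin n) : christoffel G k i j = christoffel G k j i := by
  have : ∀ i j, (fun z => G z i j) = fun z => G z j i := fun i j => funext fun z => hG.symm z i j
  funext y
  simp only [christoffel]
  rw [this i j]
  congr 1
  refine Finset.sum_congr rfl fun l _ => ?_
  ring

end IsMetricOn

/-! ### Translation between indices and multilinear maps -/

/-- The bilinear form `(u, v) ↦ uᵢ vⱼ`. -/
def coordBil (i j : Fin n) : Model n →L[ℝ] Model n →L[ℝ] ℝ :=
  (EuclideanSpace.proj (𝕜 := ℝ) i : Model n →L[ℝ] ℝ).smulRight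
    (EuclideanSpace.proj (𝕜 := ℝ) j : Model n →L[ℝ] ℝ)

/-- The vector-valued bilinear map `(u, v) ↦ uᵢ vⱼ eₖ`. -/
def coordBilVec (k i j : Fin n) : Model n →L[ℝ] Model n →L[ℝ] Model n :=
  (EuclideanSpace.proj (𝕜 := ℝ) i : Model n →L[ℝ] ℝ).smulRight
    ((EuclideanSpace.proj (𝕜 := ℝ) j : Model n →L[ℝ] ℝ).smulRight (stdVec k))

lemma differentiableAt_smul_const {E F : Type*} [NormedAddCommGroup E] [NormedSpace ℝ E]
    [NormedAddCommGroup F] [NormedSpace ℝ F] {f : E → ℝ} {y : E} (hf : DifferentiableAt ℝ f y)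
    (c : F) : DifferentiableAt ℝ (fun z => f z • c) y := hf.smul_const c

lemma differentiableAt_sum {ι E F : Type*} [Fintype ι] [NormedAddCommGroup E] [NormedSpace ℝ E]
    [NormedAddCommGroup F] [NormedSpace ℝ F] {f : ι → E → F} {y : E}
    (hf : ∀ i, DifferentiableAt ℝ (f i) y) : DifferentiableAt ℝ (fun z => ∑ i, f i z) y :=
  DifferentiableAt.fun_sum fun i _ => hf i

/-- The bilinear form with matrix `G y`. -/
def bil (G : Model n → Matrix (Fin n) (Fin n) ℝ) (y : Model n) : Model n →L[ℝ] Model n →L[ℝ] ℝ :=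
  ∑ i, ∑ j, G y i j • coordBil i j

/-- The Christoffel symbols as a vector-valued bilinear map. -/
def chr (G : Model n → Matrix (Fin n) (Fin n) ℝ) (y : Model n) :
    Model n →L[ℝ] Model n →L[ℝ] Model n :=
  ∑ k, ∑ i, ∑ j, christoffel G k i j y • coordBilVec k i j

lemma bil_apply (G : Model n → Matrix (Fin n) (Fin n) ℝ) (y u v : Model n) :
    bil G y u v = ∑ i, ∑ j, G y i j * (u i * v j) := by
  simp [bil, coordBil]

lemma bil_single (G : Model n → Matrix (Fin n) (Fin n) ℝ) (y : Model n) (i j : Fin n) :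
    bil G y (stdVec i) (stdVec j) = G y i j := by
  simp [bil_apply]

lemma chr_apply (G : Model n → Matrix (Fin n) (Fin n) ℝ) (y u v : Model n) (k : Fin n) :
    chr G y u v k = ∑ i, ∑ j, christoffel G k i j y * (u i * v j) := by
  simp only [chr, coordBilVec, sum_apply, smul_apply, ContinuousLinearMap.smulRight_apply,
    WithLp.ofLp_sum, WithLp.ofLp_smul, Finset.sum_apply, Pi.smul_apply]
  rw [Finset.sum_eq_single k (by intro p _ hp; simp [hp.symm]) (by simp)]
  simp

lemma chr_single (G : Model n → Matrix (Fin n) (Fin n) ℝ) (y : Model n) (k i j : Fin n) :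
    chr G y (stdVec i) (stdVec j) k = christoffel G k i j y := by
  simp [chr_apply]

lemma eq_sum_stdVec (u : Model n) : u = ∑ i, u i • stdVec i := by
  ext k
  simp only [WithLp.ofLp_sum, WithLp.ofLp_smul, Finset.sum_apply, Pi.smul_apply]
  rw [Finset.sum_eq_single k (by intro p _ hp; simp [hp.symm]) (by simp)]
  simp

lemma eq_of_eq_on_stdVec {F : Type*} [AddCommGroup F] [Module ℝ F] {f g : Model n → F}
    (hf : IsLinearMap ℝ f) (hg : IsLinearMap ℝ g) (h : ∀ i, f (stdVec i) = g (stdVec i))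
    (u : Model n) : f u = g u := by
  have : hf.mk' = hg.mk' := by
    refine (EuclideanSpace.basisFun (Fin n) ℝ).toBasis.ext fun i => ?_
    simpa using h i
  exact congrArg (fun L => L u) this

namespace IsMetricOn

variable {G : Model n → Matrix (Fin n) (Fin n) ℝ} {T : Set (Model n)} (hG : IsMetricOn G T)
include hG

lemma differentiableAt_bil {y : Model n} (hy : y ∈ T) : DifferentiableAt ℝ (bil G) y := by
  unfold bil
  exact differentiableAt_sum fun i => differentiableAt_sum fun j =>
    differentiableAt_smul_const (hG.differentiableAt (hG.smooth i j) hy) (coordBil i j)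

lemma differentiableAt_chr {y : Model n} (hy : y ∈ T) : DifferentiableAt ℝ (chr G) y := by
  unfold chr
  exact differentiableAt_sum fun k => differentiableAt_sum fun i => differentiableAt_sum fun j =>
    differentiableAt_smul_const (hG.differentiableAt (hG.contDiffOn_christoffel k i j) hy)
      (coordBilVec k i j)

lemma fderiv_bil_single {y : Model n} (hy : y ∈ T) (w : Model n) (i j : Fin n) :
    fderiv ℝ (bil G) y w (stdVec i) (stdVec j) = fderiv ℝ (fun z => G z i j) y w := by
  have h := ((hG.differentiableAt_bil hy).hasFDerivAt.clm_apply
    (hasFDerivAt_const (stdVec i) y)).clm_apply (hasFDerivAt_const (stdVec j) y)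
  simp only [bil_single] at h
  rw [h.fderiv]
  simp

lemma fderiv_chr_single {y : Model n} (hy : y ∈ T) (w : Model n) (k i j : Fin n) :
    fderiv ℝ (chr G) y w (stdVec i) (stdVec j) k = fderiv ℝ (christoffel G k i j) y w := by
  have h := ((hG.differentiableAt_chr hy).hasFDerivAt.clm_apply
    (hasFDerivAt_const (stdVec i) y)).clm_apply (hasFDerivAt_const (stdVec j) y)
  have h2 := (EuclideanSpace.proj (𝕜 := ℝ) k : Model n →L[ℝ] ℝ).hasFDerivAt.comp y h
  have h3 : (fun z => (chr G z (stdVec i) (stdVec j)) k) = christoffel G k i j := by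
    funext z; exact chr_single G z k i j
  rw [← h3]
  change _ = fderiv ℝ (EuclideanSpace.proj (𝕜 := ℝ) k ∘ _) y w
  rw [h2.fderiv]
  simp

/-- The Koszul formula for the Levi-Civita connection. -/
lemma koszul_chr {y : Model n} (hy : y ∈ T) (u v w : Model n) :
    2 * bil G y (chr G y u v) w = koszul (bil G) y u v w := by
  refine eq_of_eq_on_stdVec (f := fun u => 2 * bil G y (chr G y u v) w)
    (g := fun u => koszul (bil G) y u v w) ⟨fun a b => ?_, fun c a => ?_⟩
    ⟨fun a b => ?_, fun c a => ?_⟩ (fun i => ?_) u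
  · simp; ring
  · simp; ring
  · simp [koszul]; ring
  · simp [koszul]; ring
  refine eq_of_eq_on_stdVec (f := fun v => 2 * bil G y (chr G y (stdVec i) v) w)
    (g := fun v => koszul (bil G) y (stdVec i) v w) ⟨fun a b => ?_, fun c a => ?_⟩
    ⟨fun a b => ?_, fun c a => ?_⟩ (fun j => ?_) v
  · simp; ring
  · simp; ring
  · simp [koszul]; ring
  · simp [koszul]; ring
  refine eq_of_eq_on_stdVec (f := fun w => 2 * bil G y (chr G y (stdVec i) (stdVec j)) w)
    (g := fun w => koszul (bil G) y (stdVec i) (stdVec j) w) ⟨fun a b => ?_, fun c a => ?_⟩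
    ⟨fun a b => ?_, fun c a => ?_⟩ (fun l => ?_) w
  · simp; ring
  · simp; ring
  · simp [koszul]; ring
  · simp [koszul]; ring
  simp only [koszul, hG.fderiv_bil_single hy]
  set K : Fin n → ℝ := fun l => pd i (fun z => G z j l) y + pd j (fun z => G z i l) y
    - pd l (fun z => G z i j) y with hK
  have h1 : ∀ k, chr G y (stdVec i) (stdVec j) k = 1 / 2 * ((G y)⁻¹.mulVec K) k := fun k => by
    rw [chr_single]; rfl
  have h2 : bil G y (chr G y (stdVec i) (stdVec j)) (stdVec l) =
      1 / 2 * ((G y).mulVec ((G y)⁻¹.mulVec K)) l := by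
    rw [bil_apply]
    simp only [h1]
    rw [Matrix.mulVec, dotProduct, Finset.mul_sum]
    refine Finset.sum_congr rfl fun k _ => ?_
    simp only [PiLp.single_apply, mul_ite, mul_one, mul_zero, Finset.sum_ite_eq',
      Finset.mem_univ, if_true]
    rw [hG.symm y k l]; ring
  rw [h2, Matrix.mulVec_mulVec, Matrix.mul_nonsing_inv _ (hG.det_ne y hy).isUnit,
    Matrix.one_mulVec]
  simp only [hK, pd]
  ring

/-- The Ricci tensor is a contraction of the curvature. -/
lemma ricci_eq {y : Model n} (hy : y ∈ T) (i j : Fin n) :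
    ricci G i j y = ∑ k, curv (chr G) y (stdVec k) (stdVec j) (stdVec i) k := by
  have h1 : ∀ a b c k, chr G y (stdVec a) (chr G y (stdVec b) (stdVec c)) k =
      ∑ l, christoffel G k a l y * christoffel G l b c y := by
    intro a b c k
    rw [chr_apply, Finset.sum_eq_single a (by intro p _ hp; simp [hp])
      (by simp)]
    simp [chr_single]
  simp only [ricci, curv]
  rw [← Finset.sum_add_distrib]
  refine Finset.sum_congr rfl fun k _ => ?_
  simp only [PiLp.add_apply, PiLp.sub_apply, hG.fderiv_chr_single hy, h1, pd,
    Finset.sum_sub_distrib]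
  rw [hG.christoffel_symm k i j, hG.christoffel_symm k i k]
  simp only [fun l => hG.christoffel_symm l i j, fun l => hG.christoffel_symm l i k]
  ring

end IsMetricOn

end Coord

/-! ### Invariance of the scalar curvature under a change of coordinates -/

section Invariance

lemma two_le_smooth : minSmoothness ℝ 2 ≤ (∞ : WithTop ℕ∞) := by
  simp only [minSmoothness_of_isRCLikeNormedField]
  exact WithTop.coe_le_coe.2 (le_top (a := (2 : ℕ∞)))

variable {n : ℕ}

lemma IsMetricOn.bil_symm {G : Model n → Matrix (Fin n) (Fin n) ℝ} {T : Set (Model n)}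
    (hG : IsMetricOn G T) (y u v : Model n) : bil G y u v = bil G y v u := by
  rw [bil_apply, bil_apply, Finset.sum_comm]
  refine Finset.sum_congr rfl fun i _ => Finset.sum_congr rfl fun j _ => ?_
  rw [hG.symm y i j]; ring

lemma IsMetricOn.bil_nondegenerate {G : Model n → Matrix (Fin n) (Fin n) ℝ} {T : Set (Model n)}
    (hG : IsMetricOn G T) {y : Model n} (hy : y ∈ T) (u : Model n)
    (h : ∀ w, bil G y u w = 0) : u = 0 := by
  have h1 : (G y).mulVec u.ofLp = 0 := by
    funext j
    have := h (stdVec j)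
    rw [hG.bil_symm, bil_apply] at this
    simpa [Matrix.mulVec, dotProduct, Finset.sum_eq_single j] using this
  have h2 := Matrix.eq_zero_of_mulVec_eq_zero (hG.det_ne y hy) h1
  ext k
  simpa using congrFun h2 k

/-- The linear map `w ↦ R(w, u)v`. -/
def curvLin (Γ : Model n → Model n →L[ℝ] Model n →L[ℝ] Model n) (y u v : Model n) :
    Model n →ₗ[ℝ] Model n where
  toFun w := curv Γ y w u v
  map_add' a b := by simp [curv]; abel
  map_smul' c a := by simp [curv, smul_sub, smul_add]

lemma trace_curvLin (Γ : Model n → Model n →L[ℝ] Model n →L[ℝ] Model n) (y u v : Model n) :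
    LinearMap.trace ℝ _ (curvLin Γ y u v) = ∑ k, curv Γ y (stdVec k) u v k := by
  rw [LinearMap.trace_eq_sum_inner _ (EuclideanSpace.basisFun (Fin n) ℝ)]
  refine Finset.sum_congr rfl fun k _ => ?_
  simp [curvLin, EuclideanSpace.inner_single_left]

/-- The matrix of a linear map of `ℝⁿ` with respect to the standard basis. -/
def stdMatrix (A : Model n →L[ℝ] Model n) : Matrix (Fin n) (Fin n) ℝ :=
  Matrix.of fun a i => A (stdVec i) a

/-- The matrix of the pull-back of a bilinear form along a linear map. -/
lemma sum_form_eq_conj (f : Model n → Model n → ℝ) (hl : ∀ v, IsLinearMap ℝ (fun u => f u v))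
    (hr : ∀ u, IsLinearMap ℝ (fun v => f u v)) (A : Model n →L[ℝ] Model n) :
    (Matrix.of fun i j => f (A (stdVec i)) (A (stdVec j))) =
      (stdMatrix A).transpose * (Matrix.of fun a b => f (stdVec a) (stdVec b)) * stdMatrix A := by
  ext i j
  have e1 : ∀ u v : Model n, f u v = ∑ a, ∑ b, u a * (f (stdVec a) (stdVec b) * v b) := by
    intro u v
    have h1 : f u v = ∑ a, u a * f (stdVec a) v := by
      conv_lhs => rw [eq_sum_stdVec u]
      have := map_sum (hl v).mk' (fun a => u a • stdVec a) Finset.univ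
      rw [IsLinearMap.mk'_apply] at this
      rw [this]
      exact Finset.sum_congr rfl fun a _ => (hl v).map_smul (u a) (stdVec a)
    rw [h1]
    refine Finset.sum_congr rfl fun a _ => ?_
    rw [← Finset.mul_sum]
    congr 1
    conv_lhs => rw [eq_sum_stdVec v]
    have := map_sum (hr (stdVec a)).mk' (fun b => v b • stdVec b) Finset.univ
    rw [IsLinearMap.mk'_apply] at this
    rw [this]
    exact Finset.sum_congr rfl fun b _ => ((hr (stdVec a)).map_smul (v b) (stdVec b)).trans
      (mul_comm _ _)
  rw [Matrix.of_apply, e1, Matrix.mul_assoc]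
  simp only [Matrix.mul_apply, Matrix.transpose_apply, stdMatrix, Matrix.of_apply,
    Finset.mul_sum]

/-- The contraction of a bilinear form with an inverse metric does not depend on the basis. -/
lemma sum_inv_mul_conj {ι : Type*} [Fintype ι] [DecidableEq ι] {P G R : Matrix ι ι ℝ}
    (hP : IsUnit P.det) :
    ∑ i, ∑ j, (P.transpose * G * P)⁻¹ i j * (P.transpose * R * P) i j =
      ∑ i, ∑ j, G⁻¹ i j * R i j := by
  have h : ∀ A B : Matrix ι ι ℝ, ∑ i, ∑ j, A i j * B i j = (A * B.transpose).trace := by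
    intro A B
    simp [Matrix.trace, Matrix.mul_apply]
  rw [h, h]
  have hPt : IsUnit P.transpose.det := by rwa [Matrix.det_transpose]
  rw [Matrix.mul_inv_rev, Matrix.mul_inv_rev, Matrix.transpose_mul, Matrix.transpose_mul,
    Matrix.transpose_transpose]
  have e : P⁻¹ * (G⁻¹ * P.transpose⁻¹) * (P.transpose * (R.transpose * P)) =
      P⁻¹ * (G⁻¹ * R.transpose) * P := by
    calc _ = P⁻¹ * (G⁻¹ * (P.transpose⁻¹ * P.transpose) * R.transpose) * P := by
          simp only [Matrix.mul_assoc]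
      _ = _ := by rw [Matrix.nonsing_inv_mul _ hPt, Matrix.mul_one]
  rw [e, Matrix.trace_mul_cycle, Matrix.mul_nonsing_inv _ hP, Matrix.one_mul]

lemma isUnit_det_stdMatrix {A : Model n →L[ℝ] Model n} (hA : Function.Injective A) :
    IsUnit (stdMatrix A).det := by
  rw [isUnit_iff_ne_zero]
  intro h0
  obtain ⟨v, hv, hv0⟩ := Matrix.exists_mulVec_eq_zero_iff.2 h0
  apply hv
  have : A (WithLp.toLp 2 v) = 0 := by
    rw [eq_sum_stdVec (WithLp.toLp 2 v)]
    ext k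
    have := congrFun hv0 k
    simpa [Matrix.mulVec, dotProduct, stdMatrix, mul_comm] using this
  have h2 := hA (this.trans (map_zero A).symm)
  simpa using h2

/-- The scalar curvature is invariant under a change of coordinates `φ`, defined on `T₀`. -/
lemma scalarCoord_transform {G G' : Model n → Matrix (Fin n) (Fin n) ℝ} {T T' T₀ : Set (Model n)}
    (hG : IsMetricOn G T) (hG' : IsMetricOn G' T') {φ : Model n → Model n} (hT₀ : IsOpen T₀)
    (hsub : T₀ ⊆ T') (hmaps : MapsTo φ T₀ T) (hφ : ContDiffOn ℝ ∞ φ T₀)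
    (hbij : ∀ z ∈ T₀, Function.Bijective (fderiv ℝ φ z))
    (h : ∀ z ∈ T₀, ∀ u v, bil G' z u v = bil G (φ z) (fderiv ℝ φ z u) (fderiv ℝ φ z v))
    {y : Model n} (hy : y ∈ T₀) : scalarCoord G' y = scalarCoord G (φ y) := by
  have hd1 : ContDiffOn ℝ ∞ (fderiv ℝ φ) T₀ := hφ.fderiv_of_isOpen hT₀ (by simp)
  have hd2 : ContDiffOn ℝ ∞ (fderiv ℝ (fderiv ℝ φ)) T₀ := hd1.fderiv_of_isOpen hT₀ (by simp)
  have D0 : ∀ z ∈ T₀, HasFDerivAt φ (fderiv ℝ φ z) z := fun z hz =>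
    ((hφ.contDiffAt (hT₀.mem_nhds hz)).differentiableAt (by simp)).hasFDerivAt
  have D1 : ∀ z ∈ T₀, HasFDerivAt (fderiv ℝ φ) (fderiv ℝ (fderiv ℝ φ) z) z := fun z hz =>
    ((hd1.contDiffAt (hT₀.mem_nhds hz)).differentiableAt (by simp)).hasFDerivAt
  have D2 : ∀ z ∈ T₀, HasFDerivAt (fderiv ℝ (fderiv ℝ φ)) (fderiv ℝ (fderiv ℝ (fderiv ℝ φ)) z) z :=
    fun z hz => ((hd2.contDiffAt (hT₀.mem_nhds hz)).differentiableAt (by simp)).hasFDerivAt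
  have S1 : ∀ z ∈ T₀, ∀ u v, fderiv ℝ (fderiv ℝ φ) z u v = fderiv ℝ (fderiv ℝ φ) z v u :=
    fun z hz u v => (hφ.contDiffAt (hT₀.mem_nhds hz)).isSymmSndFDerivAt two_le_smooth u v
  have S2 : ∀ u v w, fderiv ℝ (fderiv ℝ (fderiv ℝ φ)) y u v w =
      fderiv ℝ (fderiv ℝ (fderiv ℝ φ)) y v u w := fun u v w =>
    congrArg (fun L => L w) ((hd1.contDiffAt (hT₀.mem_nhds hy)).isSymmSndFDerivAt two_le_smooth u v)
  -- The derivatives of `φ` up to third order cancel in the curvature.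
  have hΓ : ∀ z ∈ T₀, ∀ u v, fderiv ℝ φ z (chr G' z u v) =
      fderiv ℝ (fderiv ℝ φ) z u v + chr G (φ z) (fderiv ℝ φ z u) (fderiv ℝ φ z v) := by
    intro z hz u v
    exact christoffel_transform (D0 z hz) (D1 z hz) (hG.differentiableAt_bil (hmaps hz))
      (hG'.differentiableAt_bil (hsub hz))
      (by filter_upwards [hT₀.mem_nhds hz] with x hx using h x hx) (S1 z hz)
      (hG.bil_symm _) (hbij z hz).2 (hG.bil_nondegenerate (hmaps hz))
      (hG.koszul_chr (hmaps hz)) (hG'.koszul_chr (hsub hz)) u v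
  have hR : ∀ w u v, fderiv ℝ φ y (curv (chr G') y w u v) =
      curv (chr G) (φ y) (fderiv ℝ φ y w) (fderiv ℝ φ y u) (fderiv ℝ φ y v) := by
    intro w u v
    exact curv_transform (D0 y hy) (D1 y hy) (D2 y hy) (hG.differentiableAt_chr (hmaps hy))
      (hG'.differentiableAt_chr (hsub hy))
      (by filter_upwards [hT₀.mem_nhds hy] with x hx using hΓ x hx) (S1 y hy) S2 w u v
  set A := fderiv ℝ φ y with hA
  -- The Ricci tensor is a trace of the curvature, hence invariant under conjugation with `A`.
  have hRic : ∀ u v, ∑ k, curv (chr G') y (stdVec k) u v k =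
      ∑ k, curv (chr G) (φ y) (stdVec k) (A u) (A v) k := by
    intro u v
    rw [← trace_curvLin, ← trace_curvLin]
    let e : Model n ≃ₗ[ℝ] Model n := LinearEquiv.ofBijective (A : Model n →ₗ[ℝ] Model n) (hbij y hy)
    rw [← LinearMap.trace_conj' (curvLin (chr G') y u v) e]
    congr 1
    ext1 w
    obtain ⟨w, rfl⟩ := e.surjective w
    rw [LinearEquiv.conj_apply_apply, LinearEquiv.symm_apply_apply]
    exact hR w u v
  set f : Model n → Model n → ℝ := fun u v => ∑ k, curv (chr G) (φ y) (stdVec k) v u k with hf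
  have hfl : ∀ v, IsLinearMap ℝ (fun u => f u v) := fun v =>
    ⟨fun a b => by
      simp only [hf, curv, map_add, ← Finset.sum_add_distrib]
      exact Finset.sum_congr rfl fun k _ => by simp; ring,
     fun c a => by
      simp only [hf, curv, map_smul, smul_eq_mul, Finset.mul_sum]
      exact Finset.sum_congr rfl fun k _ => by simp; ring⟩
  have hfr : ∀ u, IsLinearMap ℝ (fun v => f u v) := fun v =>
    ⟨fun a b => by
      simp only [hf, curv, map_add, ← Finset.sum_add_distrib]
      exact Finset.sum_congr rfl fun k _ => by simp; ring,
     fun c a => by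
      simp only [hf, curv, map_smul, smul_eq_mul, Finset.mul_sum]
      exact Finset.sum_congr rfl fun k _ => by simp; ring⟩
  have hG1 : G' y = (stdMatrix A).transpose * G (φ y) * stdMatrix A := by
    have h1 := sum_form_eq_conj (fun u v => bil G (φ y) u v)
      (fun v => ⟨fun a b => by simp, fun c a => by simp⟩)
      (fun v => ⟨fun a b => by simp, fun c a => by simp⟩) A
    have h2 : (Matrix.of fun a b => bil G (φ y) (stdVec a) (stdVec b)) = G (φ y) := by
      ext a b; simp [bil_single]
    rw [h2] at h1
    rw [← h1]
    ext i j
    rw [Matrix.of_apply, ← h y hy, bil_single]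
  have hR1 : (Matrix.of fun i j => ricci G' i j y) =
      (stdMatrix A).transpose * (Matrix.of fun a b => ricci G a b (φ y)) * stdMatrix A := by
    have h1 := sum_form_eq_conj f hfl hfr A
    have h2 : (Matrix.of fun a b => f (stdVec a) (stdVec b)) =
        Matrix.of fun a b => ricci G a b (φ y) := by
      ext a b; rw [Matrix.of_apply, Matrix.of_apply, hG.ricci_eq (hmaps hy)]
    rw [← h2, ← h1]
    ext i j
    rw [Matrix.of_apply, Matrix.of_apply, hG'.ricci_eq (hsub hy), hRic]
  have := sum_inv_mul_conj (G := G (φ y)) (R := Matrix.of fun a b => ricci G a b (φ y))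
    (isUnit_det_stdMatrix (hbij y hy).1)
  rw [← hG1, ← hR1] at this
  exact this

end Invariance

/-! ### The scalar curvature as a continuous function of the 2-jet of the metric -/

section Jet

variable {n : ℕ}

/-- Components of a matrix-valued function and of its partial derivatives of order at most two. -/
abbrev JetSpace (n : ℕ) : Type := (Fin n → Fin n → ℝ) × (Fin n → Fin n → Fin n → ℝ) ×
      (Fin n → Fin n → Fin n → Fin n → ℝ)

/-- The 2-jet of a matrix-valued function. -/
def jetOf (G : Model n → Matrix (Fin n) (Fin n) ℝ) (y : Model n) : JetSpace n :=
  (fun i j => G y i j, fun k i j => pd k (fun y => G y i j) y,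
    fun l k i j => pd l (pd k (fun y => G y i j)) y)

/-- The inverse metric as a function of the jet. -/
def jetInv (p : JetSpace n) : Matrix (Fin n) (Fin n) ℝ := (Matrix.of p.1)⁻¹

/-- Twice the Christoffel symbols of the first kind, as a function of the jet. -/
def jetKoszul (p : JetSpace n) (i j l : Fin n) : ℝ := p.2.1 i j l + p.2.1 j i l - p.2.1 l i j

/-- The Christoffel symbols as functions of the jet. -/
def jetChristoffel (p : JetSpace n) (k i j : Fin n) : ℝ :=
  (1 / 2 : ℝ) * ∑ l, jetInv p k l * jetKoszul p i j l

/-- The first derivatives of the Christoffel symbols as functions of the jet. The derivative of the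
inverse matrix is `-g⁻¹ (∂ₘ g) g⁻¹`. -/
def jetChristoffelDeriv (p : JetSpace n) (m k i j : Fin n) : ℝ :=
  (1 / 2 : ℝ) * ∑ l, ((-∑ q, (∑ r, jetInv p k r * p.2.1 m r q) * jetInv p q l) * jetKoszul p i j l +
    jetInv p k l * (p.2.2 m i j l + p.2.2 m j i l - p.2.2 m l i j))

/-- The Ricci tensor as a function of the jet. -/
def jetRicci (p : JetSpace n) (i j : Fin n) : ℝ :=
  ∑ k, (jetChristoffelDeriv p k k i j - jetChristoffelDeriv p j k i k) +
    ∑ k, ∑ l, (jetChristoffel p k k l * jetChristoffel p l i j -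
      jetChristoffel p k j l * jetChristoffel p l i k)

/-- The scalar curvature as a function of the jet. -/
def jetScalar (p : JetSpace n) : ℝ := ∑ i, ∑ j, jetInv p i j * jetRicci p i j

lemma continuousOn_jetInv (i j : Fin n) :
    ContinuousOn (fun p : JetSpace n => jetInv p i j) {p | (Matrix.of p.1).det ≠ 0} := by
  refine (contDiffOn_matrix_inv (G := fun p : JetSpace n => Matrix.of p.1) (fun i j => ?_)
    (fun y hy => hy) i j).continuousOn
  have : ContDiff ℝ ∞ (fun p : JetSpace n => p.1 i j) :=
    contDiff_pi.1 (contDiff_pi.1 contDiff_fst i) j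
  exact this.contDiffOn

lemma continuousOn_jetScalar :
    ContinuousOn (jetScalar (n := n)) {p | (Matrix.of p.1).det ≠ 0} := by
  have hi := continuousOn_jetInv (n := n)
  have hb : ∀ i j l, ContinuousOn (fun p : JetSpace n => p.2.1 i j l)
      {p | (Matrix.of p.1).det ≠ 0} := fun i j l => by fun_prop
  have hd : ∀ m i j l, ContinuousOn (fun p : JetSpace n => p.2.2 m i j l)
      {p | (Matrix.of p.1).det ≠ 0} := fun m i j l => by fun_prop
  have hK : ∀ i j l, ContinuousOn (fun p : JetSpace n => jetKoszul p i j l)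
      {p | (Matrix.of p.1).det ≠ 0} := fun i j l =>
    ((hb i j l).add (hb j i l)).sub (hb l i j)
  have hC : ∀ k i j, ContinuousOn (fun p : JetSpace n => jetChristoffel p k i j)
      {p | (Matrix.of p.1).det ≠ 0} := fun k i j =>
    continuousOn_const.mul (continuousOn_finsetSum _ fun l _ => (hi k l).mul (hK i j l))
  have hD : ∀ m k i j, ContinuousOn (fun p : JetSpace n => jetChristoffelDeriv p m k i j)
      {p | (Matrix.of p.1).det ≠ 0} := fun m k i j =>
    continuousOn_const.mul (continuousOn_finsetSum _ fun l _ =>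
      ((continuousOn_finsetSum _ fun q _ => (continuousOn_finsetSum _ fun r _ =>
        (hi k r).mul (hb m r q)).mul (hi q l)).neg.mul (hK i j l)).add
      ((hi k l).mul (((hd m i j l).add (hd m j i l)).sub (hd m l i j))))
  have hR : ∀ i j, ContinuousOn (fun p : JetSpace n => jetRicci p i j)
      {p | (Matrix.of p.1).det ≠ 0} := fun i j =>
    (continuousOn_finsetSum _ fun k _ => (hD k k i j).sub (hD j k i k)).add
    (continuousOn_finsetSum _ fun k _ => continuousOn_finsetSum _ fun l _ =>
      ((hC k k l).mul (hC l i j)).sub ((hC k j l).mul (hC l i k)))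
  exact continuousOn_finsetSum _ fun i _ => continuousOn_finsetSum _ fun j _ =>
    (hi i j).mul (hR i j)

lemma pd_add {f g : Model n → ℝ} {y : Model n} (hf : DifferentiableAt ℝ f y)
    (hg : DifferentiableAt ℝ g y) (k : Fin n) :
    pd k (fun z => f z + g z) y = pd k f y + pd k g y := by
  simp [pd, fderiv_fun_add hf hg]

lemma pd_sub {f g : Model n → ℝ} {y : Model n} (hf : DifferentiableAt ℝ f y)
    (hg : DifferentiableAt ℝ g y) (k : Fin n) :
    pd k (fun z => f z - g z) y = pd k f y - pd k g y := by
  simp [pd, fderiv_fun_sub hf hg]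

lemma pd_mul {f g : Model n → ℝ} {y : Model n} (hf : DifferentiableAt ℝ f y)
    (hg : DifferentiableAt ℝ g y) (k : Fin n) :
    pd k (fun z => f z * g z) y = pd k f y * g y + f y * pd k g y := by
  simp [pd, fderiv_fun_mul hf hg]; ring

lemma pd_sum {ι : Type*} [Fintype ι] {f : ι → Model n → ℝ} {y : Model n}
    (hf : ∀ i, DifferentiableAt ℝ (f i) y) (k : Fin n) :
    pd k (fun z => ∑ i, f i z) y = ∑ i, pd k (f i) y := by
  simp [pd, fderiv_fun_sum (fun i (_ : i ∈ Finset.univ) => hf i)]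

/-- The derivative of the inverse matrix is `-g⁻¹ (∂ₘ g) g⁻¹`. -/
lemma IsMetricOn.pd_inv {G : Model n → Matrix (Fin n) (Fin n) ℝ} {T : Set (Model n)}
    (hG : IsMetricOn G T) {y : Model n} (hy : y ∈ T) (m k l : Fin n) :
    pd m (fun z => (G z)⁻¹ k l) y =
      -∑ q, (∑ r, (G y)⁻¹ k r * pd m (fun z => G z r q) y) * (G y)⁻¹ q l := by
  have hGd : ∀ i j, DifferentiableAt ℝ (fun z => G z i j) y := fun i j =>
    hG.differentiableAt (hG.smooth i j) hy
  have hId : ∀ i j, DifferentiableAt ℝ (fun z => (G z)⁻¹ i j) y := fun i j =>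
    hG.differentiableAt (hG.contDiffOn_inv i j) hy
  set dG : Matrix (Fin n) (Fin n) ℝ := Matrix.of fun i j => pd m (fun z => G z i j) y with hdG
  set dI : Matrix (Fin n) (Fin n) ℝ := Matrix.of fun i j => pd m (fun z => (G z)⁻¹ i j) y with hdI
  have h1 : dG * (G y)⁻¹ + G y * dI = 0 := by
    ext i j
    have e : (fun z => ∑ q, G z i q * (G z)⁻¹ q j) =ᶠ[𝓝 y]
        fun _ => (1 : Matrix (Fin n) (Fin n) ℝ) i j := by
      filter_upwards [hG.isOpen.mem_nhds hy] with z hz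
      rw [← Matrix.mul_apply, Matrix.mul_nonsing_inv _ (hG.det_ne z hz).isUnit]
    have e2 : pd m (fun z => ∑ q, G z i q * (G z)⁻¹ q j) y = 0 := by
      rw [pd, e.fderiv_eq]; simp
    rw [pd_sum (fun q => (hGd i q).fun_mul (hId q j))] at e2
    simp only [pd_mul (hGd i _) (hId _ j), Finset.sum_add_distrib] at e2
    simpa [Matrix.mul_apply, hdG, hdI] using e2
  have h2 : dI = -((G y)⁻¹ * dG * (G y)⁻¹) := by
    have h3 : (G y)⁻¹ * (dG * (G y)⁻¹ + G y * dI) = 0 := by rw [h1, Matrix.mul_zero]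
    rw [Matrix.mul_add, ← Matrix.mul_assoc, ← Matrix.mul_assoc,
      Matrix.nonsing_inv_mul _ (hG.det_ne y hy).isUnit, Matrix.one_mul] at h3
    exact (neg_eq_of_add_eq_zero_right h3).symm
  have h3 := congrFun (congrFun h2 k) l
  simpa [Matrix.mul_apply, hdG, hdI] using h3

lemma IsMetricOn.scalarCoord_eq_jetScalar {G : Model n → Matrix (Fin n) (Fin n) ℝ}
    {T : Set (Model n)} (hG : IsMetricOn G T) {y : Model n} (hy : y ∈ T) :
    scalarCoord G y = jetScalar (jetOf G y) := by
  have hp : ∀ k i j, DifferentiableAt ℝ (pd k (fun z => G z i j)) y := fun k i j =>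
    hG.differentiableAt (contDiffOn_pd hG.isOpen (hG.smooth i j) k) hy
  have hI : ∀ i j, DifferentiableAt ℝ (fun z => (G z)⁻¹ i j) y := fun i j =>
    hG.differentiableAt (hG.contDiffOn_inv i j) hy
  have hinv : jetInv (jetOf G y) = (G y)⁻¹ := rfl
  have hC : ∀ k i j, christoffel G k i j y = jetChristoffel (jetOf G y) k i j :=
    fun _ _ _ => rfl
  have hD : ∀ m k i j, pd m (christoffel G k i j) y =
      jetChristoffelDeriv (jetOf G y) m k i j := by
    intro m k i j
    have hs : ∀ l, DifferentiableAt ℝ (fun z => pd i (fun z => G z j l) z +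
        pd j (fun z => G z i l) z - pd l (fun z => G z i j) z) y := fun l =>
      ((hp i j l).fun_add (hp j i l)).sub (hp l i j)
    unfold christoffel
    rw [pd_mul (differentiableAt_const _)
      (DifferentiableAt.fun_sum fun l _ => (hI k l).fun_mul (hs l)),
      pd_sum (fun l => (hI k l).fun_mul (hs l))]
    have h0 : pd m (fun _ : Model n => (1 / 2 : ℝ)) y = 0 := by simp [pd]
    rw [h0, zero_mul, zero_add]
    unfold jetChristoffelDeriv
    congr 1
    refine Finset.sum_congr rfl fun l _ => ?_
    rw [pd_mul (hI k l) (hs l), pd_sub ((hp i j l).fun_add (hp j i l)) (hp l i j),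
      pd_add (hp i j l) (hp j i l), hG.pd_inv hy]
    rfl
  simp only [scalarCoord, jetScalar, ricci, jetRicci, hinv, hC, hD]

end Jet

/-! ### Riemannian metrics in charts -/

section Charts

variable {n : ℕ} {M : Type*} [TopologicalSpace M] [ChartedSpace (Model n) M]
  [IsManifold (𝓡 n) ∞ M]

lemma mdifferentiable_chart_of_mem_atlas {c : OpenPartialHomeomorph M (Model n)}
    (hc : c ∈ atlas (Model n) M) : c.MDifferentiable (𝓡 n) (𝓡 n) := by
  have : IsManifold (𝓡 n) 1 M := IsManifold.of_le (n := ∞) (by simp)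
  exact mdifferentiable_of_mem_atlas hc

lemma contMDiffOn_chart_symm {c : OpenPartialHomeomorph M (Model n)}
    (hc : c ∈ atlas (Model n) M) : ContMDiffOn (𝓡 n) (𝓡 n) ∞ c.symm c.target :=
  contMDiffOn_symm_of_mem_maximalAtlas (IsManifold.subset_maximalAtlas hc)

lemma contMDiffOn_chart {c : OpenPartialHomeomorph M (Model n)}
    (hc : c ∈ atlas (Model n) M) : ContMDiffOn (𝓡 n) (𝓡 n) ∞ c c.source :=
  contMDiffOn_of_mem_maximalAtlas (IsManifold.subset_maximalAtlas hc)

/-- The differential of the inverse of the chart `c` at `y`, as a map from `ℝⁿ`. -/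
def chartFrame (c : OpenPartialHomeomorph M (Model n)) (y : Model n) :
    Model n →L[ℝ] TangentSpace (𝓡 n) (c.symm y) :=
  mfderiv (𝓡 n) (𝓡 n) c.symm y

lemma metricCoord_eq (g : Metr n M) (c : OpenPartialHomeomorph M (Model n)) (y : Model n)
    (i j : Fin n) : metricCoord g c y i j =
      g.inner (c.symm y) (chartFrame c y (stdVec i)) (chartFrame c y (stdVec j)) := rfl

lemma bil_metricCoord (g : Metr n M) (c : OpenPartialHomeomorph M (Model n)) (y u v : Model n) :
    bil (metricCoord g c) y u v = g.inner (c.symm y) (chartFrame c y u) (chartFrame c y v) := by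
  refine eq_of_eq_on_stdVec (f := fun u => bil (metricCoord g c) y u v)
    (g := fun u => g.inner (c.symm y) (chartFrame c y u) (chartFrame c y v))
    ⟨fun a b => by simp, fun r a => by simp⟩ ⟨fun a b => by simp, fun r a => by simp⟩
    (fun i => ?_) u
  refine eq_of_eq_on_stdVec (f := fun v => bil (metricCoord g c) y (stdVec i) v)
    (g := fun v => g.inner (c.symm y) (chartFrame c y (stdVec i)) (chartFrame c y v))
    ⟨fun a b => by simp, fun r a => by simp⟩ ⟨fun a b => by simp, fun r a => by simp⟩
    (fun j => ?_) v
  rw [bil_single, metricCoord_eq]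

lemma bijective_chartFrame {c : OpenPartialHomeomorph M (Model n)}
    (hc : c ∈ atlas (Model n) M) {y : Model n} (hy : y ∈ c.target) :
    Function.Bijective (chartFrame c y) :=
  (mdifferentiable_chart_of_mem_atlas hc).symm.mfderiv_bijective hy

/-- The coordinate vector fields of a chart are smooth sections of the tangent bundle. -/
lemma contMDiffOn_mfderiv_chart_symm {c : OpenPartialHomeomorph M (Model n)}
    (hc : c ∈ atlas (Model n) M) (u : Model n) :
    ContMDiffOn (𝓡 n) ((𝓡 n).prod 𝓘(ℝ, Model n)) ∞
      (fun y : Model n => Bundle.TotalSpace.mk' (Model n) (E := fun x : M => TangentSpace (𝓡 n) x)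
        (c.symm y) (mfderiv (𝓡 n) (𝓡 n) c.symm y u)) c.target := by
  have h1 := (contMDiffOn_chart_symm hc).contMDiffOn_tangentMapWithin (m := ∞) (by simp)
    c.open_target.uniqueMDiffOn
  have h2 : ContMDiffOn (𝓡 n) ((𝓡 n).prod 𝓘(ℝ, Model n)) ∞
      (fun y : Model n => (⟨y, u⟩ : TangentBundle (𝓡 n) (Model n))) c.target := by
    have : ContMDiffOn 𝓘(ℝ, Model n) (𝓘(ℝ, Model n).prod 𝓘(ℝ, Model n)) ∞
      (fun y : Model n => (⟨y, u⟩ : TangentBundle 𝓘(ℝ, Model n) (Model n))) c.target :=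
      contMDiffOn_vectorSpace_iff_contDiffOn.2 contDiffOn_const
    exact this
  have h3 := h1.comp h2 (fun y hy => hy)
  refine h3.congr fun y hy => ?_
  simp only [Function.comp, tangentMapWithin]
  rw [mfderivWithin_of_isOpen c.open_target hy]

lemma contDiffOn_metricCoord (g : Metr n M) {c : OpenPartialHomeomorph M (Model n)}
    (hc : c ∈ atlas (Model n) M) (i j : Fin n) :
    ContDiffOn ℝ ∞ (fun y => metricCoord g c y i j) c.target := by
  rw [← contMDiffOn_iff_contDiffOn]
  have h := ContMDiffOn.clm_bundle_apply₂ (F₁ := Model n) (F₂ := Model n) (F₃ := ℝ)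
    (E₃ := Bundle.Trivial M ℝ)
    (ψ := fun y => g.inner (c.symm y))
    (g.contMDiff.comp_contMDiffOn (contMDiffOn_chart_symm hc))
    (contMDiffOn_mfderiv_chart_symm hc (stdVec i)) (contMDiffOn_mfderiv_chart_symm hc (stdVec j))
  intro y hy
  have h2 := h y hy
  rw [Bundle.contMDiffWithinAt_totalSpace] at h2
  exact h2.2

lemma det_metricCoord_pos (g : Metr n M) {c : OpenPartialHomeomorph M (Model n)}
    (hc : c ∈ atlas (Model n) M) {y : Model n} (hy : y ∈ c.target) :
    0 < (metricCoord g c y).det := by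
  refine (Matrix.PosDef.of_dotProduct_mulVec_pos ?_ fun x hx => ?_).det_pos
  · ext i j
    simp only [Matrix.conjTranspose_apply, star_trivial]
    rw [metricCoord_eq, metricCoord_eq, g.symm]
  · have h1 : chartFrame c y (WithLp.toLp 2 x) ≠ 0 := by
      intro h
      have := (bijective_chartFrame hc hy).1 (h.trans (map_zero _).symm)
      exact hx (by simpa using this)
    have h2 := g.pos _ _ h1
    rw [← bil_metricCoord, bil_apply] at h2
    simpa [Matrix.mulVec, dotProduct, Finset.mul_sum, mul_assoc, mul_left_comm] using h2

lemma isMetricOn_metricCoord (g : Metr n M) {c : OpenPartialHomeomorph M (Model n)}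
    (hc : c ∈ atlas (Model n) M) : IsMetricOn (metricCoord g c) c.target where
  isOpen := c.open_target
  smooth := contDiffOn_metricCoord g hc
  symm y i j := by rw [metricCoord_eq, metricCoord_eq, g.symm]
  det_ne y hy := (det_metricCoord_pos g hc hy).ne'

lemma inner_congr_point (g : Metr n M) {x x' : M} (h : x = x') (u v : Model n) :
    g.inner x (show TangentSpace (𝓡 n) x from u) (show TangentSpace (𝓡 n) x from v) =
      g.inner x' (show TangentSpace (𝓡 n) x' from u) (show TangentSpace (𝓡 n) x' from v) := by
  subst h; rfl

/-! ### Change of charts -/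

/-- The part of the target of `c` on which the coordinate change to `c'` is defined. -/
def overlap (c c' : OpenPartialHomeomorph M (Model n)) : Set (Model n) := (c.symm.trans c').source

omit [ChartedSpace (Model n) M] [IsManifold (𝓡 n) ∞ M] in
lemma mem_overlap {c c' : OpenPartialHomeomorph M (Model n)} {y : Model n} :
    y ∈ overlap c c' ↔ y ∈ c.target ∧ c.symm y ∈ c'.source := by
  simp [overlap]

omit [ChartedSpace (Model n) M] [IsManifold (𝓡 n) ∞ M] in
lemma isOpen_overlap (c c' : OpenPartialHomeomorph M (Model n)) : IsOpen (overlap c c') :=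
  (c.symm.trans c').open_source

lemma contDiffOn_transition {c c' : OpenPartialHomeomorph M (Model n)}
    (hc : c ∈ atlas (Model n) M) (hc' : c' ∈ atlas (Model n) M) :
    ContDiffOn ℝ ∞ (c.symm.trans c') (overlap c c') := by
  rw [← contMDiffOn_iff_contDiffOn]
  exact (contMDiffOn_chart hc').comp ((contMDiffOn_chart_symm hc).mono fun y hy =>
    (mem_overlap.1 hy).1) fun y hy => (mem_overlap.1 hy).2

lemma bijective_fderiv_transition {c c' : OpenPartialHomeomorph M (Model n)}
    (hc : c ∈ atlas (Model n) M) (hc' : c' ∈ atlas (Model n) M) {y : Model n}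
    (hy : y ∈ overlap c c') : Function.Bijective (fderiv ℝ (c.symm.trans c') y) := by
  have h := ((mdifferentiable_chart_of_mem_atlas hc).symm.trans
    (mdifferentiable_chart_of_mem_atlas hc')).mfderiv_bijective hy
  rw [mfderiv_eq_fderiv] at h
  exact h

/-- The chain rule for the coordinate frames of two charts. -/
lemma chartFrame_transition {c c' : OpenPartialHomeomorph M (Model n)}
    (hc : c ∈ atlas (Model n) M) (hc' : c' ∈ atlas (Model n) M) {y : Model n}
    (hy : y ∈ overlap c c') (u : Model n) :
    (show Model n from chartFrame c y u) =
      (show Model n from chartFrame c' (c.symm.trans c' y) (fderiv ℝ (c.symm.trans c') y u)) := by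
  have h1 : (c.symm : Model n → M) =ᶠ[𝓝 y] c'.symm ∘ (c.symm.trans c') := by
    filter_upwards [(isOpen_overlap c c').mem_nhds hy] with z hz
    simp [c'.left_inv (mem_overlap.1 hz).2]
  have hd1 : MDifferentiableAt (𝓡 n) (𝓡 n) c'.symm (c.symm.trans c' y) :=
    (mdifferentiable_chart_of_mem_atlas hc').mdifferentiableAt_symm
      (c'.map_source (mem_overlap.1 hy).2)
  have hd2 : MDifferentiableAt (𝓡 n) (𝓡 n) (c.symm.trans c') y :=
    ((mdifferentiable_chart_of_mem_atlas hc).symm.trans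
      (mdifferentiable_chart_of_mem_atlas hc')).mdifferentiableAt hy
  have h2 := mfderiv_comp y hd1 hd2
  have h3 := h1.mfderiv_eq (I := 𝓡 n) (I' := 𝓡 n)
  have h4 : (mfderiv (𝓡 n) (𝓡 n) (c.symm.trans c') y : Model n →L[ℝ] Model n) =
    fderiv ℝ (c.symm.trans c') y := mfderiv_eq_fderiv
  have h5 := congrArg (fun L : Model n →L[ℝ] Model n => L u) (h3.trans h2)
  refine h5.trans ?_
  rw [← h4]
  rfl

lemma bil_metricCoord_transition (g : Metr n M) {c c' : OpenPartialHomeomorph M (Model n)}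
    (hc : c ∈ atlas (Model n) M) (hc' : c' ∈ atlas (Model n) M) {y : Model n}
    (hy : y ∈ overlap c c') (u v : Model n) :
    bil (metricCoord g c) y u v = bil (metricCoord g c') (c.symm.trans c' y)
      (fderiv ℝ (c.symm.trans c') y u) (fderiv ℝ (c.symm.trans c') y v) := by
  rw [bil_metricCoord, bil_metricCoord]
  have h0 : c.symm y = c'.symm (c.symm.trans c' y) := by
    simp [c'.left_inv (mem_overlap.1 hy).2]
  have h1 := inner_congr_point g h0 (chartFrame c y u) (chartFrame c y v)
  refine h1.trans ?_
  rw [chartFrame_transition hc hc' hy u, chartFrame_transition hc hc' hy v]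

/-- The scalar curvature does not depend on the chart in which it is computed. -/
lemma scalarCoord_chart_eq (g : Metr n M) {c c' : OpenPartialHomeomorph M (Model n)}
    (hc : c ∈ atlas (Model n) M) (hc' : c' ∈ atlas (Model n) M) {x : M} (hx : x ∈ c.source)
    (hx' : x ∈ c'.source) :
    scalarCoord (metricCoord g c) (c x) = scalarCoord (metricCoord g c') (c' x) := by
  have hy : c x ∈ overlap c c' := mem_overlap.2 ⟨c.map_source hx, by rwa [c.left_inv hx]⟩
  have h := scalarCoord_transform (isMetricOn_metricCoord g hc') (isMetricOn_metricCoord g hc)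
    (φ := c.symm.trans c') (isOpen_overlap c c') (fun y hy => (mem_overlap.1 hy).1)
    (fun y hy => by simpa using c'.map_source (mem_overlap.1 hy).2) (contDiffOn_transition hc hc')
    (fun z hz => bijective_fderiv_transition hc hc' hz)
    (fun z hz u v => bil_metricCoord_transition g hc hc' hz u v) hy
  rw [h]
  simp [c.left_inv hx]

/-- In any chart of the atlas, the scalar curvature is the function `jetScalar` of the 2-jet. -/
lemma scal_eq (g : Metr n M) {c : OpenPartialHomeomorph M (Model n)}
    (hc : c ∈ atlas (Model n) M) {x : M} (hx : x ∈ c.source) :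
    scal g x = jetScalar (jetOf (metricCoord g c) (c x)) := by
  rw [← (isMetricOn_metricCoord g hc).scalarCoord_eq_jetScalar (c.map_source hx)]
  exact scalarCoord_chart_eq g (chart_mem_atlas _ x) hc (mem_chart_source _ x) hx

lemma continuousOn_jetOf_metricCoord (g : Metr n M) {c : OpenPartialHomeomorph M (Model n)}
    (hc : c ∈ atlas (Model n) M) : ContinuousOn (jetOf (metricCoord g c)) c.target := by
  have h := isMetricOn_metricCoord g hc
  have h1 : ∀ i j, ContDiffOn ℝ ∞ (fun y => metricCoord g c y i j) c.target := h.smooth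
  have h2 := fun k i j => contDiffOn_pd h.isOpen (h1 i j) k
  have h3 := fun l k i j => contDiffOn_pd h.isOpen (h2 k i j) l
  refine ContinuousOn.prodMk ?_ (ContinuousOn.prodMk ?_ ?_)
  · exact continuousOn_pi.2 fun i => continuousOn_pi.2 fun j => (h1 i j).continuousOn
  · exact continuousOn_pi.2 fun k => continuousOn_pi.2 fun i => continuousOn_pi.2 fun j =>
      (h2 k i j).continuousOn
  · exact continuousOn_pi.2 fun l => continuousOn_pi.2 fun k => continuousOn_pi.2 fun i =>
      continuousOn_pi.2 fun j => (h3 l k i j).continuousOn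

lemma continuous_scal (g : Metr n M) : Continuous (scal g) := by
  rw [continuous_iff_continuousAt]
  intro x
  set c := chartAt (Model n) x with hcdef
  have hc : c ∈ atlas (Model n) M := chart_mem_atlas _ x
  have hx : x ∈ c.source := mem_chart_source _ x
  have h1 : ContinuousAt (fun z => jetScalar (jetOf (metricCoord g c) (c z))) x := by
    have e1 : ContinuousAt jetScalar (jetOf (metricCoord g c) (c x)) :=
      continuousOn_jetScalar.continuousAt (by
        refine IsOpen.mem_nhds ?_ (det_metricCoord_pos g hc (c.map_source hx)).ne'
        exact isOpen_ne_fun (Continuous.matrix_det (by fun_prop)) continuous_const)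
    have e2 : ContinuousAt (jetOf (metricCoord g c)) (c x) :=
      (continuousOn_jetOf_metricCoord g hc).continuousAt (c.open_target.mem_nhds (c.map_source hx))
    exact ContinuousAt.comp (f := fun z => jetOf (metricCoord g c) (c z)) e1
      (ContinuousAt.comp (f := c) e2 (c.continuousAt hx))
  refine h1.congr ?_
  filter_upwards [c.open_source.mem_nhds hx] with z hz
  exact (scal_eq g hc hz).symm

end Charts

/-! ### The norm of a differential -/

section DualNorm

variable {n : ℕ} {M : Type*} [TopologicalSpace M] [ChartedSpace (Model n) M]
  [IsManifold (𝓡 n) ∞ M]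

/-- The differential of a function at a point, as a covector. -/
def dfun (v : M → ℝ) (x : M) : TangentSpace (𝓡 n) x →L[ℝ] ℝ := mfderiv (𝓡 n) 𝓘(ℝ, ℝ) v x

/-- The squared norm of the covector `α` with respect to the norm dual to `g`, as a supremum over the
unit ball of `g`. -/
def dualSq (g : Metr n M) (x : M) (α : TangentSpace (𝓡 n) x →L[ℝ] ℝ) : ℝ :=
  sSup {r : ℝ | ∃ u : TangentSpace (𝓡 n) x, g.inner x u u ≤ 1 ∧ r = (α u) ^ 2}

lemma normSqDiff_eq (g : Metr n M) (v : M → ℝ) (x : M) :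
    normSqDiff g v x = dualSq g x (dfun v x) := rfl

lemma inner_self_nonneg (g : Metr n M) (x : M) (u : TangentSpace (𝓡 n) x) :
    0 ≤ g.inner x u u := by
  by_cases h : u = 0
  · simp [h]
  · exact (g.pos x u h).le

/-- Every covector is represented by a vector with respect to `g`. -/
lemma exists_riesz (g : Metr n M) (x : M) (α : TangentSpace (𝓡 n) x →L[ℝ] ℝ) :
    ∃ u, ∀ w, g.inner x u w = α w := by
  have : FiniteDimensional ℝ (TangentSpace (𝓡 n) x) :=
    inferInstanceAs (FiniteDimensional ℝ (Model n))
  let L : TangentSpace (𝓡 n) x →ₗ[ℝ] Module.Dual ℝ (TangentSpace (𝓡 n) x) :=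
    { toFun := fun u => (g.inner x u : TangentSpace (𝓡 n) x →ₗ[ℝ] ℝ)
      map_add' := fun a b => by ext w; simp
      map_smul' := fun a b => by ext w; simp }
  have hinj : Function.Injective L := by
    rw [injective_iff_map_eq_zero]
    intro u hu
    by_contra h
    have h1 := g.pos x u h
    have h2 : g.inner x u u = 0 := congrArg (fun f => f u) hu
    linarith
  have hsurj := (LinearMap.injective_iff_surjective_of_finrank_eq_finrank
    (Subspace.dual_finrank_eq).symm).1 hinj
  obtain ⟨u, hu⟩ := hsurj (α : TangentSpace (𝓡 n) x →ₗ[ℝ] ℝ)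
  exact ⟨u, fun w => congrArg (fun f => f w) hu⟩

lemma inner_sq_le (g : Metr n M) (x : M) (u w : TangentSpace (𝓡 n) x) :
    (g.inner x u w) ^ 2 ≤ g.inner x u u * g.inner x w w := by
  have h : ∀ t : ℝ, 0 ≤ g.inner x w w * (t * t) + (2 * g.inner x u w) * t + g.inner x u u := by
    intro t
    have := inner_self_nonneg g x (u + t • w)
    simp only [map_add, map_smul, add_apply, smul_apply,
      smul_eq_mul] at this
    rw [g.symm x w u] at this
    linarith
  have := discrim_le_zero h
  rw [discrim] at this
  linarith

/-- The squared norm of a covector is that of the vector which represents it. -/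
lemma dualSq_eq (g : Metr n M) (x : M) {α : TangentSpace (𝓡 n) x →L[ℝ] ℝ}
    {u : TangentSpace (𝓡 n) x} (hu : ∀ w, g.inner x u w = α w) :
    dualSq g x α = g.inner x u u := by
  have hub : ∀ r ∈ {r : ℝ | ∃ u : TangentSpace (𝓡 n) x, g.inner x u u ≤ 1 ∧ r = (α u) ^ 2},
      r ≤ g.inner x u u := by
    rintro r ⟨w, hw, rfl⟩
    rw [← hu w]
    have h1 := inner_sq_le g x u w
    have h2 := inner_self_nonneg g x u
    nlinarith
  refine le_antisymm (csSup_le ⟨0, 0, by simp, by simp⟩ hub) ?_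
  rcases eq_or_lt_of_le (inner_self_nonneg g x u) with h0 | h0
  · rw [← h0]
    exact le_csSup ⟨_, hub⟩ ⟨0, by simp, by simp⟩
  · refine le_csSup ⟨_, hub⟩ ⟨(Real.sqrt (g.inner x u u))⁻¹ • u, ?_, ?_⟩
    · simp only [map_smul, smul_apply, smul_eq_mul]
      rw [← mul_assoc, ← mul_inv, Real.mul_self_sqrt h0.le, inv_mul_cancel₀ h0.ne']
    · rw [map_smul, ← hu, smul_eq_mul, mul_pow, inv_pow, Real.sq_sqrt h0.le]
      field_simp

lemma dualSq_nonneg (g : Metr n M) (x : M) (α : TangentSpace (𝓡 n) x →L[ℝ] ℝ) :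
    0 ≤ dualSq g x α := by
  obtain ⟨u, hu⟩ := exists_riesz g x α
  rw [dualSq_eq g x hu]
  exact inner_self_nonneg g x u

lemma apply_sq_le_dualSq (g : Metr n M) (x : M) (α : TangentSpace (𝓡 n) x →L[ℝ] ℝ)
    (w : TangentSpace (𝓡 n) x) : (α w) ^ 2 ≤ dualSq g x α * g.inner x w w := by
  obtain ⟨u, hu⟩ := exists_riesz g x α
  rw [dualSq_eq g x hu, ← hu]
  exact inner_sq_le g x u w

lemma dualSq_le (g : Metr n M) (x : M) (α : TangentSpace (𝓡 n) x →L[ℝ] ℝ) {r : ℝ} (hr : 0 ≤ r)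
    (h : ∀ w, (α w) ^ 2 ≤ r * g.inner x w w) : dualSq g x α ≤ r := by
  refine csSup_le ⟨0, 0, by simp, by simp⟩ ?_
  rintro _ ⟨w, hw, rfl⟩
  nlinarith [h w]

lemma dualSq_le_of_inner_le {g h : Metr n M} {x : M} {C : ℝ} (hC : 0 ≤ C)
    (hgh : ∀ u, g.inner x u u ≤ C * h.inner x u u) (α : TangentSpace (𝓡 n) x →L[ℝ] ℝ) :
    dualSq h x α ≤ C * dualSq g x α := by
  refine dualSq_le h x α (mul_nonneg hC (dualSq_nonneg g x α)) fun w => ?_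
  calc (α w) ^ 2 ≤ dualSq g x α * g.inner x w w := apply_sq_le_dualSq g x α w
    _ ≤ dualSq g x α * (C * h.inner x w w) := by gcongr; exacts [dualSq_nonneg g x α, hgh w]
    _ = _ := by ring

/-- The squared norm of covectors is a quadratic form. -/
lemma exists_dualSq_combo (g : Metr n M) (x : M) (α β : TangentSpace (𝓡 n) x →L[ℝ] ℝ) :
    ∃ b : ℝ, ∀ s t : ℝ, dualSq g x (s • α + t • β) =
      s ^ 2 * dualSq g x α + 2 * (s * t) * b + t ^ 2 * dualSq g x β := by
  obtain ⟨u, hu⟩ := exists_riesz g x α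
  obtain ⟨w, hw⟩ := exists_riesz g x β
  refine ⟨g.inner x u w, fun s t => ?_⟩
  have h : ∀ z, g.inner x (s • u + t • w) z = (s • α + t • β) z := fun z => by
    simp [hu, hw]
  rw [dualSq_eq g x hu, dualSq_eq g x hw, dualSq_eq g x h]
  simp only [map_add, map_smul, add_apply, smul_apply, smul_eq_mul]
  rw [g.symm x w u]
  ring

omit [IsManifold (𝓡 n) ∞ M] in
lemma dfun_mul {f v : M → ℝ} {x : M} (hf : MDifferentiableAt (𝓡 n) 𝓘(ℝ, ℝ) f x)
    (hv : MDifferentiableAt (𝓡 n) 𝓘(ℝ, ℝ) v x) :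
    dfun (n := n) (fun z => f z * v z) x = f x • dfun v x + v x • dfun f x :=
  (hf.hasMFDerivAt.mul hv.hasMFDerivAt).mfderiv

omit [IsManifold (𝓡 n) ∞ M] in
lemma dfun_comp {φ : ℝ → ℝ} {φ' : ℝ} {f : M → ℝ} {x : M} (hφ : HasDerivAt φ φ' (f x))
    (hf : MDifferentiableAt (𝓡 n) 𝓘(ℝ, ℝ) f x) :
    dfun (n := n) (fun z => φ (f z)) x = φ' • dfun f x := by
  have h := HasMFDerivAt.comp x (I := 𝓡 n) (I' := 𝓘(ℝ, ℝ)) (I'' := 𝓘(ℝ, ℝ))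
    hφ.hasFDerivAt.hasMFDerivAt hf.hasMFDerivAt
  refine h.mfderiv.trans ?_
  ext u
  exact mul_comm (dfun f x u) φ'

/-- The differential in a chart. -/
lemma dfun_chartFrame {c : OpenPartialHomeomorph M (Model n)} (hc : c ∈ atlas (Model n) M)
    {y : Model n} (hy : y ∈ c.target) {v : M → ℝ}
    (hv : MDifferentiableAt (𝓡 n) 𝓘(ℝ, ℝ) v (c.symm y)) (u : Model n) :
    dfun v (c.symm y) (chartFrame c y u) = fderiv ℝ (v ∘ c.symm) y u := by
  have h := mfderiv_comp y hv ((mdifferentiable_chart_of_mem_atlas hc).mdifferentiableAt_symm hy)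
  have h2 : (mfderiv (𝓡 n) 𝓘(ℝ, ℝ) (v ∘ c.symm) y : Model n →L[ℝ] ℝ) =
    fderiv ℝ (v ∘ c.symm) y := mfderiv_eq_fderiv
  rw [← h2, h]
  rfl

/-- The squared norm of the differential in a chart is `∑ gⁱʲ ∂ᵢv ∂ⱼv`. -/
lemma normSqDiff_chart (g : Metr n M) {c : OpenPartialHomeomorph M (Model n)}
    (hc : c ∈ atlas (Model n) M) {y : Model n} (hy : y ∈ c.target) {v : M → ℝ}
    (hv : MDifferentiableAt (𝓡 n) 𝓘(ℝ, ℝ) v (c.symm y)) :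
    normSqDiff g v (c.symm y) = ∑ i, ∑ j, (metricCoord g c y)⁻¹ i j *
      (pd i (v ∘ c.symm) y * pd j (v ∘ c.symm) y) := by
  set ξ : Fin n → ℝ := fun i => pd i (v ∘ c.symm) y with hξ
  set G := metricCoord g c y with hG
  have hGs := isMetricOn_metricCoord g hc
  set w : Model n := WithLp.toLp 2 (G⁻¹.mulVec ξ) with hw
  have hGw : ∀ i, ∑ j, G i j * w j = ξ i := by
    intro i
    have : G.mulVec (G⁻¹.mulVec ξ) = ξ := by
      rw [Matrix.mulVec_mulVec, Matrix.mul_nonsing_inv _ (hGs.det_ne y hy).isUnit,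
        Matrix.one_mulVec]
    exact congrFun this i
  have key : ∀ z : Model n, bil (metricCoord g c) y w z = fderiv ℝ (v ∘ c.symm) y z := by
    intro z
    refine eq_of_eq_on_stdVec (f := fun z => bil (metricCoord g c) y w z)
      (g := fun z => fderiv ℝ (v ∘ c.symm) y z)
      ⟨fun a b => by simp, fun r a => by simp⟩ ⟨fun a b => by simp, fun r a => by simp⟩
      (fun i => ?_) z
    rw [hGs.bil_symm, bil_apply, Finset.sum_eq_single i (by intro p _ hp; simp [hp]) (by simp)]
    simpa [hG, hξ, pd] using hGw i
  have hr : ∀ z, g.inner (c.symm y) (chartFrame c y w) z = dfun v (c.symm y) z := by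
    intro z
    obtain ⟨z, rfl⟩ := (bijective_chartFrame hc hy).2 z
    rw [dfun_chartFrame hc hy hv, ← key, bil_metricCoord]
  rw [normSqDiff_eq, dualSq_eq g _ hr, ← bil_metricCoord, bil_apply]
  have : ∀ i, ∑ j, metricCoord g c y i j * (w i * w j) = w i * ξ i := by
    intro i
    rw [← hGw i, Finset.mul_sum]
    exact Finset.sum_congr rfl fun j _ => by ring
  simp only [this]
  simp only [hw, Matrix.mulVec, dotProduct, Finset.sum_mul]
  exact Finset.sum_congr rfl fun i _ => Finset.sum_congr rfl fun j _ => by ring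

lemma continuous_normSqDiff (g : Metr n M) {v : M → ℝ} (hv : ContMDiff (𝓡 n) 𝓘(ℝ, ℝ) ∞ v) :
    Continuous (normSqDiff g v) := by
  rw [continuous_iff_continuousAt]
  intro x
  set c := chartAt (Model n) x with hcdef
  have hc : c ∈ atlas (Model n) M := chart_mem_atlas _ x
  have hx : x ∈ c.source := mem_chart_source _ x
  have hs : ContDiffOn ℝ ∞ (v ∘ c.symm) c.target := by
    rw [← contMDiffOn_iff_contDiffOn]
    exact hv.comp_contMDiffOn (contMDiffOn_chart_symm hc)
  have hG := isMetricOn_metricCoord g hc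
  have h1 : ContinuousOn (fun y => ∑ i, ∑ j, (metricCoord g c y)⁻¹ i j *
      (pd i (v ∘ c.symm) y * pd j (v ∘ c.symm) y)) c.target :=
    continuousOn_finsetSum _ fun i _ => continuousOn_finsetSum _ fun j _ =>
      (hG.contDiffOn_inv i j).continuousOn.mul
        ((contDiffOn_pd c.open_target hs i).continuousOn.mul
        (contDiffOn_pd c.open_target hs j).continuousOn)
  have h2 := ContinuousAt.comp (f := c)
    (h1.continuousAt (c.open_target.mem_nhds (c.map_source hx))) (c.continuousAt hx)
  refine h2.congr ?_
  filter_upwards [c.open_source.mem_nhds hx] with z hz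
  have := normSqDiff_chart g hc (c.map_source hz) (v := v)
    (hv.mdifferentiableAt (by simp))
  rw [c.left_inv hz] at this
  exact this.symm

end DualNorm

/-! ### The Riemannian measure -/

section Volume

variable {n : ℕ} {M : Type*} [TopologicalSpace M] [ChartedSpace (Model n) M]
  [IsManifold (𝓡 n) ∞ M]

/-- The density `√det(gᵢⱼ)` in a chart. -/
def chartDensity (g : Metr n M) (c : OpenPartialHomeomorph M (Model n)) (y : Model n) : ℝ :=
  Real.sqrt (metricCoord g c y).det

lemma chartDensity_pos (g : Metr n M) {c : OpenPartialHomeomorph M (Model n)}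
    (hc : c ∈ atlas (Model n) M) {y : Model n} (hy : y ∈ c.target) : 0 < chartDensity g c y :=
  Real.sqrt_pos.2 (det_metricCoord_pos g hc hy)

lemma continuousOn_chartDensity (g : Metr n M) {c : OpenPartialHomeomorph M (Model n)}
    (hc : c ∈ atlas (Model n) M) : ContinuousOn (chartDensity g c) c.target :=
  (contDiffOn_det (contDiffOn_metricCoord g hc)).continuousOn.sqrt

lemma metricCoord_transition (g : Metr n M) {c c' : OpenPartialHomeomorph M (Model n)}
    (hc : c ∈ atlas (Model n) M) (hc' : c' ∈ atlas (Model n) M) {y : Model n}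
    (hy : y ∈ overlap c c') : metricCoord g c y =
      (stdMatrix (fderiv ℝ (c.symm.trans c') y)).transpose *
        metricCoord g c' (c.symm.trans c' y) * stdMatrix (fderiv ℝ (c.symm.trans c') y) := by
  have h1 := sum_form_eq_conj (fun u v => bil (metricCoord g c') (c.symm.trans c' y) u v)
    (fun v => ⟨fun a b => by simp, fun c a => by simp⟩)
    (fun v => ⟨fun a b => by simp, fun c a => by simp⟩) (fderiv ℝ (c.symm.trans c') y)
  have h2 : (Matrix.of fun a b => bil (metricCoord g c') (c.symm.trans c' y) (stdVec a) (stdVec b))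
      = metricCoord g c' (c.symm.trans c' y) := by
    ext a b; simp [bil_single]
  rw [h2] at h1
  rw [← h1]
  ext i j
  rw [Matrix.of_apply, ← bil_metricCoord_transition g hc hc' hy, bil_single]

lemma det_stdMatrix (A : Model n →L[ℝ] Model n) : (stdMatrix A).det = A.det := by
  have : stdMatrix A = LinearMap.toMatrix (EuclideanSpace.basisFun (Fin n) ℝ).toBasis
      (EuclideanSpace.basisFun (Fin n) ℝ).toBasis (A : Model n →ₗ[ℝ] Model n) := by
    ext i j
    simp [stdMatrix, LinearMap.toMatrix_apply]
  rw [this, LinearMap.det_toMatrix]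

/-- The transformation rule of the Riemannian volume density. -/
lemma chartDensity_transition (g : Metr n M) {c c' : OpenPartialHomeomorph M (Model n)}
    (hc : c ∈ atlas (Model n) M) (hc' : c' ∈ atlas (Model n) M) {y : Model n}
    (hy : y ∈ overlap c c') : chartDensity g c y =
      |(fderiv ℝ (c.symm.trans c') y).det| * chartDensity g c' (c.symm.trans c' y) := by
  rw [chartDensity, chartDensity, metricCoord_transition g hc hc' hy, Matrix.det_mul,
    Matrix.det_mul, Matrix.det_transpose, det_stdMatrix, mul_right_comm, ← sq,
    Real.sqrt_mul (sq_nonneg _), Real.sqrt_sq_eq_abs]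

variable [MeasurableSpace M] [BorelSpace M]

omit [ChartedSpace (Model n) M] [IsManifold (𝓡 n) ∞ M] in
lemma aemeasurable_chart_symm (c : OpenPartialHomeomorph M (Model n)) :
    AEMeasurable c.symm (volume.restrict c.target) :=
  c.continuousOn_symm.aemeasurable c.open_target.measurableSet

omit [MeasurableSpace M] [BorelSpace M] in
lemma aemeasurable_chartDensity (g : Metr n M) {c : OpenPartialHomeomorph M (Model n)}
    (hc : c ∈ atlas (Model n) M) :
    AEMeasurable (fun y => ENNReal.ofReal (chartDensity g c y)) (volume.restrict c.target) :=
  ((continuousOn_chartDensity g hc).aemeasurable c.open_target.measurableSet).ennreal_ofReal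

lemma lintegral_chartVolume (g : Metr n M) {c : OpenPartialHomeomorph M (Model n)}
    (hc : c ∈ atlas (Model n) M) {f : M → ℝ≥0∞} (hf : Measurable f) :
    ∫⁻ x, f x ∂(chartVolume g c) =
      ∫⁻ y in c.target, ENNReal.ofReal (chartDensity g c y) * f (c.symm y) := by
  have h1 := aemeasurable_chart_symm c
  have h2 : AEMeasurable c.symm ((volume.restrict c.target).withDensity
    (fun y => ENNReal.ofReal (chartDensity g c y))) :=
    h1.mono_ac (withDensity_absolutelyContinuous _ _)
  change ∫⁻ x, f x ∂(((volume.restrict c.target).withDensity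
    (fun y => ENNReal.ofReal (chartDensity g c y))).map c.symm) = _
  rw [lintegral_map' hf.aemeasurable h2]
  exact lintegral_withDensity_eq_lintegral_mul₀ (aemeasurable_chartDensity g hc)
    (hf.comp_aemeasurable h1)

lemma chartVolume_apply (g : Metr n M) (c : OpenPartialHomeomorph M (Model n)) {s : Set M}
    (hs : MeasurableSet s) :
    chartVolume g c s =
      ∫⁻ y in c.symm ⁻¹' s ∩ c.target, ENNReal.ofReal (chartDensity g c y) := by
  have h2 : AEMeasurable c.symm ((volume.restrict c.target).withDensity
    (fun y => ENNReal.ofReal (chartDensity g c y))) :=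
    (aemeasurable_chart_symm c).mono_ac (withDensity_absolutelyContinuous _ _)
  change (((volume.restrict c.target).withDensity
    (fun y => ENNReal.ofReal (chartDensity g c y))).map c.symm) s = _
  rw [Measure.map_apply_of_aemeasurable h2 hs, withDensity_apply',
    Measure.restrict_restrict' c.open_target.measurableSet]

omit [ChartedSpace (Model n) M] [IsManifold (𝓡 n) ∞ M] in
lemma measurableSet_chart_preimage (c : OpenPartialHomeomorph M (Model n)) {s : Set M}
    (hs : MeasurableSet s) : MeasurableSet (c.symm ⁻¹' s ∩ c.target) := by
  have h1 : Measurable (c.target.domRestrict c.symm) :=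
    (continuousOn_iff_continuous_domRestrict.1 c.continuousOn_symm).measurable
  have h2 := MeasurableSet.subtype_image c.open_target.measurableSet (h1 hs)
  convert h2 using 1
  ext y
  simp [and_comm]

/-- The chart volumes agree on overlaps: change of variables. -/
lemma chartVolume_overlap (g : Metr n M) {c c' : OpenPartialHomeomorph M (Model n)}
    (hc : c ∈ atlas (Model n) M) (hc' : c' ∈ atlas (Model n) M) {s : Set M}
    (hs : MeasurableSet s) (h1 : s ⊆ c.source) (h2 : s ⊆ c'.source) :
    chartVolume g c' s = chartVolume g c s := by
  rw [chartVolume_apply g c' hs, chartVolume_apply g c hs]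
  have hA := measurableSet_chart_preimage c hs
  have hsub : c.symm ⁻¹' s ∩ c.target ⊆ overlap c c' := fun y hy =>
    mem_overlap.2 ⟨hy.2, h2 hy.1⟩
  have himg : (c.symm.trans c') '' (c.symm ⁻¹' s ∩ c.target) = c'.symm ⁻¹' s ∩ c'.target := by
    ext z
    constructor
    · rintro ⟨y, ⟨hy1, hy2⟩, rfl⟩
      refine ⟨?_, ?_⟩
      · simpa [c'.left_inv (h2 hy1)] using hy1
      · simpa using c'.map_source (h2 hy1)
    · rintro ⟨hz1, hz2⟩
      refine ⟨c (c'.symm z), ⟨?_, c.map_source (h1 hz1)⟩, ?_⟩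
      · simpa [c.left_inv (h1 hz1)] using hz1
      · simp [c.left_inv (h1 hz1), c'.right_inv hz2]
  rw [← himg, lintegral_image_eq_lintegral_abs_det_fderiv_mul volume hA
    (f' := fun y => fderiv ℝ (c.symm.trans c') y)]
  · refine setLIntegral_congr_fun hA fun y hy => ?_
    rw [chartDensity_transition g hc hc' (hsub hy), ENNReal.ofReal_mul (abs_nonneg _)]
  · intro y hy
    have := ((contDiffOn_transition hc hc').contDiffAt
      ((isOpen_overlap c c').mem_nhds (hsub hy))).differentiableAt (by simp)
    exact this.hasFDerivAt.hasFDerivWithinAt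
  · exact (c.symm.trans c').injOn.mono hsub

lemma chartVolume_inter_source (g : Metr n M) (c : OpenPartialHomeomorph M (Model n)) {s : Set M}
    (hs : MeasurableSet s) :
    chartVolume g c (s ∩ c.source) = chartVolume g c s := by
  rw [chartVolume_apply g c (hs.inter c.open_source.measurableSet), chartVolume_apply g c hs]
  congr 2
  ext y
  simp only [mem_inter_iff, mem_preimage]
  exact ⟨fun h => ⟨h.1.1, h.2⟩, fun h => ⟨⟨h.1, c.map_target h.2⟩, h.2⟩⟩

omit [BorelSpace M] in
lemma chartVolume_le_riemMeasure (g : Metr n M) {c : OpenPartialHomeomorph M (Model n)}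
    (hc : c ∈ atlas (Model n) M) : chartVolume g c ≤ riemMeasure g :=
  le_iSup₂_of_le c hc le_rfl

/-- In each chart, `μ_g` is given by the density `√det(gᵢⱼ)`. -/
lemma riemMeasure_eq_chartVolume (g : Metr n M) {c : OpenPartialHomeomorph M (Model n)}
    (hc : c ∈ atlas (Model n) M) {s : Set M} (hs : MeasurableSet s) (h1 : s ⊆ c.source) :
    riemMeasure g s = chartVolume g c s := by
  refine le_antisymm ?_ (chartVolume_le_riemMeasure g hc s)
  -- The right-hand side is a measure which dominates the volumes of all charts.
  have hle : riemMeasure g ≤ chartVolume g c + (riemMeasure g).restrict (c.source)ᶜ := by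
    refine iSup₂_le fun c' hc' => Measure.le_iff.2 fun t ht => ?_
    rw [← measure_inter_add_sdiff t c.open_source.measurableSet, Measure.add_apply,
      Measure.restrict_apply ht]
    refine add_le_add ?_ (chartVolume_le_riemMeasure g hc' _)
    have hm := ht.inter c.open_source.measurableSet
    rw [← chartVolume_inter_source g c' hm,
      chartVolume_overlap g hc hc' (hm.inter c'.open_source.measurableSet)
        (fun x hx => hx.1.2) (fun x hx => hx.2)]
    exact measure_mono fun x hx => hx.1.1
  refine (hle s).trans ?_
  rw [Measure.add_apply, Measure.restrict_apply hs]
  have : s ∩ (c.source)ᶜ = ∅ := by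
    rw [← disjoint_iff_inter_eq_empty]; exact disjoint_compl_right_iff_subset.2 h1
  simp [this]

instance isLocallyFiniteMeasure_riemMeasure (g : Metr n M) :
    IsLocallyFiniteMeasure (riemMeasure g) := by
  refine ⟨fun x => ?_⟩
  set c := chartAt (Model n) x
  have hc : c ∈ atlas (Model n) M := chart_mem_atlas _ x
  have hx : x ∈ c.source := mem_chart_source _ x
  obtain ⟨r, hr, hball⟩ := Metric.nhds_basis_closedBall.mem_iff.1
    (c.open_target.mem_nhds (c.map_source hx))
  have hopen : IsOpen (c.source ∩ c ⁻¹' Metric.ball (c x) r) :=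
    c.isOpen_inter_preimage Metric.isOpen_ball
  refine ⟨c.source ∩ c ⁻¹' Metric.ball (c x) r,
    hopen.mem_nhds ⟨hx, by simpa using hr⟩, ?_⟩
  rw [riemMeasure_eq_chartVolume g hc hopen.measurableSet inter_subset_left,
    chartVolume_apply g c hopen.measurableSet]
  obtain ⟨B, hB⟩ := (isCompact_closedBall (c x) r).exists_bound_of_continuousOn
    ((continuousOn_chartDensity g hc).mono hball)
  have hsub : c.symm ⁻¹' (c.source ∩ c ⁻¹' Metric.ball (c x) r) ∩ c.target ⊆
      Metric.closedBall (c x) r := by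
    rintro y ⟨⟨_, hy⟩, hyt⟩
    rw [mem_preimage, c.right_inv hyt] at hy
    exact Metric.ball_subset_closedBall hy
  calc _ ≤ ∫⁻ y in Metric.closedBall (c x) r, ENNReal.ofReal (chartDensity g c y) :=
        lintegral_mono_set hsub
    _ ≤ ∫⁻ y in Metric.closedBall (c x) r, ENNReal.ofReal B :=
        setLIntegral_mono measurable_const fun y hy =>
          ENNReal.ofReal_le_ofReal ((le_abs_self _).trans (hB y hy))
    _ < ⊤ := by
        rw [setLIntegral_const]
        exact ENNReal.mul_lt_top ENNReal.ofReal_lt_top measure_closedBall_lt_top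

instance isOpenPosMeasure_riemMeasure (g : Metr n M) :
    (riemMeasure g).IsOpenPosMeasure := by
  refine ⟨fun U hU ⟨x, hxU⟩ h0 => ?_⟩
  set c := chartAt (Model n) x
  have hc : c ∈ atlas (Model n) M := chart_mem_atlas _ x
  have hx : x ∈ c.source := mem_chart_source _ x
  have h1 : chartVolume g c U = 0 :=
    le_antisymm ((chartVolume_le_riemMeasure g hc U).trans h0.le) bot_le
  rw [chartVolume_apply g c hU.measurableSet] at h1
  have hO : IsOpen (c.symm ⁻¹' U ∩ c.target) := by
    rw [inter_comm]; exact c.symm.isOpen_inter_preimage hU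
  have h2 := (lintegral_eq_zero_iff' ((aemeasurable_chartDensity g hc).mono_measure
    (Measure.restrict_mono inter_subset_right le_rfl))).1 h1
  have h3 : ∀ᵐ y ∂volume.restrict (c.symm ⁻¹' U ∩ c.target), False := by
    filter_upwards [h2, ae_restrict_mem hO.measurableSet] with y hy hym
    have := chartDensity_pos g hc hym.2
    simp only [Pi.zero_apply, ENNReal.ofReal_eq_zero] at hy
    linarith
  rw [ae_restrict_iff' hO.measurableSet] at h3
  have h4 : volume (c.symm ⁻¹' U ∩ c.target) = 0 := by
    rw [ae_iff] at h3
    refine Eq.trans (congrArg _ ?_) h3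
    ext y
    simp
  exact (hO.measure_pos volume ⟨c x, by simpa [c.left_inv hx] using hxU, c.map_source hx⟩).ne' h4

/-- Riemannian measures can be compared chart by chart. -/
lemma riemMeasure_le_withDensity {g h : Metr n M} {ρ : M → ℝ≥0∞} (hρ : Measurable ρ)
    (hle : ∀ c ∈ atlas (Model n) M, ∀ y ∈ c.target, ENNReal.ofReal (chartDensity h c y) ≤
      ENNReal.ofReal (chartDensity g c y) * ρ (c.symm y)) :
    riemMeasure h ≤ (riemMeasure g).withDensity ρ := by
  refine iSup₂_le fun c hc => Measure.le_iff.2 fun s hs => ?_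
  calc chartVolume h c s = ∫⁻ x, s.indicator 1 x ∂(chartVolume h c) := by
        rw [lintegral_indicator_one hs]
    _ = ∫⁻ y in c.target, ENNReal.ofReal (chartDensity h c y) * s.indicator 1 (c.symm y) :=
        lintegral_chartVolume h hc (measurable_one.indicator hs)
    _ ≤ ∫⁻ y in c.target, ENNReal.ofReal (chartDensity g c y) * s.indicator ρ (c.symm y) := by
        refine setLIntegral_mono' c.open_target.measurableSet fun y hy => ?_
        by_cases hys : c.symm y ∈ s
        · simpa [hys] using hle c hc y hy
        · simp [hys]
    _ = ∫⁻ x, s.indicator ρ x ∂(chartVolume g c) :=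
        (lintegral_chartVolume g hc (hρ.indicator hs)).symm
    _ ≤ ∫⁻ x, s.indicator ρ x ∂(riemMeasure g) :=
        lintegral_mono' (chartVolume_le_riemMeasure g hc) le_rfl
    _ = _ := by rw [lintegral_indicator hs, withDensity_apply _ hs]

end Volume

/-! ### Metrics that are close to each other at infinity -/

section Close

variable {n : ℕ} {M : Type*} [TopologicalSpace M] [ChartedSpace (Model n) M]
  [IsManifold (𝓡 n) ∞ M]

/-- The metrics `g` and `h` differ pointwise by at most `τ³`: relatively, as far as lengths and
volumes are concerned, and absolutely for the scalar curvatures. The relation is symmetric. -/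
structure Close (τ : M → ℝ) (g h : Metr n M) : Prop where
  inner_le : ∀ x u, h.inner x u u ≤ (1 + τ x ^ 3) * g.inner x u u
  inner_ge : ∀ x u, g.inner x u u ≤ (1 + τ x ^ 3) * h.inner x u u
  density_le : ∀ c ∈ atlas (Model n) M, ∀ y ∈ c.target,
    chartDensity h c y ≤ (1 + τ (c.symm y) ^ 3) * chartDensity g c y
  density_ge : ∀ c ∈ atlas (Model n) M, ∀ y ∈ c.target,
    chartDensity g c y ≤ (1 + τ (c.symm y) ^ 3) * chartDensity h c y
  scal_sub_le : ∀ x, |scal h x - scal g x| ≤ τ x ^ 3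

lemma Close.symm {τ : M → ℝ} {g h : Metr n M} (H : Close τ g h) : Close τ h g :=
  ⟨H.inner_ge, H.inner_le, H.density_ge, H.density_le, fun x => by
    rw [abs_sub_comm]; exact H.scal_sub_le x⟩

lemma Close.dualSq_le {τ : M → ℝ} {g h : Metr n M} (H : Close τ g h) (hτ : ∀ x, 0 ≤ τ x) (x : M)
    (α : TangentSpace (𝓡 n) x →L[ℝ] ℝ) : dualSq h x α ≤ (1 + τ x ^ 3) * dualSq g x α :=
  dualSq_le_of_inner_le (by have := pow_nonneg (hτ x) 3; linarith) (H.inner_ge x) α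

variable [MeasurableSpace M] [BorelSpace M]

lemma Close.riemMeasure_le {τ : M → ℝ} {g h : Metr n M} (H : Close τ g h) (hτc : Continuous τ)
    (hτ : ∀ x, 0 ≤ τ x) :
    riemMeasure h ≤ (riemMeasure g).withDensity fun x => ENNReal.ofReal (1 + τ x ^ 3) := by
  refine riemMeasure_le_withDensity (by fun_prop) fun c hc y hy => ?_
  have h3 := pow_nonneg (hτ (c.symm y)) 3
  rw [← ENNReal.ofReal_mul (chartDensity_pos g hc hy).le, mul_comm]
  exact ENNReal.ofReal_le_ofReal (H.density_le c hc y hy)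

lemma Close.lintegral_le {τ : M → ℝ} {g h : Metr n M} (H : Close τ g h) (hτc : Continuous τ)
    (hτ : ∀ x, 0 ≤ τ x) {f : M → ℝ≥0∞} (hf : Measurable f) :
    ∫⁻ x, f x ∂(riemMeasure h) ≤ ∫⁻ x, ENNReal.ofReal (1 + τ x ^ 3) * f x ∂(riemMeasure g) := by
  refine (lintegral_mono' (H.riemMeasure_le hτc hτ) le_rfl).trans ?_
  rw [lintegral_withDensity_eq_lintegral_mul _ (by fun_prop) hf]
  rfl

lemma integrable_of_continuous (g : Metr n M) {f : M → ℝ} (hf : Continuous f)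
    (hc : HasCompactSupport f) : Integrable f (riemMeasure g) :=
  hf.integrable_of_hasCompactSupport hc

lemma integrable_mul_of_continuous (g : Metr n M) {ψ f : M → ℝ} (hψ : Continuous ψ)
    (hf : Continuous f) (hc : HasCompactSupport f) :
    Integrable (fun x => ψ x * f x) (riemMeasure g) :=
  integrable_of_continuous g (hψ.mul hf) (hc.mul_left (f := ψ))

/-- Comparison of the integrals of a nonnegative function. -/
lemma Close.integral_le {τ : M → ℝ} {g h : Metr n M} (H : Close τ g h) (hτc : Continuous τ)
    (hτ : ∀ x, 0 ≤ τ x) {f : M → ℝ} (hf : Continuous f) (hc : HasCompactSupport f)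
    (hf0 : ∀ x, 0 ≤ f x) :
    ∫ x, f x ∂(riemMeasure h) ≤ ∫ x, (1 + τ x ^ 3) * f x ∂(riemMeasure g) := by
  have h3 : ∀ x, 0 ≤ 1 + τ x ^ 3 := fun x => by have := pow_nonneg (hτ x) 3; linarith
  have hcont : Continuous fun x => (1 + τ x ^ 3) * f x := by fun_prop
  have hint := integrable_of_continuous g hcont (hc.mul_left (f := fun x => 1 + τ x ^ 3))
  have hnn : ∀ x, 0 ≤ (1 + τ x ^ 3) * f x := fun x => mul_nonneg (h3 x) (hf0 x)
  rw [integral_eq_lintegral_of_nonneg_ae (ae_of_all _ hf0) hf.aestronglyMeasurable,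
    integral_eq_lintegral_of_nonneg_ae (ae_of_all _ hnn) hcont.aestronglyMeasurable]
  refine ENNReal.toReal_mono ?_ ?_
  · exact ((hasFiniteIntegral_iff_ofReal (ae_of_all _ hnn)).1 hint.2).ne
  · refine (H.lintegral_le hτc hτ hf.measurable.ennreal_ofReal).trans_eq ?_
    simp only [ENNReal.ofReal_mul (h3 _)]

/-- Comparison of the integrals of a function of arbitrary sign. -/
lemma Close.integral_ge {τ : M → ℝ} {g h : Metr n M} (H : Close τ g h) (hτc : Continuous τ)
    (hτ : ∀ x, 0 ≤ τ x) (hτ1 : ∀ x, τ x ≤ 1) {f : M → ℝ} (hf : Continuous f)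
    (hc : HasCompactSupport f) :
    ∫ x, (f x - τ x ^ 3 * |f x|) ∂(riemMeasure g) ≤ ∫ x, f x ∂(riemMeasure h) := by
  have h3 : ∀ x, 0 ≤ τ x ^ 3 := fun x => pow_nonneg (hτ x) 3
  have h31 : ∀ x, τ x ^ 3 ≤ 1 := fun x => pow_le_one₀ (hτ x) (hτ1 x)
  -- The positive part is estimated from below, the negative part from above.
  set p : M → ℝ := fun x => max (f x) 0 with hp
  set q : M → ℝ := fun x => max (-f x) 0 with hq
  have hpc : Continuous p := by fun_prop
  have hqc : Continuous q := by fun_prop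
  have hps : HasCompactSupport p := hc.mono fun x hx => by
    rw [Function.mem_support] at hx ⊢
    intro h0; exact hx (by simp [hp, h0])
  have hqs : HasCompactSupport q := hc.mono fun x hx => by
    rw [Function.mem_support] at hx ⊢
    intro h0; exact hx (by simp [hq, h0])
  have hp0 : ∀ x, 0 ≤ p x := fun x => le_max_right _ _
  have hq0 : ∀ x, 0 ≤ q x := fun x => le_max_right _ _
  have hpq : ∀ x, f x = p x - q x := fun x => by
    simp only [hp, hq]
    rcases le_total (f x) 0 with h0 | h0
    · rw [max_eq_right h0, max_eq_left (by linarith)]; ring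
    · rw [max_eq_left h0, max_eq_right (by linarith)]; ring
  have habs : ∀ x, |f x| = p x + q x := fun x => by
    simp only [hp, hq]
    rcases le_total (f x) 0 with h0 | h0
    · rw [max_eq_right h0, max_eq_left (by linarith), abs_of_nonpos h0]; ring
    · rw [max_eq_left h0, max_eq_right (by linarith), abs_of_nonneg h0]; ring
  have hm : Continuous fun x => 1 - τ x ^ 3 := by fun_prop
  have hP : Continuous fun x => 1 + τ x ^ 3 := by fun_prop
  have i1 : Integrable (fun x => (1 - τ x ^ 3) * p x) (riemMeasure g) :=
    integrable_mul_of_continuous g hm hpc hps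
  have i2 : Integrable (fun x => (1 + τ x ^ 3) * q x) (riemMeasure g) :=
    integrable_mul_of_continuous g hP hqc hqs
  have e1 : ∫ x, (1 - τ x ^ 3) * p x ∂(riemMeasure g) ≤ ∫ x, p x ∂(riemMeasure h) := by
    have hpm : HasCompactSupport fun x => (1 - τ x ^ 3) * p x :=
      hps.mul_left (f := fun x => 1 - τ x ^ 3)
    have hpmc : Continuous fun x => (1 - τ x ^ 3) * p x := hm.mul hpc
    have b1 := H.symm.integral_le hτc hτ hpmc hpm
      (fun x => mul_nonneg (by linarith [h31 x]) (hp0 x))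
    refine b1.trans (integral_mono (integrable_mul_of_continuous h hP hpmc hpm)
      (integrable_of_continuous h hpc hps) fun x => ?_)
    have := mul_nonneg (mul_nonneg (h3 x) (h3 x)) (hp0 x)
    simp only
    linarith
  have e2 := H.integral_le hτc hτ hqc hqs hq0
  have e3 : ∫ x, (f x - τ x ^ 3 * |f x|) ∂(riemMeasure g) =
      ∫ x, (1 - τ x ^ 3) * p x ∂(riemMeasure g) - ∫ x, (1 + τ x ^ 3) * q x ∂(riemMeasure g) := by
    rw [← integral_sub i1 i2]
    refine integral_congr_ae (ae_of_all _ fun x => ?_)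
    simp only
    rw [habs x, hpq x]; ring
  have e4 : ∫ x, f x ∂(riemMeasure h) = ∫ x, p x ∂(riemMeasure h) - ∫ x, q x ∂(riemMeasure h) := by
    rw [← integral_sub (integrable_of_continuous h hpc hps) (integrable_of_continuous h hqc hqs)]
    exact integral_congr_ae (ae_of_all _ hpq)
  rw [e3, e4]
  linarith

end Close

/-! ### The energy and the norm -/

section Energy

variable {n : ℕ} {M : Type*} [TopologicalSpace M] [ChartedSpace (Model n) M]
  [IsManifold (𝓡 n) ∞ M]

/-- The integrand of the Yamabe functional. -/
def energyDensity (g : Metr n M) (v : M → ℝ) (x : M) : ℝ :=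
  yamabeCoeff n * normSqDiff g v x + scal g x * v x ^ 2

lemma yamabeCoeff_pos (hn : 3 ≤ n) : 0 < yamabeCoeff n := by
  have : (3 : ℝ) ≤ n := by exact_mod_cast hn
  exact div_pos (by linarith) (by linarith)

omit [IsManifold (𝓡 n) ∞ M] in
lemma dfun_eq_zero {v : M → ℝ} {x : M} (hx : x ∉ tsupport v) : dfun (n := n) v x = 0 := by
  have h1 : v =ᶠ[𝓝 x] fun _ => 0 := notMem_tsupport_iff_eventuallyEq.1 hx
  have h2 := h1.mfderiv_eq (I := 𝓡 n) (I' := 𝓘(ℝ, ℝ))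
  exact h2.trans mfderiv_const

lemma normSqDiff_eq_zero (g : Metr n M) {v : M → ℝ} {x : M} (hx : x ∉ tsupport v) :
    normSqDiff g v x = 0 := by
  rw [normSqDiff_eq, dfun_eq_zero hx, dualSq_eq g x (u := 0) (by simp)]
  simp

lemma hasCompactSupport_of_eq_zero {v f : M → ℝ} (hv : HasCompactSupport v)
    (h : ∀ x, x ∉ tsupport v → f x = 0) : HasCompactSupport f :=
  HasCompactSupport.intro' hv (isClosed_tsupport v) fun x hx => h x hx

lemma energyDensity_eq_zero (g : Metr n M) {v : M → ℝ} {x : M} (hx : x ∉ tsupport v) :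
    energyDensity g v x = 0 := by
  rw [energyDensity, normSqDiff_eq_zero g hx, image_eq_zero_of_notMem_tsupport hx]; simp

lemma continuous_energyDensity (g : Metr n M) {v : M → ℝ}
    (hv : ContMDiff (𝓡 n) 𝓘(ℝ, ℝ) ∞ v) : Continuous (energyDensity g v) :=
  (continuous_const.mul (continuous_normSqDiff g hv)).add
    ((continuous_scal g).mul (hv.continuous.pow 2))

variable [MeasurableSpace M]

/-- The energy `∫ (a |dv|² + scal v²) dμ`. -/
def energy (g : Metr n M) (v : M → ℝ) : ℝ := ∫ x, energyDensity g v x ∂(riemMeasure g)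

/-- The squared `L^p`-norm. -/
def normSq (g : Metr n M) (v : M → ℝ) : ℝ := lqNorm g (yamabeExponent n) v ^ 2

lemma yamabeFunctional_eq (g : Metr n M) (v : M → ℝ) :
    yamabeFunctional g v = 1 / normSq g v * energy g v := rfl

variable [BorelSpace M]

lemma integrable_energyDensity (g : Metr n M) {v : M → ℝ} (hv : ContMDiff (𝓡 n) 𝓘(ℝ, ℝ) ∞ v)
    (hc : HasCompactSupport v) : Integrable (energyDensity g v) (riemMeasure g) :=
  integrable_of_continuous g (continuous_energyDensity g hv)
    (hasCompactSupport_of_eq_zero hc fun _ hx => energyDensity_eq_zero g hx)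

lemma two_lt_yamabeExponent (hn : 3 ≤ n) : 2 < yamabeExponent n := by
  have : (3 : ℝ) ≤ n := by exact_mod_cast hn
  rw [yamabeExponent, lt_div_iff₀ (by linarith)]
  linarith

omit [ChartedSpace (Model n) M] [IsManifold (𝓡 n) ∞ M] [MeasurableSpace M] [BorelSpace M] in
lemma continuous_abs_rpow (hn : 3 ≤ n) {v : M → ℝ} (hv : Continuous v) :
    Continuous fun x => |v x| ^ yamabeExponent n :=
  hv.abs.rpow_const fun _ => Or.inr (by linarith [two_lt_yamabeExponent hn])

omit [ChartedSpace (Model n) M] [IsManifold (𝓡 n) ∞ M] [MeasurableSpace M] [BorelSpace M] in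
lemma hasCompactSupport_abs_rpow (hn : 3 ≤ n) {v : M → ℝ} (hc : HasCompactSupport v) :
    HasCompactSupport fun x => |v x| ^ yamabeExponent n :=
  hasCompactSupport_of_eq_zero hc fun x hx => by
    rw [image_eq_zero_of_notMem_tsupport hx, abs_zero,
      Real.zero_rpow (by linarith [two_lt_yamabeExponent hn])]

omit [BorelSpace M] in
lemma normSq_eq (g : Metr n M) (v : M → ℝ) : normSq g v =
    (∫ x, |v x| ^ yamabeExponent n ∂(riemMeasure g)) ^ (2 / yamabeExponent n) := by
  have h0 : 0 ≤ ∫ x, |v x| ^ yamabeExponent n ∂(riemMeasure g) :=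
    integral_nonneg fun x => Real.rpow_nonneg (abs_nonneg _) _
  rw [normSq, lqNorm, ← Real.rpow_natCast, ← Real.rpow_mul h0]
  congr 1
  push_cast; ring

omit [BorelSpace M] in
lemma normSq_nonneg (g : Metr n M) (v : M → ℝ) : 0 ≤ normSq g v := sq_nonneg _

lemma normSq_pos (hn : 3 ≤ n) (g : Metr n M) {v : M → ℝ} (hv : Continuous v)
    (hc : HasCompactSupport v) (h0 : v ≠ 0) : 0 < normSq g v := by
  have hi := integrable_of_continuous g (continuous_abs_rpow hn hv)
    (hasCompactSupport_abs_rpow hn hc)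
  rw [normSq_eq]
  refine Real.rpow_pos_of_pos ?_ _
  obtain ⟨x, hx⟩ := Function.ne_iff.1 h0
  refine (continuous_abs_rpow hn hv).integral_pos_of_hasCompactSupport_nonneg_nonzero
    (hasCompactSupport_abs_rpow hn hc) (fun x => Real.rpow_nonneg (abs_nonneg _) _) (x := x) ?_
  exact (Real.rpow_pos_of_pos (abs_pos.2 hx) _).ne'

lemma normSq_mono (hn : 3 ≤ n) (g : Metr n M) {u v : M → ℝ} (hu : Continuous u)
    (huc : HasCompactSupport u) (hv : Continuous v)
    (hc : HasCompactSupport v) (h : ∀ x, |u x| ≤ |v x|) : normSq g u ≤ normSq g v := by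
  have hp := two_lt_yamabeExponent hn
  rw [normSq_eq, normSq_eq]
  refine Real.rpow_le_rpow (integral_nonneg fun x => Real.rpow_nonneg (abs_nonneg _) _) ?_
    (by positivity)
  exact integral_mono
    (integrable_of_continuous g (continuous_abs_rpow hn hu) (hasCompactSupport_abs_rpow hn huc))
    (integrable_of_continuous g (continuous_abs_rpow hn hv) (hasCompactSupport_abs_rpow hn hc))
    fun x => Real.rpow_le_rpow (abs_nonneg _) (h x) (by linarith)

lemma Close.normSq_le (hn : 3 ≤ n) {τ : M → ℝ} {g h : Metr n M} (H : Close τ g h)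
    (hτc : Continuous τ) (hτ : ∀ x, 0 ≤ τ x) {v : M → ℝ} (hv : Continuous v)
    (hc : HasCompactSupport v) {ε : ℝ} (hε : 0 ≤ ε) (hsupp : ∀ x ∈ tsupport v, τ x ^ 3 ≤ ε) :
    normSq h v ≤ (1 + ε) * normSq g v := by
  have hp := two_lt_yamabeExponent hn
  have hcont := continuous_abs_rpow hn hv
  have hsup := hasCompactSupport_abs_rpow hn hc
  have hnn : ∀ x, 0 ≤ |v x| ^ yamabeExponent n := fun x => Real.rpow_nonneg (abs_nonneg _) _
  have e1 : ∫ x, |v x| ^ yamabeExponent n ∂(riemMeasure h) ≤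
      (1 + ε) * ∫ x, |v x| ^ yamabeExponent n ∂(riemMeasure g) := by
    refine (H.integral_le hτc hτ hcont hsup hnn).trans ?_
    rw [← integral_const_mul]
    refine integral_mono (integrable_of_continuous g (by fun_prop)
      (hsup.mul_left (f := fun x => 1 + τ x ^ 3)))
      ((integrable_of_continuous g hcont hsup).const_mul _) fun x => ?_
    by_cases hx : x ∈ tsupport v
    · exact mul_le_mul_of_nonneg_right (by linarith [hsupp x hx]) (hnn x)
    · simp only [image_eq_zero_of_notMem_tsupport hx, abs_zero]
      rw [Real.zero_rpow (by linarith)]; simp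
  rw [normSq_eq, normSq_eq]
  calc _ ≤ ((1 + ε) * ∫ x, |v x| ^ yamabeExponent n ∂(riemMeasure g)) ^ (2 / yamabeExponent n) :=
        Real.rpow_le_rpow (integral_nonneg hnn) e1 (by positivity)
    _ = (1 + ε) ^ (2 / yamabeExponent n) * _ :=
        Real.mul_rpow (by linarith) (integral_nonneg hnn)
    _ ≤ (1 + ε) * _ := by
        refine mul_le_mul_of_nonneg_right ?_ (Real.rpow_nonneg (integral_nonneg hnn) _)
        refine (Real.rpow_le_rpow_of_exponent_le (by linarith)
          (show 2 / yamabeExponent n ≤ 1 from ?_)).trans_eq (Real.rpow_one _)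
        rw [div_le_one (by linarith)]; exact hp.le

/-- Hölder's inequality with the exponents `n / 2` and `n / (n - 2)`. -/
lemma integral_mul_sq_le (hn : 3 ≤ n) (g : Metr n M) {w v : M → ℝ} (hw : Continuous w)
    (hw0 : ∀ x, 0 ≤ w x) (hwi : Integrable (fun x => w x ^ ((n : ℝ) / 2)) (riemMeasure g))
    (hv : Continuous v) (hc : HasCompactSupport v) :
    ∫ x, w x * v x ^ 2 ∂(riemMeasure g) ≤
      (∫ x, w x ^ ((n : ℝ) / 2) ∂(riemMeasure g)) ^ (1 / ((n : ℝ) / 2)) * normSq g v := by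
  have hn3 : (3 : ℝ) ≤ n := by exact_mod_cast hn
  have hq : (0 : ℝ) < n / (n - 2) := div_pos (by linarith) (by linarith)
  have hpq : ((n : ℝ) / 2).HolderConjugate (n / (n - 2)) := by
    rw [Real.holderConjugate_iff]
    refine ⟨by linarith, ?_⟩
    have : (n : ℝ) - 2 ≠ 0 := by linarith
    field_simp
    ring
  have hpow : ∀ x, (v x ^ 2) ^ ((n : ℝ) / (n - 2)) = |v x| ^ yamabeExponent n := by
    intro x
    rw [← sq_abs, ← Real.rpow_natCast, ← Real.rpow_mul (abs_nonneg _)]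
    congr 1
    rw [yamabeExponent]; push_cast; ring
  have hm1 : MemLp w (ENNReal.ofReal ((n : ℝ) / 2)) (riemMeasure g) := by
    rw [← integrable_norm_rpow_iff hw.aestronglyMeasurable
      (by simp; linarith) ENNReal.ofReal_ne_top, ENNReal.toReal_ofReal (by linarith)]
    refine hwi.congr (ae_of_all _ fun x => ?_)
    simp only
    rw [Real.norm_of_nonneg (hw0 x)]
  have hm2 : MemLp (fun x => v x ^ 2) (ENNReal.ofReal ((n : ℝ) / (n - 2))) (riemMeasure g) := by
    refine Continuous.memLp_of_hasCompactSupport (by fun_prop) ?_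
    exact hasCompactSupport_of_eq_zero hc fun x hx => by
      rw [image_eq_zero_of_notMem_tsupport hx]; simp
  refine (integral_mul_le_Lp_mul_Lq_of_nonneg hpq (ae_of_all _ hw0)
    (ae_of_all _ fun x => sq_nonneg (v x)) hm1 hm2).trans_eq ?_
  congr 1
  rw [normSq_eq]
  simp only [hpow]
  congr 1
  rw [yamabeExponent]
  field_simp

end Energy

/-! ### Localization of the energy -/

section Localization

variable {n : ℕ} {M : Type*} [TopologicalSpace M] [ChartedSpace (Model n) M]
  [IsManifold (𝓡 n) ∞ M]

omit [IsManifold (𝓡 n) ∞ M] in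
lemma dfun_sin_mul {τ v : M → ℝ} {x : M} (hτ : MDifferentiableAt (𝓡 n) 𝓘(ℝ, ℝ) τ x)
    (hv : MDifferentiableAt (𝓡 n) 𝓘(ℝ, ℝ) v x) :
    dfun (n := n) (fun z => Real.sin (τ z) * v z) x =
      Real.sin (τ x) • dfun v x + (v x * Real.cos (τ x)) • dfun τ x := by
  have h1 : MDifferentiableAt (𝓡 n) 𝓘(ℝ, ℝ) (fun z => Real.sin (τ z)) x :=
    (Real.differentiable_sin.differentiableAt.mdifferentiableAt).comp x hτ
  rw [dfun_mul h1 hv, dfun_comp (Real.hasDerivAt_sin _) hτ, smul_smul]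

omit [IsManifold (𝓡 n) ∞ M] in
lemma dfun_cos_mul {τ v : M → ℝ} {x : M} (hτ : MDifferentiableAt (𝓡 n) 𝓘(ℝ, ℝ) τ x)
    (hv : MDifferentiableAt (𝓡 n) 𝓘(ℝ, ℝ) v x) :
    dfun (n := n) (fun z => Real.cos (τ z) * v z) x =
      Real.cos (τ x) • dfun v x + (v x * -Real.sin (τ x)) • dfun τ x := by
  have h1 : MDifferentiableAt (𝓡 n) 𝓘(ℝ, ℝ) (fun z => Real.cos (τ z)) x :=
    (Real.differentiable_cos.differentiableAt.mdifferentiableAt).comp x hτ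
  rw [dfun_mul h1 hv, dfun_comp (Real.hasDerivAt_cos _) hτ, smul_smul]

/-- The IMS localization formula for the quadratic partition of unity `sin² τ + cos² τ = 1`. -/
lemma energyDensity_sin_add_cos (g : Metr n M) {τ v : M → ℝ} {x : M}
    (hτ : MDifferentiableAt (𝓡 n) 𝓘(ℝ, ℝ) τ x) (hv : MDifferentiableAt (𝓡 n) 𝓘(ℝ, ℝ) v x) :
    energyDensity g (fun z => Real.sin (τ z) * v z) x +
      energyDensity g (fun z => Real.cos (τ z) * v z) x =
      energyDensity g v x + yamabeCoeff n * (normSqDiff g τ x * v x ^ 2) := by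
  obtain ⟨b, hb⟩ := exists_dualSq_combo g x (dfun v x) (dfun τ x)
  simp only [energyDensity, normSqDiff_eq, dfun_sin_mul hτ hv, dfun_cos_mul hτ hv, hb]
  have h := Real.sin_sq_add_cos_sq (τ x)
  linear_combination (yamabeCoeff n * dualSq g x (dfun v x) +
    yamabeCoeff n * v x ^ 2 * dualSq g x (dfun τ x) + scal g x * v x ^ 2) * h

/-- The weight `|dτ|² + τ² (1 + |scal|)` by which `v²` is multiplied in the error terms of the
localization by `τ`. By Hölder's inequality they are harmless if it is in `L^{n/2}`. -/
def weight (g : Metr n M) (τ : M → ℝ) (x : M) : ℝ :=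
  normSqDiff g τ x + τ x ^ 2 * (1 + |scal g x|)

lemma normSqDiff_nonneg (g : Metr n M) (v : M → ℝ) (x : M) : 0 ≤ normSqDiff g v x :=
  dualSq_nonneg g x _

lemma weight_nonneg (g : Metr n M) (τ : M → ℝ) (x : M) : 0 ≤ weight g τ x := by
  have := normSqDiff_nonneg g τ x
  unfold weight; positivity

lemma continuous_weight (g : Metr n M) {τ : M → ℝ} (hτ : ContMDiff (𝓡 n) 𝓘(ℝ, ℝ) ∞ τ) :
    Continuous (weight g τ) :=
  (continuous_normSqDiff g hτ).add
    ((hτ.continuous.pow 2).mul (continuous_const.add (continuous_scal g).abs))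

/-- The absolute energy density `a |dv|² + (1 + |scal|) v²`. -/
def absDensity (g : Metr n M) (v : M → ℝ) (x : M) : ℝ :=
  yamabeCoeff n * normSqDiff g v x + (1 + |scal g x|) * v x ^ 2

lemma absDensity_nonneg (hn : 3 ≤ n) (g : Metr n M) (v : M → ℝ) (x : M) :
    0 ≤ absDensity g v x := by
  have := normSqDiff_nonneg g v x
  have := yamabeCoeff_pos hn
  unfold absDensity; positivity

lemma absDensity_eq_zero (g : Metr n M) {v : M → ℝ} {x : M} (hx : x ∉ tsupport v) :
    absDensity g v x = 0 := by
  rw [absDensity, normSqDiff_eq_zero g hx, image_eq_zero_of_notMem_tsupport hx]; simp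

lemma continuous_absDensity (g : Metr n M) {v : M → ℝ}
    (hv : ContMDiff (𝓡 n) 𝓘(ℝ, ℝ) ∞ v) : Continuous (absDensity g v) :=
  (continuous_const.mul (continuous_normSqDiff g hv)).add
    ((continuous_const.add (continuous_scal g).abs).mul (hv.continuous.pow 2))

/-- The absolute energy density, multiplied by `τ²`, is controlled by the energy density of the
localized function `(sin τ) v`. -/
lemma sq_mul_absDensity_le (hn : 3 ≤ n) (g : Metr n M) {τ v : M → ℝ} {x : M}
    (hτ : MDifferentiableAt (𝓡 n) 𝓘(ℝ, ℝ) τ x) (hv : MDifferentiableAt (𝓡 n) 𝓘(ℝ, ℝ) v x)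
    (h0 : 0 < τ x) (h1 : τ x ≤ 1) :
    τ x ^ 2 * absDensity g v x ≤ 4 * energyDensity g (fun z => Real.sin (τ z) * v z) x +
      (5 + 4 * yamabeCoeff n) * (weight g τ x * v x ^ 2) := by
  obtain ⟨b, hb⟩ := exists_dualSq_combo g x (dfun v x) (dfun τ x)
  have ha := yamabeCoeff_pos hn
  -- This absorbs the mixed term: `|s α + k v β|² ≥ ½ s² |α|² - k² v² |β|²`.
  have e1 := dualSq_nonneg g x
    (Real.sin (τ x) • dfun v x + (2 * (v x * Real.cos (τ x))) • dfun τ x)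
  simp only [energyDensity, absDensity, weight, normSqDiff_eq, dfun_sin_mul hτ hv, hb] at e1 ⊢
  have hα := dualSq_nonneg g x (dfun v x)
  have hβ := dualSq_nonneg g x (dfun τ x)
  set A := dualSq g x (dfun v x)
  set B := dualSq g x (dfun τ x)
  set a := yamabeCoeff n
  set S := scal g x
  set s := Real.sin (τ x)
  set k := Real.cos (τ x)
  set t := τ x
  set V := v x
  have hs1 : s ≤ t := Real.sin_le h0.le
  have hs2 : t - t ^ 3 / 6 ≤ s := (Real.sin_gt_sub_cube h0).le
  have hs3 : 3 / 4 * t ≤ s := by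
    have : t ^ 3 ≤ t := pow_le_of_le_one h0.le h1 (by norm_num)
    linarith
  have hs0 : 0 ≤ s := by linarith
  have hst : s ^ 2 ≤ t ^ 2 := by gcongr
  have hts : t ^ 2 ≤ 2 * s ^ 2 := by nlinarith
  have hk : k ^ 2 ≤ 1 := Real.cos_sq_le_one _
  have c1 : t ^ 2 * (a * A) ≤ 2 * s ^ 2 * (a * A) := by gcongr
  have c2 : a * (k ^ 2 * V ^ 2 * B) ≤ a * (V ^ 2 * B) := by
    have : k ^ 2 * V ^ 2 * B ≤ 1 * (V ^ 2 * B) := by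
      rw [mul_assoc]; gcongr
    rw [one_mul] at this
    gcongr
  have c3 : -(t ^ 2 * |S| * V ^ 2) ≤ S * (s * V) ^ 2 := by
    have h2 : -|S| ≤ S := neg_abs_le S
    have h3 : -|S| * (s * V) ^ 2 ≤ S * (s * V) ^ 2 := by gcongr
    have h4 : |S| * (s ^ 2 * V ^ 2) ≤ |S| * (t ^ 2 * V ^ 2) := by gcongr
    nlinarith
  have c4 := mul_nonneg ha.le e1
  have c5 : 0 ≤ t ^ 2 * V ^ 2 := by positivity
  have c6 : 0 ≤ B * V ^ 2 := by positivity
  have c7 : 0 ≤ t ^ 2 * |S| * V ^ 2 := by positivity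
  have c8 : 0 ≤ a * (t ^ 2 * (1 + |S|) * V ^ 2) := by positivity
  nlinarith

/-- The energy densities of close metrics, compared through the absolute energy density. -/
lemma Close.energyDensity_ge (hn : 3 ≤ n) {τ : M → ℝ} {g h : Metr n M} (H : Close τ g h)
    (hτ : ∀ x, 0 ≤ τ x) (hτ1 : ∀ x, τ x ≤ 1) (v : M → ℝ) (x : M) :
    energyDensity g v x - 3 * (τ x ^ 3 * absDensity g v x) ≤
      energyDensity h v x - τ x ^ 3 * |energyDensity h v x| := by
  have ha := yamabeCoeff_pos hn
  have d1 := H.dualSq_le hτ x (dfun v x)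
  have d2 := H.symm.dualSq_le hτ x (dfun v x)
  have d3 := H.scal_sub_le x
  have h3 : 0 ≤ τ x ^ 3 := pow_nonneg (hτ x) 3
  have h31 : τ x ^ 3 ≤ 1 := pow_le_one₀ (hτ x) (hτ1 x)
  simp only [energyDensity, absDensity, normSqDiff_eq]
  have hA := dualSq_nonneg g x (dfun v x)
  have hB := dualSq_nonneg h x (dfun v x)
  set A := dualSq g x (dfun v x)
  set B := dualSq h x (dfun v x)
  set a := yamabeCoeff n
  set S := scal g x
  set S' := scal h x
  set t := τ x ^ 3
  set V := v x ^ 2 with hVdef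
  have hV : 0 ≤ V := sq_nonneg _
  have f1 : (1 - t) * A ≤ B := by nlinarith
  have f2 : B ≤ 2 * A := by nlinarith
  have f3 : |S'| ≤ |S| + 1 := by
    have := abs_sub_abs_le_abs_sub S' S
    linarith
  have f4 : S - t ≤ S' := by linarith [(abs_le.1 d3).1]
  have f5 : |a * B + S' * V| ≤ 2 * (a * A + (1 + |S|) * V) := by
    calc |a * B + S' * V| ≤ |a * B| + |S' * V| := abs_add_le _ _
      _ = a * B + |S'| * V := by
          rw [abs_of_nonneg (mul_nonneg ha.le hB), abs_mul, abs_of_nonneg hV]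
      _ ≤ a * (2 * A) + (|S| + 1) * V := by gcongr
      _ ≤ _ := by nlinarith [mul_nonneg (add_nonneg zero_le_one (abs_nonneg S)) hV]
  have f6 : t * |a * B + S' * V| ≤ t * (2 * (a * A + (1 + |S|) * V)) := by gcongr
  have f7 : a * ((1 - t) * A) ≤ a * B := by gcongr
  have f8 : (S - t) * V ≤ S' * V := by gcongr
  have f9 : 0 ≤ t * (|S| * V) := by positivity
  nlinarith

variable [MeasurableSpace M] [BorelSpace M]

/-- A lower bound for the Yamabe constant bounds the integral of `τ² (a |dv|² + (1 + |scal|) v²)` by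
the energy and the squared `L^p`-norm. -/
lemma exists_integral_absDensity_le (hn : 3 ≤ n) (g : Metr n M) {τ : M → ℝ}
    (hτ : ContMDiff (𝓡 n) 𝓘(ℝ, ℝ) ∞ τ) (h0 : ∀ x, 0 < τ x) (h1 : ∀ x, τ x ≤ 1)
    (hw : Integrable (fun x => weight g τ x ^ ((n : ℝ) / 2)) (riemMeasure g)) {U : Set M} {r : ℝ}
    (hr : ∀ v ∈ testFunctions n U, r * normSq g v ≤ energy g v) :
    ∃ B : ℝ, 0 ≤ B ∧ ∀ v ∈ testFunctions n U,
      ∫ x, τ x ^ 2 * absDensity g v x ∂(riemMeasure g) ≤ 4 * energy g v + B * normSq g v := by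
  have ha := yamabeCoeff_pos hn
  set D : ℝ := (∫ x, weight g τ x ^ ((n : ℝ) / 2) ∂(riemMeasure g)) ^ (1 / ((n : ℝ) / 2)) with hD
  have hD0 : 0 ≤ D := Real.rpow_nonneg
    (integral_nonneg fun x => Real.rpow_nonneg (weight_nonneg g τ x) _) _
  set a := yamabeCoeff n with hadef
  refine ⟨4 * (a * D) + 4 * |r| + (5 + 4 * a) * D, by positivity, ?_⟩
  rintro v ⟨hv, hc, hsub, hnn, hne⟩
  have hvd : ∀ x, MDifferentiableAt (𝓡 n) 𝓘(ℝ, ℝ) v x := fun x => hv.mdifferentiableAt (by simp)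
  have hτd : ∀ x, MDifferentiableAt (𝓡 n) 𝓘(ℝ, ℝ) τ x := fun x => hτ.mdifferentiableAt (by simp)
  have hN := normSq_nonneg g v
  set s : M → ℝ := fun z => Real.sin (τ z) * v z with hs
  set k : M → ℝ := fun z => Real.cos (τ z) * v z with hk
  have hssm : ContMDiff (𝓡 n) 𝓘(ℝ, ℝ) ∞ s :=
    (Real.contDiff_sin.contMDiff.comp hτ).mul hv
  have hksm : ContMDiff (𝓡 n) 𝓘(ℝ, ℝ) ∞ k :=
    (Real.contDiff_cos.contMDiff.comp hτ).mul hv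
  have hsc : HasCompactSupport s := hc.mul_left (f := fun z => Real.sin (τ z))
  have hkc : HasCompactSupport k := hc.mul_left (f := fun z => Real.cos (τ z))
  have hcos : ∀ x, 0 < Real.cos (τ x) := fun x =>
    Real.cos_pos_of_le_one (by rw [abs_of_pos (h0 x)]; exact h1 x)
  have hkt : k ∈ testFunctions n U := by
    refine ⟨hksm, hkc, (tsupport_mul_subset_right).trans hsub,
      fun x => mul_nonneg (hcos x).le (hnn x), fun hk0 => hne ?_⟩
    funext x
    exact (mul_eq_zero.1 (congrFun hk0 x)).resolve_left (hcos x).ne'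
  have q1 : -(|r| * normSq g v) ≤ energy g k := by
    refine le_trans ?_ (hr k hkt)
    have hkN : normSq g k ≤ normSq g v := by
      refine normSq_mono hn g hksm.continuous hkc hv.continuous hc fun x => ?_
      rw [hk, abs_mul]
      exact mul_le_of_le_one_left (abs_nonneg _) (Real.abs_cos_le_one _)
    have := normSq_nonneg g k
    nlinarith [neg_abs_le r, abs_nonneg r]
  have q2 : ∫ x, weight g τ x * v x ^ 2 ∂(riemMeasure g) ≤ D * normSq g v :=
    integral_mul_sq_le hn g (continuous_weight g hτ) (weight_nonneg g τ) hw hv.continuous hc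
  have hv2 : HasCompactSupport fun x => v x ^ 2 :=
    hasCompactSupport_of_eq_zero hc fun x hx => by
      rw [image_eq_zero_of_notMem_tsupport hx]; simp
  have hv2c : Continuous fun x => v x ^ 2 := hv.continuous.pow 2
  have iw := integrable_mul_of_continuous g (continuous_weight g hτ) hv2c hv2
  have id := integrable_mul_of_continuous g (continuous_normSqDiff g hτ) hv2c hv2
  have is := integrable_energyDensity g hssm hsc
  have ik := integrable_energyDensity g hksm hkc
  have iv := integrable_energyDensity g hv hc
  have q3 : energy g s + energy g k = energy g v +
      a * ∫ x, normSqDiff g τ x * v x ^ 2 ∂(riemMeasure g) := by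
    rw [energy, energy, energy, ← integral_add is ik, ← integral_const_mul,
      ← integral_add iv (id.const_mul a)]
    exact integral_congr_ae (ae_of_all _ fun x => energyDensity_sin_add_cos g (hτd x) (hvd x))
  have q4 : ∫ x, normSqDiff g τ x * v x ^ 2 ∂(riemMeasure g) ≤
      ∫ x, weight g τ x * v x ^ 2 ∂(riemMeasure g) := by
    refine integral_mono id iw fun x => mul_le_mul_of_nonneg_right ?_ (sq_nonneg _)
    unfold weight
    have : 0 ≤ τ x ^ 2 * (1 + |scal g x|) := by positivity
    linarith
  have q5 : ∫ x, τ x ^ 2 * absDensity g v x ∂(riemMeasure g) ≤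
      4 * energy g s + (5 + 4 * a) * ∫ x, weight g τ x * v x ^ 2 ∂(riemMeasure g) := by
    rw [energy, ← integral_const_mul, ← integral_const_mul,
      ← integral_add (is.const_mul 4) (iw.const_mul _)]
    refine integral_mono (integrable_mul_of_continuous g (hτ.continuous.pow 2)
      (continuous_absDensity g hv)
      (hasCompactSupport_of_eq_zero hc fun x hx => absDensity_eq_zero g hx))
      ((is.const_mul 4).add (iw.const_mul _)) fun x => ?_
    exact sq_mul_absDensity_le hn g (hτd x) (hvd x) (h0 x) (h1 x)
  have q6 : a * ∫ x, normSqDiff g τ x * v x ^ 2 ∂(riemMeasure g) ≤ a * (D * normSq g v) :=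
    mul_le_mul_of_nonneg_left (q4.trans q2) ha.le
  have q7 : (5 + 4 * a) * ∫ x, weight g τ x * v x ^ 2 ∂(riemMeasure g) ≤
      (5 + 4 * a) * (D * normSq g v) := mul_le_mul_of_nonneg_left q2 (by linarith)
  nlinarith

/-- Lower bounds for the Yamabe constant persist, with an arbitrarily small loss, on the complement
of a larger compact set when the metric is replaced by a close one. -/
lemma Close.exists_isCompact (hn : 3 ≤ n) {τ : M → ℝ} {g h : Metr n M} (H : Close τ g h)
    (hτ : ContMDiff (𝓡 n) 𝓘(ℝ, ℝ) ∞ τ) (h0 : ∀ x, 0 < τ x) (h1 : ∀ x, τ x ≤ 1)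
    (hlim : Tendsto τ (cocompact M) (𝓝 0))
    (hw : Integrable (fun x => weight g τ x ^ ((n : ℝ) / 2)) (riemMeasure g)) {K : Set M}
    (hK : IsCompact K) {r r' : ℝ} (hrr : r < r')
    (hr : ∀ v ∈ testFunctions n Kᶜ, r' * normSq g v ≤ energy g v) :
    ∃ K' : Set M, IsCompact K' ∧ ∀ v ∈ testFunctions n K'ᶜ, r * normSq h v ≤ energy h v := by
  obtain ⟨B, hB, hcoer⟩ := exists_integral_absDensity_le hn g hτ h0 h1 hw hr
  have hτ0 : ∀ x, 0 ≤ τ x := fun x => (h0 x).le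
  -- `ε` is so small that the accumulated loss is at most `r' - r`.
  set L : ℝ := |r| + 12 * |r'| + 3 * B + 12 * (r' - r) + 1 with hL
  have hLpos : 0 < L := by
    have := abs_nonneg r; have := abs_nonneg r'; have : 0 < r' - r := by linarith
    positivity
  set ε : ℝ := (r' - r) / L with hε
  have hε0 : 0 < ε := div_pos (by linarith) hLpos
  have hεL : ε * L = r' - r := div_mul_cancel₀ _ hLpos.ne'
  have hε12 : 12 * ε ≤ 1 := by
    have h2 : 12 * (r' - r) ≤ L := by
      have := abs_nonneg r; have := abs_nonneg r'; rw [hL]; linarith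
    rw [hε, ← mul_div_assoc, div_le_one hLpos]
    exact h2
  have hbound : |r| * ε + 12 * ε * |r'| + 3 * ε * B ≤ r' - r := by
    have : ε * (|r| + 12 * |r'| + 3 * B) ≤ ε * L := by
      have : 0 < r' - r := by linarith
      gcongr; rw [hL]; linarith
    linarith
  obtain ⟨K₁, hK₁, hK₁s⟩ := mem_cocompact.1 (hlim (Iio_mem_nhds hε0))
  refine ⟨K ∪ K₁, hK.union hK₁, ?_⟩
  rintro v ⟨hv, hc, hsub, hnn, hne⟩
  have hvt : v ∈ testFunctions n Kᶜ :=
    ⟨hv, hc, hsub.trans (compl_subset_compl.2 subset_union_left), hnn, hne⟩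
  have hτε : ∀ x ∈ tsupport v, τ x ≤ ε := fun x hx =>
    (show τ x < ε from hK₁s fun hx1 => hsub hx (Or.inr hx1)).le
  have hτ3ε : ∀ x ∈ tsupport v, τ x ^ 3 ≤ ε := fun x hx =>
    (pow_le_of_le_one (hτ0 x) (h1 x) (by norm_num)).trans (hτε x hx)
  have hNg := normSq_nonneg g v
  have p1 := hcoer v hvt
  have p2 := hr v hvt
  have p3 := H.normSq_le hn hτ.continuous hτ0 hv.continuous hc hε0.le hτ3ε
  have p4 := H.symm.normSq_le hn hτ.continuous hτ0 hv.continuous hc hε0.le hτ3ε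
  have hac := continuous_absDensity g hv
  have has : HasCompactSupport (absDensity g v) :=
    hasCompactSupport_of_eq_zero hc fun x hx => absDensity_eq_zero g hx
  have i2 : Integrable (fun x => τ x ^ 2 * absDensity g v x) (riemMeasure g) :=
    integrable_mul_of_continuous g (hτ.continuous.pow 2) hac has
  have i3 : Integrable (fun x => τ x ^ 3 * absDensity g v x) (riemMeasure g) :=
    integrable_mul_of_continuous g (hτ.continuous.pow 3) hac has
  have iv := integrable_energyDensity g hv hc
  have p5 : energy g v - 3 * ∫ x, τ x ^ 3 * absDensity g v x ∂(riemMeasure g) ≤ energy h v := by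
    have hhc := continuous_energyDensity h hv
    have hhs : HasCompactSupport (energyDensity h v) :=
      hasCompactSupport_of_eq_zero hc fun _ hx => energyDensity_eq_zero h hx
    refine le_trans ?_ (H.integral_ge hτ.continuous hτ0 h1 hhc hhs)
    rw [energy, ← integral_const_mul, ← integral_sub iv (i3.const_mul 3)]
    refine integral_mono (iv.sub (i3.const_mul 3)) ((integrable_of_continuous g hhc hhs).sub
      (integrable_mul_of_continuous g (hτ.continuous.pow 3) hhc.abs hhs.norm)) fun x => ?_
    exact H.energyDensity_ge hn hτ0 h1 v x
  have p6 : ∫ x, τ x ^ 3 * absDensity g v x ∂(riemMeasure g) ≤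
      ε * ∫ x, τ x ^ 2 * absDensity g v x ∂(riemMeasure g) := by
    rw [← integral_const_mul]
    refine integral_mono i3 (i2.const_mul ε) fun x => ?_
    by_cases hx : x ∈ tsupport v
    · have e1 := mul_nonneg (pow_nonneg (hτ0 x) 2) (absDensity_nonneg hn g v x)
      have e2 := mul_le_mul_of_nonneg_right (hτε x hx) e1
      simp only
      calc _ = τ x * (τ x ^ 2 * absDensity g v x) := by ring
        _ ≤ _ := e2
    · simp [absDensity_eq_zero g hx]
  have p7 : energy g v - 3 * (ε * (4 * energy g v + B * normSq g v)) ≤ energy h v := by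
    have := mul_le_mul_of_nonneg_left p1 hε0.le
    linarith
  have p8 : (1 - 12 * ε) * (r' * normSq g v) ≤ (1 - 12 * ε) * energy g v :=
    mul_le_mul_of_nonneg_left p2 (by linarith)
  have p9 : (r + |r| * ε) * normSq g v ≤ energy h v := by
    have e1 : (r + |r| * ε) * normSq g v ≤ (r' - 12 * ε * r' - 3 * ε * B) * normSq g v := by
      refine mul_le_mul_of_nonneg_right ?_ hNg
      have : 12 * ε * r' ≤ 12 * ε * |r'| :=
        mul_le_mul_of_nonneg_left (le_abs_self r') (by linarith)
      linarith
    nlinarith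
  refine le_trans ?_ p9
  rcases le_total 0 r with hr0 | hr0
  · rw [abs_of_nonneg hr0]
    nlinarith [mul_le_mul_of_nonneg_left p3 hr0]
  · rw [abs_of_nonpos hr0]
    have e2 : (1 - ε) * normSq g v ≤ normSq h v := by
      have := normSq_nonneg h v
      have e3 := mul_le_mul_of_nonneg_left p4 (show 0 ≤ 1 - ε by linarith)
      nlinarith [mul_nonneg (mul_nonneg hε0.le hε0.le) this]
    nlinarith [mul_le_mul_of_nonpos_left e2 hr0]

end Localization

/-! ### Closeness is an open condition on 2-jets -/

section Openness

variable {n : ℕ} {M : Type*} [TopologicalSpace M] [ChartedSpace (Model n) M]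
  [IsManifold (𝓡 n) ∞ M]

/-- The condition on the 2-jet of a metric in the chart `c` which expresses closeness to `g`. The
lengths are compared on the coordinate unit sphere only, which is enough by homogeneity and compact,
so that the condition is open. The bound `τ³ / 2` leaves room for a symmetric comparison. -/
structure JetClose (g : Metr n M) (τ : M → ℝ) (c : OpenPartialHomeomorph M (Model n))
    (p : Model n × JetSpace n) : Prop where
  mem_target : p.1 ∈ c.target
  det_pos : 0 < (Matrix.of p.2.1).det
  bil_lt : ∀ u ∈ Metric.sphere (0 : Model n) 1,
    |∑ i, ∑ j, p.2.1 i j * (u i * u j) -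
      ∑ i, ∑ j, (jetOf (metricCoord g c) p.1).1 i j * (u i * u j)| <
      τ (c.symm p.1) ^ 3 / 2 * ∑ i, ∑ j, (jetOf (metricCoord g c) p.1).1 i j * (u i * u j)
  density_lt : |Real.sqrt (Matrix.of p.2.1).det - chartDensity g c p.1| <
    τ (c.symm p.1) ^ 3 / 2 * chartDensity g c p.1
  scal_lt : |jetScalar p.2 - jetScalar (jetOf (metricCoord g c) p.1)| < τ (c.symm p.1) ^ 3

lemma isOpen_jetClose (g : Metr n M) {τ : M → ℝ} (hτ : Continuous τ)
    {c : OpenPartialHomeomorph M (Model n)} (hc : c ∈ atlas (Model n) M) :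
    IsOpen {p | JetClose g τ c p} := by
  rw [isOpen_iff_mem_nhds]
  intro p hp
  have hnhds := c.open_target.mem_nhds hp.mem_target
  have cJ : ContinuousAt (fun q : Model n × JetSpace n => jetOf (metricCoord g c) q.1) p :=
    ContinuousAt.comp (f := Prod.fst)
      ((continuousOn_jetOf_metricCoord g hc).continuousAt hnhds) continuousAt_fst
  have cD : ContinuousAt (fun q : Model n × JetSpace n => chartDensity g c q.1) p :=
    ContinuousAt.comp (f := Prod.fst)
      ((continuousOn_chartDensity g hc).continuousAt hnhds) continuousAt_fst
  have cT : ContinuousAt (fun q : Model n × JetSpace n => τ (c.symm q.1)) p :=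
    ContinuousAt.comp (f := fun q : Model n × JetSpace n => c.symm q.1) hτ.continuousAt
      (ContinuousAt.comp (f := Prod.fst) (c.continuousOn_symm.continuousAt hnhds) continuousAt_fst)
  have cdet : Continuous fun q : Model n × JetSpace n => (Matrix.of q.2.1).det :=
    Continuous.matrix_det (by fun_prop)
  have hopen : IsOpen {q : JetSpace n | (Matrix.of q.1).det ≠ 0} :=
    isOpen_ne_fun (Continuous.matrix_det (by fun_prop)) continuous_const
  have cS1 : ContinuousAt (fun q : Model n × JetSpace n => jetScalar q.2) p :=
    ContinuousAt.comp (f := Prod.snd)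
      (continuousOn_jetScalar.continuousAt (hopen.mem_nhds hp.det_pos.ne')) continuousAt_snd
  have cS2 : ContinuousAt
      (fun q : Model n × JetSpace n => jetScalar (jetOf (metricCoord g c) q.1)) p :=
    ContinuousAt.comp (f := fun q : Model n × JetSpace n => jetOf (metricCoord g c) q.1)
      (continuousOn_jetScalar.continuousAt
        (hopen.mem_nhds (det_metricCoord_pos g hc hp.mem_target).ne')) cJ
  have e1 : ∀ᶠ q : Model n × JetSpace n in 𝓝 p, q.1 ∈ c.target :=
    continuousAt_fst.eventually_mem hnhds
  have e2 : ∀ᶠ q : Model n × JetSpace n in 𝓝 p, 0 < (Matrix.of q.2.1).det :=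
    continuousAt_const.eventually_lt cdet.continuousAt hp.det_pos
  have e4 := ContinuousAt.eventually_lt (cdet.sqrt.continuousAt.sub cD).abs
    (((cT.pow 3).div_const 2).mul cD) hp.density_lt
  have e5 := ContinuousAt.eventually_lt (cS1.sub cS2).abs (cT.pow 3) hp.scal_lt
  have e3 : ∀ᶠ q : Model n × JetSpace n in 𝓝 p, ∀ u ∈ Metric.sphere (0 : Model n) 1,
      |∑ i, ∑ j, q.2.1 i j * (u i * u j) -
        ∑ i, ∑ j, (jetOf (metricCoord g c) q.1).1 i j * (u i * u j)| <
      τ (c.symm q.1) ^ 3 / 2 *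
        ∑ i, ∑ j, (jetOf (metricCoord g c) q.1).1 i j * (u i * u j) := by
    refine (isCompact_sphere (0 : Model n) 1).eventually_forall_of_forall_eventually fun u hu => ?_
    have cJ' : ContinuousAt (fun z : (Model n × JetSpace n) × Model n =>
        jetOf (metricCoord g c) z.1.1) (p, u) :=
      ContinuousAt.comp (f := Prod.fst)
        (g := fun q : Model n × JetSpace n => jetOf (metricCoord g c) q.1) cJ continuousAt_fst
    have cT' : ContinuousAt (fun z : (Model n × JetSpace n) × Model n =>
        τ (c.symm z.1.1)) (p, u) :=
      ContinuousAt.comp (f := Prod.fst)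
        (g := fun q : Model n × JetSpace n => τ (c.symm q.1)) cT continuousAt_fst
    have hu : ∀ i, ContinuousAt (fun z : (Model n × JetSpace n) × Model n => z.2 i) (p, u) :=
      fun i => by fun_prop
    have cB : ContinuousAt (fun z : (Model n × JetSpace n) × Model n =>
        ∑ i, ∑ j, (jetOf (metricCoord g c) z.1.1).1 i j * (z.2 i * z.2 j)) (p, u) :=
      tendsto_finsetSum _ fun i _ => tendsto_finsetSum _ fun j _ =>
        ContinuousAt.mul (continuousAt_pi.1 (continuousAt_pi.1 cJ'.fst i) j) ((hu i).mul (hu j))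
    have cA : ContinuousAt (fun z : (Model n × JetSpace n) × Model n =>
        ∑ i, ∑ j, z.1.2.1 i j * (z.2 i * z.2 j)) (p, u) :=
      tendsto_finsetSum _ fun i _ => tendsto_finsetSum _ fun j _ =>
        ContinuousAt.mul (by fun_prop) ((hu i).mul (hu j))
    exact ContinuousAt.eventually_lt (cA.sub cB).abs (((cT'.pow 3).div_const 2).mul cB)
      (hp.bil_lt u ‹_›)
  filter_upwards [e1, e2, e3, e4, e5] with q h1 h2 h3 h4 h5
  exact ⟨h1, h2, h3, h4, h5⟩

lemma jetClose_self (g : Metr n M) {τ : M → ℝ} (hτ : ∀ x, 0 < τ x)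
    {c : OpenPartialHomeomorph M (Model n)} (hc : c ∈ atlas (Model n) M) {x : M}
    (hx : x ∈ c.source) : JetClose g τ c (jetCoord c g x) := by
  have hy := c.map_source hx
  have hpos : 0 < τ (c.symm (c x)) ^ 3 := pow_pos (hτ _) 3
  refine ⟨hy, det_metricCoord_pos g hc hy, fun u hu => ?_, ?_, ?_⟩
  · have hu0 : u ≠ 0 := by
      rintro rfl; simp at hu
    have h1 : chartFrame c (c x) u ≠ 0 := fun h =>
      hu0 ((bijective_chartFrame hc hy).1 (h.trans (map_zero _).symm))
    have h2 := g.pos _ _ h1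
    rw [← bil_metricCoord, bil_apply] at h2
    have h3 : ∑ i, ∑ j, (jetCoord c g x).2.1 i j * (u i * u j) -
      ∑ i, ∑ j, (jetOf (metricCoord g c) (jetCoord c g x).1).1 i j * (u i * u j) = 0 := sub_self _
    rw [h3, abs_zero]
    exact mul_pos (half_pos hpos) h2
  · have h3 : Real.sqrt (Matrix.of (jetCoord c g x).2.1).det -
      chartDensity g c (jetCoord c g x).1 = 0 := sub_self _
    rw [h3, abs_zero]
    exact mul_pos (half_pos hpos) (chartDensity_pos g hc hy)
  · have h3 : jetScalar (jetCoord c g x).2 -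
      jetScalar (jetOf (metricCoord g c) (jetCoord c g x).1) = 0 := sub_self _
    rw [h3, abs_zero]
    exact hpos

/-- A relative error of at most `t / 2` in one direction is one of at most `t` in the other. -/
lemma le_of_abs_sub_lt {a b t : ℝ} (ht : 0 ≤ t) (ht1 : t ≤ 1) (ha : 0 ≤ a)
    (h : |b - a| ≤ t / 2 * a) : b ≤ (1 + t) * a ∧ a ≤ (1 + t) * b := by
  obtain ⟨h1, h2⟩ := abs_le.1 h
  constructor <;> nlinarith [mul_nonneg ht ha, mul_nonneg (mul_nonneg ht ha) (sub_nonneg.2 ht1)]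

/-- The jets are compared in a chart which may vary with the point. For lengths and scalar curvatures
this does not matter, and the ratio of two volume densities does not depend on the chart. -/
lemma close_of_jetClose (g h : Metr n M) {τ : M → ℝ} (hτ : ∀ x, 0 < τ x) (hτ1 : ∀ x, τ x ≤ 1)
    (H : ∀ x, ∃ c ∈ atlas (Model n) M, x ∈ c.source ∧ JetClose g τ c (jetCoord c h x)) :
    Close τ g h := by
  have h3 : ∀ x, 0 ≤ τ x ^ 3 := fun x => pow_nonneg (hτ x).le 3
  have h31 : ∀ x, τ x ^ 3 ≤ 1 := fun x => pow_le_one₀ (hτ x).le (hτ1 x)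
  have key : ∀ x (u : TangentSpace (𝓡 n) x), h.inner x u u ≤ (1 + τ x ^ 3) * g.inner x u u ∧
      g.inner x u u ≤ (1 + τ x ^ 3) * h.inner x u u := by
    intro x
    obtain ⟨c, hc, hx, hj⟩ := H x
    obtain ⟨y, hy, rfl⟩ : ∃ y ∈ c.target, x = c.symm y :=
      ⟨c x, c.map_source hx, (c.left_inv hx).symm⟩
    intro u
    obtain ⟨w, rfl⟩ := (bijective_chartFrame hc hy).2 u
    have hb := hj.bil_lt
    change ∀ u ∈ Metric.sphere (0 : Model n) 1,
      |∑ i, ∑ j, metricCoord h c (c (c.symm y)) i j * (u i * u j) -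
        ∑ i, ∑ j, metricCoord g c (c (c.symm y)) i j * (u i * u j)| <
      τ (c.symm (c (c.symm y))) ^ 3 / 2 *
        ∑ i, ∑ j, metricCoord g c (c (c.symm y)) i j * (u i * u j) at hb
    rw [c.right_inv hy] at hb
    simp only [← bil_apply] at hb
    by_cases hw : w = 0
    · subst hw; simp
    · have hn0 : 0 < ‖w‖ := norm_pos_iff.2 hw
      have h1 := hb (‖w‖⁻¹ • w) (by simp [norm_smul, hn0.ne'])
      have h2 : ∀ k : Metr n M, bil (metricCoord k c) y w w =
          ‖w‖ ^ 2 * bil (metricCoord k c) y (‖w‖⁻¹ • w) (‖w‖⁻¹ • w) := by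
        intro k
        simp only [map_smul, smul_apply, smul_eq_mul]
        field_simp
      have h4 : |bil (metricCoord h c) y w w - bil (metricCoord g c) y w w| ≤
          τ (c.symm y) ^ 3 / 2 * bil (metricCoord g c) y w w := by
        rw [h2 h, h2 g, ← mul_sub, abs_mul, abs_of_nonneg (sq_nonneg ‖w‖)]
        have := mul_le_mul_of_nonneg_left h1.le (sq_nonneg ‖w‖)
        linarith
      rw [bil_metricCoord, bil_metricCoord] at h4
      exact le_of_abs_sub_lt (h3 _) (h31 _) (inner_self_nonneg g _ _) h4
  have key2 : ∀ c ∈ atlas (Model n) M, ∀ y ∈ c.target,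
      chartDensity h c y ≤ (1 + τ (c.symm y) ^ 3) * chartDensity g c y ∧
      chartDensity g c y ≤ (1 + τ (c.symm y) ^ 3) * chartDensity h c y := by
    intro c' hc' y hy
    obtain ⟨c, hc, hx, hj⟩ := H (c'.symm y)
    have hov : y ∈ overlap c' c := mem_overlap.2 ⟨hy, hx⟩
    have hz : c.symm (c'.symm.trans c y) = c'.symm y := by simp [c.left_inv hx]
    have hd := hj.density_lt
    change |chartDensity h c (c'.symm.trans c y) - chartDensity g c (c'.symm.trans c y)| <
      τ (c.symm (c'.symm.trans c y)) ^ 3 / 2 * chartDensity g c (c'.symm.trans c y) at hd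
    rw [hz] at hd
    have hpos := chartDensity_pos g hc (y := c'.symm.trans c y)
      (by simpa using c.map_source hx)
    obtain ⟨q1, q2⟩ := le_of_abs_sub_lt (h3 _) (h31 _) hpos.le hd.le
    rw [chartDensity_transition g hc' hc hov, chartDensity_transition h hc' hc hov]
    have hab := abs_nonneg (fderiv ℝ (c'.symm.trans c) y).det
    constructor
    · have := mul_le_mul_of_nonneg_left q1 hab; linarith
    · have := mul_le_mul_of_nonneg_left q2 hab; linarith
  refine ⟨fun x u => (key x u).1, fun x u => (key x u).2, fun c hc y hy => (key2 c hc y hy).1,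
    fun c hc y hy => (key2 c hc y hy).2, fun x => ?_⟩
  obtain ⟨c, hc, hx, hj⟩ := H x
  have hs := hj.scal_lt
  change |jetScalar (jetOf (metricCoord h c) (c x)) - jetScalar (jetOf (metricCoord g c) (c x))| <
    τ (c.symm (c x)) ^ 3 at hs
  rw [← scal_eq h hc hx, ← scal_eq g hc hx, c.left_inv hx] at hs
  exact hs.le

/-- The metrics close to `g` contain a neighbourhood of `g` in the fine C²-topology. -/
lemma exists_isOpen_forall_close (g : Metr n M) {τ : M → ℝ} (hτc : Continuous τ)
    (hτ : ∀ x, 0 < τ x) (hτ1 : ∀ x, τ x ≤ 1) :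
    ∃ S : Set (Metr n M), IsOpen S ∧ g ∈ S ∧ ∀ h ∈ S, Close τ g h := by
  set U : Set (TwoJet n M) := ⋃ c ∈ atlas (Model n) M, {η | ∃ (x : M) (h : Metr n M),
    x ∈ c.source ∧ jetCoord c h x ∈ {p | JetClose g τ c p} ∧ η = j2 h x} with hU
  have hUo : IsOpen U := isOpen_biUnion fun c hc =>
    TopologicalSpace.isOpen_generateFrom_of_mem
      ⟨c, hc, {p | JetClose g τ c p}, isOpen_jetClose g hτc hc, rfl⟩
  refine ⟨{h | range (j2 h) ⊆ U}, fun h hh => ⟨U, hUo, hh, subset_rfl⟩, ?_, fun h hh => ?_⟩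
  · rintro _ ⟨x, rfl⟩
    exact mem_biUnion (chart_mem_atlas (Model n) x) ⟨x, g, mem_chart_source _ x,
      jetClose_self g hτ (chart_mem_atlas _ x) (mem_chart_source _ x), rfl⟩
  · refine close_of_jetClose g h hτ hτ1 fun x => ?_
    obtain ⟨c, hc, x', h', hx', hj, he⟩ := mem_iUnion₂.1 (hh ⟨x, rfl⟩)
    obtain ⟨h1, h2⟩ := Quotient.exact he
    simp only at h1 h2
    subst h1
    exact ⟨c, hc, hx', by rw [h2 c hc hx']; exact hj⟩

end Openness

/-! ### The Yamabe constant at infinity as a supremum -/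

section Supremum

variable {n : ℕ} {M : Type*} [TopologicalSpace M] [ChartedSpace (Model n) M]
  [IsManifold (𝓡 n) ∞ M] [MeasurableSpace M]

lemma yamabeConstant_anti (g : Metr n M) {U V : Set M} (h : U ⊆ V) :
    yamabeConstant g V ≤ yamabeConstant g U :=
  biInf_mono fun _ hv => ⟨hv.1, hv.2.1, hv.2.2.1.trans h, hv.2.2.2⟩

/-- The supremum of the Yamabe constants of complements of compact sets. -/
def supYamabe (g : Metr n M) : EReal := ⨆ (K : Set M) (_ : IsCompact K), yamabeConstant g Kᶜ

lemma tendsto_supYamabe (g : Metr n M) (K : CompactExhaustion M) :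
    Tendsto (fun i : ℕ => yamabeConstant g (K i)ᶜ) atTop (𝓝 (supYamabe g)) := by
  have hmono : Monotone fun i : ℕ => yamabeConstant g (K i)ᶜ := fun i j hij =>
    yamabeConstant_anti g (compl_subset_compl.2 (K.subset hij))
  have h : supYamabe g = ⨆ i, yamabeConstant g (K i)ᶜ := by
    refine le_antisymm (iSup₂_le fun L hL => ?_) (iSup_le fun i =>
      le_iSup₂_of_le (K i) (K.isCompact i) le_rfl)
    obtain ⟨i, hi⟩ := K.exists_superset_of_isCompact hL
    exact le_iSup_of_le i (yamabeConstant_anti g (compl_subset_compl.2 hi))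
  rw [h]
  exact tendsto_atTop_iSup hmono

lemma yamabeInfinity_eq [T2Space M] [SecondCountableTopology M] (g : Metr n M) :
    yamabeInfinity g = supYamabe g :=
  (tendsto_supYamabe g _).limUnder_eq

variable [BorelSpace M]

lemma le_yamabeConstant_iff (hn : 3 ≤ n) (g : Metr n M) (U : Set M) (r : ℝ) :
    (r : EReal) ≤ yamabeConstant g U ↔
      ∀ v ∈ testFunctions n U, r * normSq g v ≤ energy g v := by
  rw [yamabeConstant, le_iInf₂_iff]
  refine forall₂_congr fun v hv => ?_
  have hN := normSq_pos hn g hv.1.continuous hv.2.1 hv.2.2.2.2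
  rw [EReal.coe_le_coe_iff, yamabeFunctional_eq, one_div, inv_mul_eq_div, le_div_iff₀ hN]

/-- Only one of two close metrics is required to have its weight in `L^{n/2}`; the reverse inequality
follows from symmetry of closeness and `Close.integrable_weight`. -/
lemma Close.supYamabe_le (hn : 3 ≤ n) {τ : M → ℝ} {g h : Metr n M} (H : Close τ g h)
    (hτ : ContMDiff (𝓡 n) 𝓘(ℝ, ℝ) ∞ τ) (h0 : ∀ x, 0 < τ x) (h1 : ∀ x, τ x ≤ 1)
    (hlim : Tendsto τ (cocompact M) (𝓝 0))
    (hw : Integrable (fun x => weight g τ x ^ ((n : ℝ) / 2)) (riemMeasure g)) :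
    supYamabe g ≤ supYamabe h := by
  refine le_of_forall_lt_imp_le_of_dense fun c hc => ?_
  obtain ⟨r, hcr, hr⟩ := EReal.lt_iff_exists_real_btwn.1 hc
  obtain ⟨r', hrr', hr'⟩ := EReal.lt_iff_exists_real_btwn.1 hr
  obtain ⟨K, hK⟩ := lt_iSup_iff.1 hr'
  obtain ⟨hKc, hK⟩ := lt_iSup_iff.1 hK
  obtain ⟨K', hK'c, hK'⟩ := H.exists_isCompact hn hτ h0 h1 hlim hw hKc
    (EReal.coe_lt_coe_iff.1 hrr') ((le_yamabeConstant_iff hn g _ r').1 hK.le)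
  exact hcr.le.trans (le_iSup₂_of_le K' hK'c ((le_yamabeConstant_iff hn h _ r).2 hK'))

/-- The weight of a close metric is also in `L^{n/2}`. -/
lemma Close.integrable_weight (hn : 3 ≤ n) {τ : M → ℝ} {g h : Metr n M} (H : Close τ g h)
    (hτ : ContMDiff (𝓡 n) 𝓘(ℝ, ℝ) ∞ τ) (h0 : ∀ x, 0 < τ x) (h1 : ∀ x, τ x ≤ 1)
    (hw : Integrable (fun x => weight g τ x ^ ((n : ℝ) / 2)) (riemMeasure g)) :
    Integrable (fun x => weight h τ x ^ ((n : ℝ) / 2)) (riemMeasure h) := by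
  have hn2 : (0 : ℝ) ≤ n / 2 := by positivity
  have hcont : ∀ g : Metr n M, Continuous fun x => weight g τ x ^ ((n : ℝ) / 2) := fun g =>
    (continuous_weight g hτ).rpow_const fun _ => Or.inr hn2
  have h31 : ∀ x, τ x ^ 3 ≤ 1 := fun x => pow_le_one₀ (h0 x).le (h1 x)
  have hwle : ∀ x, weight h τ x ≤ 2 * weight g τ x := by
    intro x
    have d1 := H.dualSq_le (fun x => (h0 x).le) x (dfun τ x)
    have d2 := H.scal_sub_le x
    have d3 : |scal h x| ≤ |scal g x| + 1 := by
      have := abs_sub_abs_le_abs_sub (scal h x) (scal g x)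
      linarith [h31 x]
    have d4 := dualSq_nonneg g x (dfun τ x)
    have d5 : dualSq h x (dfun τ x) ≤ 2 * dualSq g x (dfun τ x) := by
      nlinarith [h31 x]
    have d6 : τ x ^ 2 * (1 + |scal h x|) ≤ τ x ^ 2 * (2 * (1 + |scal g x|)) := by
      gcongr
      linarith [abs_nonneg (scal g x)]
    simp only [weight, normSqDiff_eq]
    linarith
  have hnn : ∀ (g : Metr n M) x, 0 ≤ weight g τ x ^ ((n : ℝ) / 2) := fun g x =>
    Real.rpow_nonneg (weight_nonneg g τ x) _
  refine ⟨(hcont h).aestronglyMeasurable, ?_⟩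
  rw [hasFiniteIntegral_iff_ofReal (ae_of_all _ (hnn h))]
  have hwint := hw.const_mul (2 * 2 ^ ((n : ℝ) / 2))
  have hfin := (hasFiniteIntegral_iff_ofReal (ae_of_all _ fun x =>
    mul_nonneg (by positivity) (hnn g x))).1 hwint.2
  refine lt_of_le_of_lt ((H.lintegral_le hτ.continuous (fun x => (h0 x).le)
    (hcont h).measurable.ennreal_ofReal).trans (lintegral_mono fun x => ?_)) hfin
  rw [← ENNReal.ofReal_mul (by have := pow_pos (h0 x) 3; positivity)]
  refine ENNReal.ofReal_le_ofReal ?_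
  calc (1 + τ x ^ 3) * weight h τ x ^ ((n : ℝ) / 2)
      ≤ 2 * (2 * weight g τ x) ^ ((n : ℝ) / 2) := by
        gcongr
        · exact hnn h x
        · linarith [h31 x]
        · exact weight_nonneg h τ x
        · exact hwle x
    _ = 2 * 2 ^ ((n : ℝ) / 2) * weight g τ x ^ ((n : ℝ) / 2) := by
        rw [Real.mul_rpow (by norm_num) (weight_nonneg g τ x), mul_assoc]

end Supremum

/-! ### Functions which decay rapidly at infinity -/

section Decay

variable {n : ℕ} {M : Type*} [TopologicalSpace M] [ChartedSpace (Model n) M]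
  [IsManifold (𝓡 n) ∞ M]

omit [IsManifold (𝓡 n) ∞ M] in
lemma dfun_const_mul {v : M → ℝ} {x : M} (hv : MDifferentiableAt (𝓡 n) 𝓘(ℝ, ℝ) v x) (c : ℝ) :
    dfun (n := n) (fun z => c * v z) x = c • dfun v x :=
  dfun_comp (φ := fun t => c * t) (by simpa using (hasDerivAt_id (v x)).const_mul c) hv

omit [IsManifold (𝓡 n) ∞ M] in
lemma dfun_add {f v : M → ℝ} {x : M} (hf : MDifferentiableAt (𝓡 n) 𝓘(ℝ, ℝ) f x)
    (hv : MDifferentiableAt (𝓡 n) 𝓘(ℝ, ℝ) v x) :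
    dfun (n := n) (fun z => f z + v z) x = dfun f x + dfun v x :=
  (hf.hasMFDerivAt.add hv.hasMFDerivAt).mfderiv

omit [IsManifold (𝓡 n) ∞ M] in
lemma dfun_sum {ι : Type*} (s : Finset ι) {v : ι → M → ℝ} {x : M}
    (hv : ∀ i, MDifferentiableAt (𝓡 n) 𝓘(ℝ, ℝ) (v i) x) :
    MDifferentiableAt (𝓡 n) 𝓘(ℝ, ℝ) (fun z => ∑ i ∈ s, v i z) x ∧
      dfun (n := n) (fun z => ∑ i ∈ s, v i z) x = ∑ i ∈ s, dfun (v i) x := by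
  classical
  induction s using Finset.induction_on with
  | empty => exact ⟨mdifferentiableAt_const, mfderiv_const⟩
  | insert i s hi ih =>
    simp only [Finset.sum_insert hi]
    exact ⟨(hv i).add ih.1, by rw [dfun_add (hv i) ih.1, ih.2]⟩

/-- On a manifold with a compact exhaustion `(Kⱼ)`, there is a positive smooth function which is
bounded by `bⱼ` on `Kⱼ ∖ Kⱼ₋₁`, as is the norm of its differential. -/
lemma exists_contMDiff_le [T2Space M] [SecondCountableTopology M] (g : Metr n M)
    (K : CompactExhaustion M) {b : ℕ → ℝ} (hb : ∀ j, 0 < b j) (hba : Antitone b) :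
    ∃ τ : M → ℝ, ContMDiff (𝓡 n) 𝓘(ℝ, ℝ) ∞ τ ∧ (∀ x, 0 < τ x) ∧
      (∀ x, τ x ≤ b (K.find x)) ∧ ∀ x, normSqDiff g τ x ≤ b (K.find x) ^ 2 := by
  have : LocallyCompactSpace M := ChartedSpace.locallyCompactSpace (Model n) M
  obtain ⟨φ, hφ⟩ := SmoothPartitionOfUnity.exists_isSubordinate (𝓡 n) (s := (univ : Set M))
    isClosed_univ (fun i : ℕ => interior (K (i + 1))) (fun i => isOpen_interior)
    (fun x _ => mem_iUnion.2 ⟨K.find x, K.subset_interior_succ _ (K.mem_find x)⟩)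
  have hsm : ∀ i, ContMDiff (𝓡 n) 𝓘(ℝ, ℝ) ∞ (φ i) := fun i => (φ i).contMDiff
  have hd : ∀ i x, MDifferentiableAt (𝓡 n) 𝓘(ℝ, ℝ) (φ i) x := fun i x =>
    (hsm i).mdifferentiableAt (by simp)
  have hbound : ∀ i, ∃ m : ℝ, 0 ≤ m ∧ ∀ x ∈ K (i + 1), normSqDiff g (φ i) x ≤ m ^ 2 := by
    intro i
    obtain ⟨m, hm⟩ := (K.isCompact (i + 1)).bddAbove_image
      (continuous_normSqDiff g (hsm i)).continuousOn
    refine ⟨1 + |m|, by positivity, fun x hx => ?_⟩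
    have h1 := hm (mem_image_of_mem _ hx)
    nlinarith [le_abs_self m, abs_nonneg m]
  choose m hm0 hm using hbound
  set c : ℕ → ℝ := fun i => (1 / 2) ^ i / 2 * b (i + 1) / (1 + m i) with hc
  have hc0 : ∀ i, 0 < c i := fun i => by
    have := hb (i + 1)
    have := hm0 i
    simp only [hc]; positivity
  have hfind : ∀ {i x}, x ∈ tsupport (φ i) → K.find x ≤ i + 1 := fun {i x} hx =>
    K.mem_iff_find_le.1 (interior_subset (hφ i hx))
  -- The `i`-th term contributes at most `2⁻ⁱ⁻¹ b`, both to the function and to its differential.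
  have hcb : ∀ {i x}, x ∈ tsupport (φ i) →
      c i * (1 + m i) ≤ (1 / 2) ^ i / 2 * b (K.find x) := fun {i x} hx => by
    have h1 := hm0 i
    have h2 := hba (hfind hx)
    simp only [hc]
    rw [div_mul_cancel₀ _ (by positivity)]
    gcongr
  have hgeom : ∀ s : Finset ℕ, ∑ i ∈ s, (1 / 2 : ℝ) ^ i / 2 ≤ 1 := fun s => by
    have h := summable_geometric_two.sum_le_tsum s (fun i _ => by positivity)
    rw [tsum_geometric_two] at h
    rw [← Finset.sum_div]
    linarith
  set τ : M → ℝ := fun x => ∑ᶠ i, c i * φ i x with hτ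
  have hτsum : ∀ x, τ =ᶠ[𝓝 x] fun y => ∑ i ∈ φ.fintsupport x, c i * φ i y := by
    intro x
    filter_upwards [φ.eventually_finsupport_subset x] with y hy
    refine finsum_eq_sum_of_support_subset _ fun i hi => hy ?_
    rw [SmoothPartitionOfUnity.mem_finsupport]
    exact right_ne_zero_of_mul hi
  have hτeq : ∀ x, τ x = ∑ i ∈ φ.fintsupport x, c i * φ i x := fun x => (hτsum x).eq_of_nhds
  refine ⟨τ, ?_, fun x => ?_, fun x => ?_, fun x => ?_⟩
  · have h := φ.contMDiff_finsum_smul (n := ⊤) (g := fun i (_ : M) => c i)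
      (fun i x _ => contMDiffAt_const)
    refine h.congr fun x => ?_
    simp only [hτ, smul_eq_mul, mul_comm]
  · obtain ⟨i, hi⟩ := φ.exists_pos_of_mem (mem_univ x)
    rw [hτeq]
    refine Finset.sum_pos' (fun j _ => mul_nonneg (hc0 j).le (φ.nonneg j x))
      ⟨i, ?_, mul_pos (hc0 i) hi⟩
    rw [SmoothPartitionOfUnity.mem_fintsupport_iff]
    exact subset_tsupport _ hi.ne'
  · rw [hτeq]
    calc ∑ i ∈ φ.fintsupport x, c i * φ i x
        ≤ ∑ i ∈ φ.fintsupport x, (1 / 2) ^ i / 2 * b (K.find x) := by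
          refine Finset.sum_le_sum fun i hi => le_trans ?_
            (hcb ((SmoothPartitionOfUnity.mem_fintsupport_iff _ _ _).1 hi))
          have := (hc0 i).le
          have := φ.le_one i x
          have := hm0 i
          gcongr
          linarith
      _ ≤ 1 * b (K.find x) := by
          rw [← Finset.sum_mul]
          exact mul_le_mul_of_nonneg_right (hgeom _) (hb _).le
      _ = _ := one_mul _
  · have hdf : dfun (n := n) τ x = ∑ i ∈ φ.fintsupport x, c i • dfun (φ i) x := by
      have h1 : dfun (n := n) τ x = dfun (fun y => ∑ i ∈ φ.fintsupport x, c i * φ i y) x :=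
        (hτsum x).mfderiv_eq
      rw [h1, (dfun_sum (v := fun i y => c i * φ i y) _
        fun i => mdifferentiableAt_const.mul (hd i x)).2]
      exact Finset.sum_congr rfl fun i _ => dfun_const_mul (hd i x) _
    refine dualSq_le g x _ (by positivity) fun w => ?_
    have hgw := inner_self_nonneg g x w
    rw [← Real.sq_sqrt hgw, ← mul_pow, ← sq_abs]
    gcongr
    set q := Real.sqrt (g.inner x w w) with hq
    have hterm : ∀ i ∈ φ.fintsupport x,
        |c i * dfun (φ i) x w| ≤ (1 / 2) ^ i / 2 * (b (K.find x) * q) := by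
      intro i hi
      have hi := (SmoothPartitionOfUnity.mem_fintsupport_iff _ _ _).1 hi
      have h1 : |dfun (φ i) x w| ≤ m i * q := by
        refine abs_le_of_sq_le_sq ?_ (mul_nonneg (hm0 i) (Real.sqrt_nonneg _))
        rw [mul_pow, hq, Real.sq_sqrt hgw]
        refine (apply_sq_le_dualSq g x _ w).trans ?_
        gcongr
        exact hm i x (interior_subset (hφ i hi))
      rw [abs_mul, abs_of_pos (hc0 i), ← mul_assoc]
      have h2 := hcb hi
      calc c i * |dfun (φ i) x w| ≤ c i * (m i * q) := by
            have := (hc0 i).le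
            gcongr
        _ ≤ c i * (1 + m i) * q := by
            rw [mul_assoc]
            have := (hc0 i).le
            gcongr
            linarith
        _ ≤ _ := by
            gcongr
    have hsum : dfun (n := n) τ x w = ∑ i ∈ φ.fintsupport x, c i * dfun (φ i) x w := by
      rw [hdf]
      generalize φ.fintsupport x = s
      induction s using Finset.induction_on with
      | empty => simp
      | insert i s hi ih => rw [Finset.sum_insert hi, Finset.sum_insert hi, ← ih]; rfl
    change |dfun (n := n) τ x w| ≤ _
    rw [hsum]
    calc |∑ i ∈ φ.fintsupport x, c i * dfun (φ i) x w|
        ≤ ∑ i ∈ φ.fintsupport x, (1 / 2) ^ i / 2 * (b (K.find x) * q) :=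
          (Finset.abs_sum_le_sum_abs _ _).trans (Finset.sum_le_sum hterm)
      _ ≤ 1 * (b (K.find x) * q) := by
          rw [← Finset.sum_mul]
          exact mul_le_mul_of_nonneg_right (hgeom _)
            (mul_nonneg (hb _).le (Real.sqrt_nonneg _))
      _ = _ := one_mul _

variable [MeasurableSpace M] [BorelSpace M]

/-- Every metric has a positive function which tends to zero so rapidly that its weight is in
`L^{n/2}`. -/
lemma exists_integrable_weight [T2Space M] [SecondCountableTopology M] (hn : 3 ≤ n)
    (g : Metr n M) :
    ∃ τ : M → ℝ, ContMDiff (𝓡 n) 𝓘(ℝ, ℝ) ∞ τ ∧ (∀ x, 0 < τ x) ∧ (∀ x, τ x ≤ 1) ∧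
      Tendsto τ (cocompact M) (𝓝 0) ∧
      Integrable (fun x => weight g τ x ^ ((n : ℝ) / 2)) (riemMeasure g) := by
  set K := someExhaustion n M
  have hfin : ∀ j, riemMeasure g (K j) ≠ ⊤ := fun j => (K.isCompact j).measure_lt_top.ne
  have hbound : ∀ j, ∃ s : ℝ, 0 ≤ s ∧ ∀ x ∈ K j, |scal g x| ≤ s := by
    intro j
    obtain ⟨s, hs⟩ := (K.isCompact j).bddAbove_image (continuous_scal g).abs.continuousOn
    exact ⟨|s|, abs_nonneg s, fun x hx => (hs (mem_image_of_mem _ hx)).trans (le_abs_self s)⟩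
  choose s hs0 hs using hbound
  set μ : ℕ → ℝ := fun j => (riemMeasure g (K j)).toReal with hμ
  have hμ0 : ∀ j, 0 ≤ μ j := fun j => ENNReal.toReal_nonneg
  -- Summing makes the denominators monotone in `j`.
  set Q : ℕ → ℝ := fun j => ∑ i ∈ Finset.range (j + 1), (2 + s i) * (1 + μ i) with hQ
  have hq0 : ∀ j, 1 ≤ (2 + s j) * (1 + μ j) := fun j => by
    nlinarith [hs0 j, hμ0 j, mul_nonneg (hs0 j) (hμ0 j)]
  have hqQ : ∀ j, (2 + s j) * (1 + μ j) ≤ Q j := fun j =>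
    Finset.single_le_sum (f := fun i => (2 + s i) * (1 + μ i))
      (fun i _ => zero_le_one.trans (hq0 i)) (by simp)
  have hQ1 : ∀ j, 1 ≤ Q j := fun j => (hq0 j).trans (hqQ j)
  have hQmono : Monotone Q := monotone_nat_of_le_succ fun j => by
    simp only [hQ]
    rw [Finset.sum_range_succ _ (j + 1)]
    linarith [hq0 (j + 1)]
  set b : ℕ → ℝ := fun j => (1 / 2) ^ j / Q j with hb
  have hb0 : ∀ j, 0 < b j := fun j => by
    have := hQ1 j
    simp only [hb]; positivity
  have hba : Antitone b := fun i j hij => by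
    have := hQ1 i
    have := hQmono hij
    have : (1 / 2 : ℝ) ^ j ≤ (1 / 2) ^ i := pow_le_pow_of_le_one (by norm_num) (by norm_num) hij
    simp only [hb]
    gcongr
  have hb2 : ∀ j, b j ≤ (1 / 2) ^ j := fun j => div_le_self (by positivity) (hQ1 j)
  have hp1 : ∀ j, (1 / 2 : ℝ) ^ j ≤ 1 := fun j => pow_le_one₀ (by norm_num) (by norm_num)
  have hb1 : ∀ j, b j ≤ 1 := fun j => (hb2 j).trans (hp1 j)
  have hbw : ∀ j, b j ^ 2 * (2 + s j) ≤ (1 / 2) ^ j / (1 + μ j) := fun j => by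
    have h1 := hs0 j
    have h2 := hμ0 j
    have h3 : b j ^ 2 ≤ b j := pow_le_of_le_one (hb0 j).le (hb1 j) two_ne_zero
    calc b j ^ 2 * (2 + s j) ≤ b j * (2 + s j) := by gcongr
      _ ≤ (1 / 2) ^ j / ((2 + s j) * (1 + μ j)) * (2 + s j) := by
          have := hqQ j
          simp only [hb]
          gcongr
      _ = _ := by field_simp
  obtain ⟨τ, hτ, h0, hle, hd⟩ := exists_contMDiff_le g K hb0 hba
  have hwle : ∀ x, weight g τ x ≤ (1 / 2) ^ (K.find x) / (1 + μ (K.find x)) := by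
    intro x
    refine le_trans ?_ (hbw (K.find x))
    have h1 := hs _ x (K.mem_find x)
    have h2 : τ x ^ 2 * (1 + |scal g x|) ≤ b (K.find x) ^ 2 * (1 + s (K.find x)) := by
      have := (h0 x).le
      have := hle x
      gcongr
    have h3 := hd x
    simp only [weight]
    linarith
  have hn2 : (1 : ℝ) ≤ n / 2 := by
    have : (3 : ℝ) ≤ n := by exact_mod_cast hn
    linarith
  have hwpow : ∀ x, weight g τ x ^ ((n : ℝ) / 2) ≤
      (1 / 2) ^ (K.find x) / (1 + μ (K.find x)) := by
    intro x
    refine le_trans ?_ (hwle x)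
    have h1 : weight g τ x ≤ 1 := (hwle x).trans
      ((div_le_self (by positivity) (by linarith [hμ0 (K.find x)])).trans (hp1 _))
    rcases eq_or_lt_of_le (weight_nonneg g τ x) with h | h
    · rw [← h, Real.zero_rpow (by linarith)]
    · exact (Real.rpow_le_rpow_of_exponent_ge h h1 hn2).trans (Real.rpow_one _).le
  refine ⟨τ, hτ, h0, fun x => (hle x).trans (hb1 _), ?_, ?_, ?_⟩
  · rw [Metric.tendsto_nhds]
    intro ε hε
    obtain ⟨j, hj⟩ := exists_pow_lt_of_lt_one hε (show (1 / 2 : ℝ) < 1 by norm_num)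
    filter_upwards [(K.isCompact j).compl_mem_cocompact] with x hx
    rw [Real.dist_0_eq_abs, abs_of_pos (h0 x)]
    have h1 : j ≤ K.find x := by
      by_contra h
      exact hx (K.mem_iff_find_le.2 (not_le.1 h).le)
    exact lt_of_le_of_lt ((hle x).trans ((hba h1).trans (hb2 j))) hj
  · exact ((continuous_weight g hτ).rpow_const fun _ =>
      Or.inr (zero_le_one.trans hn2)).aestronglyMeasurable
  · rw [hasFiniteIntegral_iff_ofReal
      (ae_of_all _ fun x => Real.rpow_nonneg (weight_nonneg g τ x) _)]
    have hmeas : ∀ j, MeasurableSet (K j) := fun j => (K.isCompact j).measurableSet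
    calc ∫⁻ x, ENNReal.ofReal (weight g τ x ^ ((n : ℝ) / 2)) ∂(riemMeasure g)
        ≤ ∫⁻ x, ∑' j, (K j).indicator
            (fun _ => ENNReal.ofReal ((1 / 2) ^ j / (1 + μ j))) x ∂(riemMeasure g) := by
          refine lintegral_mono fun x => ?_
          refine le_trans ?_ (ENNReal.le_tsum (K.find x))
          rw [indicator_of_mem (K.mem_find x)]
          exact ENNReal.ofReal_le_ofReal (hwpow x)
      _ = ∑' j, ENNReal.ofReal ((1 / 2) ^ j / (1 + μ j)) * riemMeasure g (K j) := by
          rw [lintegral_tsum fun j => (measurable_const.indicator (hmeas j)).aemeasurable]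
          exact tsum_congr fun j => lintegral_indicator_const (hmeas j) _
      _ ≤ ∑' j, ENNReal.ofReal ((1 / 2) ^ j) := by
          refine ENNReal.tsum_le_tsum fun j => ?_
          have h1 := hμ0 j
          rw [← ENNReal.ofReal_toReal (hfin j), ← ENNReal.ofReal_mul (by positivity)]
          refine ENNReal.ofReal_le_ofReal ?_
          rw [div_mul_eq_mul_div, div_le_iff₀ (by positivity)]
          have : μ j ≤ 1 + μ j := by linarith
          gcongr
      _ < ⊤ := summable_geometric_two.tsum_ofReal_lt_top

end Decay

end YamabeInfinity

end

theorem mainTheorem2 (n : ℕ) (hn : 3 ≤ n) (M : Type*) [TopologicalSpace M]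
    [ChartedSpace (YamabeInfinity.Model n) M] [IsManifold (𝓡 n) ∞ M]
    [T2Space M] [SecondCountableTopology M] [NoncompactSpace M]
    [MeasurableSpace M] [BorelSpace M] :
    (∀ (g : YamabeInfinity.Metr n M) (K : CompactExhaustion M),
      Tendsto (fun i : ℕ => YamabeInfinity.yamabeConstant g (K i)ᶜ) atTop
        (𝓝 (YamabeInfinity.yamabeInfinity g))) ∧
    IsLocallyConstant
      (fun g : YamabeInfinity.Metr n M => YamabeInfinity.yamabeInfinity g) ∧
    Continuous
      (fun g : YamabeInfinity.Metr n M => YamabeInfinity.yamabeInfinity g) := by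
  have hloc : IsLocallyConstant
      (fun g : YamabeInfinity.Metr n M => YamabeInfinity.yamabeInfinity g) := by
    rw [IsLocallyConstant.iff_exists_open]
    intro g
    obtain ⟨τ, hτ, h0, h1, hlim, hw⟩ := YamabeInfinity.exists_integrable_weight hn g
    obtain ⟨S, hS, hgS, hclose⟩ :=
      YamabeInfinity.exists_isOpen_forall_close g hτ.continuous h0 h1
    refine ⟨S, hS, hgS, fun h hh => ?_⟩
    have H := hclose h hh
    rw [YamabeInfinity.yamabeInfinity_eq, YamabeInfinity.yamabeInfinity_eq]
    exact le_antisymm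
      (H.symm.supYamabe_le hn hτ h0 h1 hlim (H.integrable_weight hn hτ h0 h1 hw))
      (H.supYamabe_le hn hτ h0 h1 hlim hw)
  refine ⟨fun g K => ?_, hloc, hloc.continuous⟩
  rw [YamabeInfinity.yamabeInfinity_eq]
  exact YamabeInfinity.tendsto_supYamabe g K
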